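/- Let $(M,\omega)$ be a (smooth, Hausdorff, $\sigma$-compact, finite-dimensional) symplectic manifold with a smooth Lagrangian distribution $\Lambda\subset TM$, let $H:M\to\mathbb R$ be smooth, let $\vec H$ be its Hamiltonian vector field, $\omega(\vec H,\cdot)=-dH$, and let $\varphi_t$ be the (maximal) flow of $\vec H$. Assume that (a) $\vec H$ is monotone: the symmetric bilinear form $\langle V_1,V_2\rangle=\omega([\vec H,V_1],V_2)$, for local sections $V_1,V_2$ of $\Lambda$, is positive definite, i.e. it is a Riemannian metric on $\Lambda$; (b) the flow has no conjugate points on $M$: for every $\alpha\in M$ and every $t\neq 0$ for which $\varphi_t(\alpha)$ is defined, $d\varphi_t(\Lambda_\alpha)$ and $\Lambda_{\varphi_t(\alpha)}$ are transversal in $T_{\varphi_t(\alpha)}M$. Let $c$ be a regular value of $H$ such that $\Sigma_c=H^{-1}(c)$ is compact. For $\alpha\in\Sigma_c$ let $J_\alpha(t)=(d\varphi_t)^{-1}(\Lambda_{\varphi_t(\alpha)})\subset T_\alpha M$. Then the limits $$\Delta^{+}_\alpha=\lim_{t\to+\infty}J_\alpha(t),\qquad \Delta^{-}_\alpha=\lim_{t\to-\infty}J_\alpha(t)$$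 exist in the Grassmannian of $T_\alpha M$ for every $\alpha\in\Sigma_c$, and the following are equivalent: 1. The flow $\varphi_t$ is Anosov on $\Sigma_c$: there are a Riemannian metric on $\Sigma_c$, a splitting $T\Sigma_c=\mathbb R\vec H\oplus E^+\oplus E^-$ with $d\varphi_t(E^\pm)=E^\pm$ for all $t$, and constants $c_1,c_2>0$ such that $|d\varphi_{\pm t}(v)|\le c_1e^{-c_2t}|v|$ for all $v\in E^\pm$ and all $t\ge 0$. 2. $\Delta^+$ and $\Delta^-$ are transversal in $T\Sigma_c$: $\Delta^+_\alpha+\Delta^-_\alpha=T_\alpha\Sigma_c$ for every $\alpha\in\Sigma_c$. 3. $\Delta^+_\alpha\cap\Delta^-_\alpha=\mathrm{span}\{\vec H(\alpha)\}$ for every $\alpha\in\Sigma_c$. -/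

import Mathlib

open scoped Manifold ContDiff Topology
open Set Filter

noncomputable section

namespace MonotoneHam

section Manifold

variable {E : Type*} [NormedAddCommGroup E] [NormedSpace ℝ E]
  {M : Type*} [TopologicalSpace M] [ChartedSpace E M]

/-- The derivative `dH_x(v)` of a real function `H`. -/
def dirDeriv (H : M → ℝ) (x : M) (v : TangentSpace 𝓘(ℝ, E) x) : ℝ :=
  mfderiv 𝓘(ℝ, E) 𝓘(ℝ, ℝ) H x v

/-- The vector field `V` is smooth near the point `x`. -/
def SmoothFieldAt [IsManifold 𝓘(ℝ, E) ∞ M] (V : Π y : M, TangentSpace 𝓘(ℝ, E) y) (x : M) : Prop :=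
  ∃ U : Set M, IsOpen U ∧ x ∈ U ∧
    ContMDiffOn 𝓘(ℝ, E) 𝓘(ℝ, E).tangent ∞ (fun y => (⟨y, V y⟩ : TangentBundle 𝓘(ℝ, E) M)) U

/-- `Ω` is a symplectic form: a smooth, alternating, nondegenerate and closed two-form.
Closedness is `dΩ = 0`, evaluated on local smooth vector fields by Cartan's formula. -/
structure IsSymplecticForm [IsManifold 𝓘(ℝ, E) ∞ M]
    (Ω : Π x : M, TangentSpace 𝓘(ℝ, E) x →L[ℝ] TangentSpace 𝓘(ℝ, E) x →L[ℝ] ℝ) : Prop where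
  smooth : ContMDiff 𝓘(ℝ, E) (𝓘(ℝ, E).prod 𝓘(ℝ, E →L[ℝ] E →L[ℝ] ℝ)) ∞
    (fun x => Bundle.TotalSpace.mk' (E →L[ℝ] E →L[ℝ] ℝ)
      (E := fun x : M => TangentSpace 𝓘(ℝ, E) x →L[ℝ] TangentSpace 𝓘(ℝ, E) x →L[ℝ] ℝ) x (Ω x))
  alternating : ∀ (x : M) (v : TangentSpace 𝓘(ℝ, E) x), Ω x v v = 0
  nondegenerate : ∀ (x : M) (v : TangentSpace 𝓘(ℝ, E) x), (∀ w, Ω x v w = 0) → v = 0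
  closed : ∀ (x : M) (X Y Z : Π y : M, TangentSpace 𝓘(ℝ, E) y),
    SmoothFieldAt X x → SmoothFieldAt Y x → SmoothFieldAt Z x →
    dirDeriv (fun y => Ω y (Y y) (Z y)) x (X x)
      - dirDeriv (fun y => Ω y (X y) (Z y)) x (Y x)
      + dirDeriv (fun y => Ω y (X y) (Y y)) x (Z x)
      - Ω x (VectorField.mlieBracket 𝓘(ℝ, E) X Y x) (Z x)
      + Ω x (VectorField.mlieBracket 𝓘(ℝ, E) X Z x) (Y x)
      - Ω x (VectorField.mlieBracket 𝓘(ℝ, E) Y Z x) (X x) = 0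

/-- `Λ` is a smooth Lagrangian distribution: near every point it is spanned by a smooth frame, and
every `Λ x` equals its own `Ω`-orthogonal complement. -/
structure IsLagrangianDistribution [IsManifold 𝓘(ℝ, E) ∞ M]
    (Ω : Π x : M, TangentSpace 𝓘(ℝ, E) x →L[ℝ] TangentSpace 𝓘(ℝ, E) x →L[ℝ] ℝ)
    (Λ : Π x : M, Submodule ℝ (TangentSpace 𝓘(ℝ, E) x)) : Prop where
  smooth : ∀ x₀ : M, ∃ (U : Set M) (k : ℕ) (V : Fin k → Π x : M, TangentSpace 𝓘(ℝ, E) x),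
    IsOpen U ∧ x₀ ∈ U ∧
    (∀ i, ContMDiffOn 𝓘(ℝ, E) 𝓘(ℝ, E).tangent ∞
      (fun y => (⟨y, V i y⟩ : TangentBundle 𝓘(ℝ, E) M)) U) ∧
    ∀ x ∈ U, LinearIndependent ℝ (fun i => V i x) ∧
      Submodule.span ℝ (Set.range fun i => V i x) = Λ x
  lagrangian : ∀ (x : M) (v : TangentSpace 𝓘(ℝ, E) x), v ∈ Λ x ↔ ∀ w ∈ Λ x, Ω x v w = 0

/-- The Hamiltonian vector field of `H`: the vector field `X` with `Ω(X, ·) = -dH`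
(which exists and is unique when `Ω` is nondegenerate, see `hamField_spec`). -/
def hamField (Ω : Π x : M, TangentSpace 𝓘(ℝ, E) x →L[ℝ] TangentSpace 𝓘(ℝ, E) x →L[ℝ] ℝ)
    (H : M → ℝ) (x : M) : TangentSpace 𝓘(ℝ, E) x :=
  Classical.epsilon fun u : TangentSpace 𝓘(ℝ, E) x =>
    ∀ w : TangentSpace 𝓘(ℝ, E) x, Ω x u w = -dirDeriv H x w

theorem hamField_spec [FiniteDimensional ℝ E]
    (Ω : Π x : M, TangentSpace 𝓘(ℝ, E) x →L[ℝ] TangentSpace 𝓘(ℝ, E) x →L[ℝ] ℝ)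
    (H : M → ℝ) (x : M)
    (hΩ : ∀ v : TangentSpace 𝓘(ℝ, E) x, (∀ w, Ω x v w = 0) → v = 0)
    (w : TangentSpace 𝓘(ℝ, E) x) :
    Ω x (hamField Ω H x) w = -dirDeriv H x w := by
  have key : ∃ u : TangentSpace 𝓘(ℝ, E) x,
      ∀ w : TangentSpace 𝓘(ℝ, E) x, Ω x u w = -dirDeriv H x w := by
    have : FiniteDimensional ℝ (TangentSpace 𝓘(ℝ, E) x) := inferInstanceAs (FiniteDimensional ℝ E)
    let L : TangentSpace 𝓘(ℝ, E) x →ₗ[ℝ] Module.Dual ℝ (TangentSpace 𝓘(ℝ, E) x) :=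
      { toFun := fun u => (Ω x u).toLinearMap
        map_add' := fun a b => by ext; simp
        map_smul' := fun a b => by ext; simp }
    have hinj : Function.Injective L := by
      rw [← LinearMap.ker_eq_bot, LinearMap.ker_eq_bot']
      intro v hv
      exact hΩ v fun w => congrArg (fun f : Module.Dual ℝ (TangentSpace 𝓘(ℝ, E) x) => f w) hv
    have hsurj : Function.Surjective L :=
      (LinearMap.injective_iff_surjective_of_finrank_eq_finrank
        (Subspace.dual_finrank_eq (K := ℝ) (V := TangentSpace 𝓘(ℝ, E) x)).symm).1 hinj
    let d : Module.Dual ℝ (TangentSpace 𝓘(ℝ, E) x) :=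
      -(mfderiv 𝓘(ℝ, E) 𝓘(ℝ, ℝ) H x : TangentSpace 𝓘(ℝ, E) x →L[ℝ] ℝ).toLinearMap
    obtain ⟨u, hu⟩ := hsurj d
    exact ⟨u, fun w => congrArg (fun f : Module.Dual ℝ (TangentSpace 𝓘(ℝ, E) x) => f w) hu⟩
  exact Classical.epsilon_spec key w

/-- The field `X` is monotone with respect to `(Ω, Λ)`: the bilinear form
`⟨V₁, V₂⟩ = Ω([X, V₁], V₂)` on local sections of `Λ` is positive definite. For a Hamiltonian field
and a Lagrangian distribution this form is automatically tensorial, symmetric and smooth, so this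
says that it is a Riemannian metric on `Λ`. -/
def IsMonotone [IsManifold 𝓘(ℝ, E) ∞ M]
    (Ω : Π x : M, TangentSpace 𝓘(ℝ, E) x →L[ℝ] TangentSpace 𝓘(ℝ, E) x →L[ℝ] ℝ)
    (Λ : Π x : M, Submodule ℝ (TangentSpace 𝓘(ℝ, E) x))
    (X : Π x : M, TangentSpace 𝓘(ℝ, E) x) : Prop :=
  ∀ (x : M) (V : Π y : M, TangentSpace 𝓘(ℝ, E) y), SmoothFieldAt V x →
    (∀ᶠ y in 𝓝 x, V y ∈ Λ y) → V x ≠ 0 →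
    0 < Ω x (VectorField.mlieBracket 𝓘(ℝ, E) X V x) (V x)

/-- `γ` is, on some open interval that contains `0` and `t`, an integral curve of `X` that
starts at `x`. -/
def IsTrajectory (X : Π x : M, TangentSpace 𝓘(ℝ, E) x) (x : M) (t : ℝ) (γ : ℝ → M) : Prop :=
  γ 0 = x ∧ ∃ a b : ℝ, 0 ∈ Ioo a b ∧ t ∈ Ioo a b ∧ IsMIntegralCurveOn γ X (Ioo a b)

/-- The domain of the maximal flow of `X`. -/
def flowDomain (X : Π x : M, TangentSpace 𝓘(ℝ, E) x) : Set (ℝ × M) :=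
  {p | ∃ γ : ℝ → M, IsTrajectory X p.2 p.1 γ}

open Classical in
/-- The (maximal) flow `φ_t(x)` of `X`: the value at time `t` of the integral curve of `X` that
starts at `x`. (Outside of the domain of the flow the value is irrelevant.) -/
def flow (X : Π x : M, TangentSpace 𝓘(ℝ, E) x) (t : ℝ) (x : M) : M :=
  if h : ∃ γ : ℝ → M, IsTrajectory X x t γ then h.choose t else x

/-- The differential `dφ_t` at `x` of the flow of `X`. -/
def dflow (X : Π x : M, TangentSpace 𝓘(ℝ, E) x) (t : ℝ) (x : M) :
    TangentSpace 𝓘(ℝ, E) x →L[ℝ] TangentSpace 𝓘(ℝ, E) (flow X t x) :=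
  mfderiv 𝓘(ℝ, E) 𝓘(ℝ, E) (flow X t) x

/-- The flow of `X` has no conjugate points: for all `x` and all times `t ≠ 0` for which `φ_t(x)`
is defined, `dφ_t(Λ_x)` is transversal to `Λ_{φ_t(x)}`. -/
def NoConjugatePoints (Λ : Π x : M, Submodule ℝ (TangentSpace 𝓘(ℝ, E) x))
    (X : Π x : M, TangentSpace 𝓘(ℝ, E) x) : Prop :=
  ∀ (t : ℝ) (x : M), (t, x) ∈ flowDomain X → t ≠ 0 →
    (Λ x).map (dflow X t x).toLinearMap ⊔ Λ (flow X t x) = ⊤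

/-- The Jacobi curve `J_x(t) = (dφ_t)⁻¹(Λ_{φ_t(x)})` in `T_xM`. -/
def jacobiCurve (Λ : Π x : M, Submodule ℝ (TangentSpace 𝓘(ℝ, E) x))
    (X : Π x : M, TangentSpace 𝓘(ℝ, E) x) (x : M) (t : ℝ) :
    Submodule ℝ (TangentSpace 𝓘(ℝ, E) x) :=
  (Λ (flow X t x)).comap (dflow X t x).toLinearMap

/-- The tangent space `T_xΣ = ker dH_x` of the level set of `H` through a regular point `x`. -/
def levelTangent (H : M → ℝ) (x : M) : Submodule ℝ (TangentSpace 𝓘(ℝ, E) x) :=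
  LinearMap.ker (mfderiv 𝓘(ℝ, E) 𝓘(ℝ, ℝ) H x).toLinearMap

/-- `c` is a regular value of `H`. -/
def IsRegularValue (E : Type*) [NormedAddCommGroup E] [NormedSpace ℝ E]
    {M : Type*} [TopologicalSpace M] [ChartedSpace E M] (H : M → ℝ) (c : ℝ) : Prop :=
  ∀ x : M, H x = c → mfderiv 𝓘(ℝ, E) 𝓘(ℝ, ℝ) H x ≠ 0

/-- The norm of a tangent vector with respect to a Riemannian metric. -/
def metricNorm [IsManifold 𝓘(ℝ, E) ∞ M]
    (g : Bundle.ContMDiffRiemannianMetric 𝓘(ℝ, E) ∞ E (fun x : M => TangentSpace 𝓘(ℝ, E) x))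
    (x : M) (v : TangentSpace 𝓘(ℝ, E) x) : ℝ :=
  Real.sqrt (g.inner x v v)

/-- The flow of the field `X` (tangent to the level sets of `H`) is Anosov on the regular level set
`Σ = H⁻¹(c)`: there are a Riemannian metric, an invariant splitting `TΣ = ℝX ⊕ Ep ⊕ Em` and
constants `c₁, c₂ > 0` with `|dφ_t v| ≤ c₁ e^{-c₂ t} |v|` for `v` in `Ep` and
`|dφ_{-t} v| ≤ c₁ e^{-c₂ t} |v|` for `v` in `Em`, for all `t ≥ 0`. The metric on `Σ` is the
restriction of one on `M`; every Riemannian metric on the closed submanifold `Σ` is of this kind. -/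
def IsAnosovOnLevel [IsManifold 𝓘(ℝ, E) ∞ M]
    (X : Π x : M, TangentSpace 𝓘(ℝ, E) x) (H : M → ℝ) (c : ℝ) : Prop :=
  ∃ (g : Bundle.ContMDiffRiemannianMetric 𝓘(ℝ, E) ∞ E (fun x : M => TangentSpace 𝓘(ℝ, E) x))
    (Ep Em : Π x : M, Submodule ℝ (TangentSpace 𝓘(ℝ, E) x)) (c₁ c₂ : ℝ),
    0 < c₁ ∧ 0 < c₂ ∧ ∀ x : M, H x = c →
      (iSupIndep ![Submodule.span ℝ {X x}, Ep x, Em x] ∧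
        Submodule.span ℝ {X x} ⊔ Ep x ⊔ Em x = levelTangent H x) ∧
      (∀ t : ℝ, (Ep x).map (dflow X t x).toLinearMap = Ep (flow X t x) ∧
        (Em x).map (dflow X t x).toLinearMap = Em (flow X t x)) ∧
      (∀ t : ℝ, 0 ≤ t → ∀ v ∈ Ep x,
        metricNorm g (flow X t x) (dflow X t x v)
          ≤ c₁ * Real.exp (-c₂ * t) * metricNorm g x v) ∧
      (∀ t : ℝ, 0 ≤ t → ∀ v ∈ Em x,
        metricNorm g (flow X (-t) x) (dflow X (-t) x v)
          ≤ c₁ * Real.exp (-c₂ * t) * metricNorm g x v)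

end Manifold

section Limits

variable {V : Type*} [AddCommGroup V] [Module ℝ V] [TopologicalSpace V]

/-- Convergence of a family of subspaces in the Grassmannian: suitable bases of `J t` converge to a
basis of `L`. -/
def TendstoGrassmannian (J : ℝ → Submodule ℝ V) (l : Filter ℝ) (L : Submodule ℝ V) : Prop :=
  ∃ (k : ℕ) (e : ℝ → Fin k → V) (b : Fin k → V),
    (LinearIndependent ℝ b ∧ Submodule.span ℝ (Set.range b) = L) ∧
    (∀ᶠ t in l, LinearIndependent ℝ (e t) ∧ Submodule.span ℝ (Set.range (e t)) = J t) ∧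
    ∀ i, Tendsto (fun t => e t i) l (𝓝 (b i))

/-- The limit of a family of subspaces: the subspace of all limits of vectors `u t ∈ J t`. If the
family converges in the Grassmannian, this is its limit. -/
def limSubspace [ContinuousAdd V] [ContinuousConstSMul ℝ V]
    (J : ℝ → Submodule ℝ V) (l : Filter ℝ) : Submodule ℝ V where
  carrier := {v | ∃ u : ℝ → V, (∀ t, u t ∈ J t) ∧ Tendsto u l (𝓝 v)}
  zero_mem' := ⟨fun _ => 0, fun t => (J t).zero_mem, tendsto_const_nhds⟩
  add_mem' := by
    rintro v w ⟨u, hu, hv⟩ ⟨u', hu', hw⟩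
    exact ⟨fun t => u t + u' t, fun t => (J t).add_mem (hu t) (hu' t), hv.add hw⟩
  smul_mem' := by
    rintro a v ⟨u, hu, hv⟩
    exact ⟨fun t => a • u t, fun t => (J t).smul_mem a (hu t), hv.const_smul a⟩

end Limits

section Green

variable {E : Type*} [NormedAddCommGroup E] [NormedSpace ℝ E]
  {M : Type*} [TopologicalSpace M] [ChartedSpace E M]

/-- `Δ⁺_x = lim_{t → +∞} J_x(t)`. -/
def greenPlus (Λ : Π x : M, Submodule ℝ (TangentSpace 𝓘(ℝ, E) x))
    (X : Π x : M, TangentSpace 𝓘(ℝ, E) x) (x : M) : Submodule ℝ (TangentSpace 𝓘(ℝ, E) x) :=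
  limSubspace (jacobiCurve Λ X x) atTop

/-- `Δ⁻_x = lim_{t → -∞} J_x(t)`. -/
def greenMinus (Λ : Π x : M, Submodule ℝ (TangentSpace 𝓘(ℝ, E) x))
    (X : Π x : M, TangentSpace 𝓘(ℝ, E) x) (x : M) : Submodule ℝ (TangentSpace 𝓘(ℝ, E) x) :=
  limSubspace (jacobiCurve Λ X x) atBot

end Green

end MonotoneHam

end

/-! Write `A_t` for the differential of the flow over the compact invariant level `Σ`, `σ` for the
symplectic form and `X` for the Hamiltonian field. For a fixed base point, `J(t)` is a curve of
Lagrangian subspaces with `J(0) = Λ`. Absence of conjugate points makes its members pairwise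
transversal. Monotonicity makes its velocity positive, at least `κ |A_t v|²` on `v ∈ J(t)`.

Limits. Let `P_t` be the projection onto `J(t)` along `J(0)`. For `t > 0` the number `σ(P_t q, q)`
is nondecreasing in `t`, and comparison with `J(-1)` bounds it above. Polarisation and nondegeneracy
then give a limit `Q` of `P_t`, whose range is Lagrangian, complementary to `J(0)`, and equal to
`Δ⁺`. Reversing time, with `σ` and `X` replaced by their negatives, gives `Δ⁻`.

Bounded vectors. The total growth of `σ(P_t q, q)` is finite, so a vector with bounded future lies
in `Δ⁺` (`mem_limSubspace_of_bounded`); in particular `X` does. For vectors of `TΣ` boundedness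
modulo `X` suffices (`mem_limSubspace_of_reduced_bounded`): one minimises the defect form `σ(Qp -
P_t p, p)` along the direction `X` and repeats the argument. Since `TΣ` is the `σ`-orthogonal of
`X`, both `Δ⁺` and `Δ⁻` lie in `TΣ`.

Equivalences. Orthogonality exchanges sum and intersection of Lagrangian subspaces, and exchanges
`TΣ` with the line of `X`, so 2 and 3 are equivalent (`sup_eq_iff_inf_eq`). An Anosov splitting
consists of bounded vectors, hence 1 implies 2. For 3 implies 1, compactness shows that norms modulo
`X` double, forwards or backwards, within a uniform time: otherwise some limit vector, nonzero
modulo `X`, would be bounded for all times and lie in `Δ⁺ ∩ Δ⁻`. A function with this doubling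
property is controlled on an interval by its end values, and decays exponentially if it is bounded
on a half-line. Vectors of `Λ` tangent to `Σ` are controlled by their past, because `Λ ∩ Δ⁻ = 0`;
applied to vectors of `J(t)` approximating `Δ⁺`, this shows that `Δ⁺` is bounded modulo `X`, hence
decays modulo `X`. The `X`-coefficient then converges exponentially, and subtracting a multiple of
`X` leaves a vector contracted to zero: `Δ⁺ = ℝX ⊕ E⁺`, and likewise for `Δ⁻`.

The argument runs for an abstract `MonotoneCocycle`; the remaining analysis proves
`monotoneCocycle_restrictFlow`, that the Hamiltonian flow on the level is one. -/

namespace MonotoneHam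

/-! ### Monotone curves of Lagrangian subspaces and their limits -/

section LagrangianCurve

variable {E : Type*} [NormedAddCommGroup E] [NormedSpace ℝ E]

/-- A monotone curve `J` of pairwise transversal Lagrangian subspaces of the symplectic space
`(E, σ)`; `G t` is a lower bound for the velocity of the curve, a quadratic form on `J t`. -/
structure IsMonotoneCurve (σ : E →L[ℝ] E →L[ℝ] ℝ) (J : ℝ → Submodule ℝ E) (G : ℝ → E → ℝ) :
    Prop where
  alternating : ∀ v, σ v v = 0
  nondegenerate : ∀ v, (∀ w, σ v w = 0) → v = 0
  lagrangian : ∀ t v, v ∈ J t ↔ ∀ w ∈ J t, σ v w = 0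
  transversal : ∀ s t, s ≠ t → J s ⊔ J t = ⊤
  energy_pos : ∀ t, ∀ v ∈ J t, v ≠ 0 → 0 < G t v
  velocity : ∀ t, ∀ v ∈ J t, ∃ (w : ℝ → E) (w' : E), w t = v ∧ (∀ᶠ s in 𝓝 t, w s ∈ J s) ∧
    HasDerivAt w w' t ∧ G t v ≤ σ w' v

open Classical in
/-- The projection onto `J s` along `J r`. -/
noncomputable def curveProj [FiniteDimensional ℝ E] (J : ℝ → Submodule ℝ E) (r s : ℝ) : E →L[ℝ] E :=
  if h : IsCompl (J s) (J r) then
    LinearMap.toContinuousLinearMap ((J s).subtype ∘ₗ Submodule.projectionOnto _ _ h) else 0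

variable {σ : E →L[ℝ] E →L[ℝ] ℝ} {J : ℝ → Submodule ℝ E} {G : ℝ → E → ℝ}

theorem alternating_swap {σ : E →L[ℝ] E →L[ℝ] ℝ} (h : ∀ v, σ v v = 0) (v w : E) :
    σ v w = -σ w v := by
  have := h (v + w)
  simp only [map_add, add_apply, h] at this
  linarith

/-- Pointwise convergence can be tested by pairing with a nondegenerate form. -/
theorem tendsto_of_forall_pairing [FiniteDimensional ℝ E] {α : Type*} {l : Filter α}
    (hnd : ∀ v, (∀ w, σ v w = 0) → v = 0) {u : α → E}
    (h : ∀ w, ∃ a, Tendsto (fun i => σ (u i) w) l (𝓝 a)) : ∃ v, Tendsto u l (𝓝 v) := by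
  let b := Module.finBasis ℝ E
  let L : E →ₗ[ℝ] (Fin (Module.finrank ℝ E) → ℝ) :=
    LinearMap.pi fun i => (σ.flip (b i)).toLinearMap
  have hL : ∀ v i, L v i = σ v (b i) := fun v i => rfl
  have hinj : Function.Injective L := by
    rw [← LinearMap.ker_eq_bot, LinearMap.ker_eq_bot']
    intro v hv
    refine hnd v fun w => ?_
    have : (σ v).toLinearMap = 0 := b.ext fun i => by
      have := congrFun hv i
      simpa [hL] using this
    exact congrArg (fun f : E →ₗ[ℝ] ℝ => f w) this
  let e := LinearEquiv.ofInjectiveOfFinrankEq L hinj (by simp)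
  have he : ∀ v, e v = L v := fun v => rfl
  choose a ha using fun i => h (b i)
  have ht : Tendsto (fun i => L (u i)) l (𝓝 a) := tendsto_pi_nhds.2 fun i => ha i
  refine ⟨e.symm a, ?_⟩
  have hc : Continuous e.symm := LinearMap.continuous_of_finiteDimensional e.symm.toLinearMap
  have := (hc.tendsto a).comp ht
  refine this.congr fun i => ?_
  simp [← he]

theorem eq_of_forall_pairing (hnd : ∀ v, (∀ w, σ v w = 0) → v = 0) {u v : E}
    (h : ∀ w, σ u w = σ v w) : u = v :=
  sub_eq_zero.1 <| hnd _ fun w => by simp [h w]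

theorem tendsto_iff_forall_pairing [FiniteDimensional ℝ E] {α : Type*} {l : Filter α} [l.NeBot]
    (hnd : ∀ v, (∀ w, σ v w = 0) → v = 0) {u : α → E} {v : E}
    (h : ∀ w, Tendsto (fun i => σ (u i) w) l (𝓝 (σ v w))) : Tendsto u l (𝓝 v) := by
  obtain ⟨v', hv'⟩ := tendsto_of_forall_pairing hnd fun w => ⟨_, h w⟩
  have : v' = v := eq_of_forall_pairing hnd fun w => by
    have h1 : Tendsto (fun i => σ (u i) w) l (𝓝 (σ v' w)) :=
      ((σ.flip w).continuous.tendsto v').comp hv'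
    exact tendsto_nhds_unique h1 (h w)
  exact this ▸ hv'

namespace IsMonotoneCurve

variable (hJ : IsMonotoneCurve σ J G)
include hJ

theorem isotropic {t : ℝ} {v w : E} (hv : v ∈ J t) (hw : w ∈ J t) : σ v w = 0 :=
  (hJ.lagrangian t v).1 hv w hw

theorem swap (v w : E) : σ v w = -σ w v := alternating_swap hJ.alternating v w

/-- A vector in two Lagrangian subspaces is orthogonal to both, hence to their sum, which is the
whole space; nondegeneracy makes it zero. -/
theorem isCompl {s r : ℝ} (h : s ≠ r) : IsCompl (J s) (J r) := by
  refine ⟨?_, codisjoint_iff.2 (hJ.transversal s r h)⟩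
  rw [Submodule.disjoint_def]
  intro v hs hr
  refine hJ.nondegenerate v fun w => ?_
  have hw : w ∈ J s ⊔ J r := by rw [hJ.transversal s r h]; trivial
  obtain ⟨a, ha, b, hb, rfl⟩ := Submodule.mem_sup.1 hw
  rw [map_add, hJ.isotropic hs ha, hJ.isotropic hr hb, add_zero]

theorem eq_zero_of_mem {s r : ℝ} (h : s ≠ r) {v : E} (hs : v ∈ J s) (hr : v ∈ J r) : v = 0 :=
  Submodule.disjoint_def.1 (hJ.isCompl h).disjoint v hs hr

variable [FiniteDimensional ℝ E]

theorem proj_mem {s r : ℝ} (h : s ≠ r) (q : E) : curveProj J r s q ∈ J s := by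
  simp [curveProj, hJ.isCompl h]

theorem sub_proj_mem {s r : ℝ} (h : s ≠ r) (q : E) : q - curveProj J r s q ∈ J r := by
  have hc := hJ.isCompl h
  have : curveProj J r s q = Submodule.projectionOnto _ _ hc q := by
    simp [curveProj, hc]
  rw [this]
  refine (Submodule.projectionOnto_apply_eq_zero_iff hc).1 ?_
  rw [map_sub, Submodule.projectionOnto_apply_left, sub_self]

theorem proj_eq {s r : ℝ} (h : s ≠ r) {q v : E} (hv : v ∈ J s) (hq : q - v ∈ J r) :
    curveProj J r s q = v := by
  refine sub_eq_zero.1 (hJ.eq_zero_of_mem h ((J s).sub_mem (hJ.proj_mem h q) hv) ?_)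
  have := (J r).sub_mem hq (hJ.sub_proj_mem h q)
  simpa using this

theorem proj_of_mem {s r : ℝ} (h : s ≠ r) {v : E} (hv : v ∈ J s) : curveProj J r s v = v :=
  hJ.proj_eq h hv (by simp)

theorem proj_eq_zero {s r : ℝ} (h : s ≠ r) {v : E} (hv : v ∈ J r) : curveProj J r s v = 0 :=
  hJ.proj_eq h (J s).zero_mem (by simpa using hv)

/-- Continuity of `J` is not an axiom; it comes from the curves that `velocity` supplies through
single vectors. Moving a basis of `J t` along them gives maps `W s` into `J s` near the projection
`P`, and the true projection differs from `W s` by an operator close to the identity, which can be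
inverted. -/
theorem continuousAt_proj {t r : ℝ} (h : t ≠ r) : ContinuousAt (curveProj J r) t := by
  let b := Module.finBasis ℝ (J t)
  choose w w' hw hwJ hd _ using fun i => hJ.velocity t (b i) (b i).2
  let P := curveProj J r t
  let p : E →ₗ[ℝ] J t := Submodule.projectionOnto _ _ (hJ.isCompl h)
  have hp : ∀ q, (p q : E) = P q := fun q => by simp [p, P, curveProj, hJ.isCompl h]
  let W : ℝ → E →L[ℝ] E := fun s =>
    ∑ i, ((LinearMap.toContinuousLinearMap (b.coord i ∘ₗ p)).smulRight (w i s))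
  have hW : ∀ s q, W s q = ∑ i, b.repr (p q) i • w i s := fun s q => by simp [W]
  have hWt : W t = P := by
    ext q
    have h1 := congrArg Subtype.val (b.sum_repr (p q))
    rw [hW, ← hp, ← h1, Submodule.coe_sum]
    simp [hw]
  have hWc : ContinuousAt W t := by
    refine tendsto_finsetSum _ fun i _ => ?_
    exact ((ContinuousLinearMap.smulRightL ℝ E E
      (LinearMap.toContinuousLinearMap (b.coord i ∘ₗ p))).continuous.tendsto _).comp
      (hd i).continuousAt
  have hWJ : ∀ᶠ s in 𝓝 t, ∀ q, W s q ∈ J s := by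
    filter_upwards [eventually_all.2 hwJ] with s hs q
    rw [hW]
    exact Submodule.sum_mem _ fun i _ => (J s).smul_mem _ (hs i)
  let U : ℝ → E →L[ℝ] E := fun s => 1 - (P - W s)
  have hU : ContinuousAt U t := (continuousAt_const.sub (continuousAt_const.sub hWc))
  have hUt : U t = 1 := by simp [U, hWt]
  have hunit : ∀ᶠ s in 𝓝 t, IsUnit (U s) := by
    have : {x : E →L[ℝ] E | IsUnit x} ∈ 𝓝 (U t) := by
      rw [hUt]; exact Units.isOpen.mem_nhds isUnit_one
    exact hU this
  have key : ∀ᶠ s in 𝓝 t, curveProj J r s = W s * Ring.inverse (U s) := by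
    filter_upwards [hWJ, hunit, isOpen_ne.mem_nhds h] with s hs hu hsr
    -- `U s q` is `q - P q`, a vector of `J r` which the projection kills, plus `W s q`, a vector of
    -- `J s` which it fixes.
    have h1 : curveProj J r s * U s = W s := by
      ext q
      have e1 : curveProj J r s (W s q) = W s q := hJ.proj_of_mem hsr (hs q)
      have e2 : curveProj J r s (q - P q) = 0 := hJ.proj_eq_zero hsr (hJ.sub_proj_mem h q)
      change curveProj J r s (q - (P q - W s q)) = W s q
      rw [sub_sub_eq_add_sub, add_sub_right_comm, map_add, e1, e2, zero_add]
    rw [← h1, mul_assoc, Ring.mul_inverse_cancel _ hu, mul_one]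
  have hinv : ContinuousAt (fun s => Ring.inverse (U s)) t := by
    have h2 : ContinuousAt Ring.inverse (U t) := by
      rw [hUt]; exact NormedRing.inverse_continuousAt (1 : (E →L[ℝ] E)ˣ)
    exact h2.comp hU
  have := hWc.mul hinv
  exact this.congr (key.mono fun s hs => hs.symm)

omit [FiniteDimensional ℝ E] in
theorem velocity_nonneg {t : ℝ} {v w' : E} (hv : v ∈ J t) (h : G t v ≤ σ w' v) : 0 ≤ σ w' v := by
  by_cases h0 : v = 0
  · simp [h0]
  · exact (hJ.energy_pos t v hv h0).le.trans h

/-- The increment of the form equals `σ (P_s q) (v - w s)`, with `P_s` the projection onto `J s`, `v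
= P_t q`, and `w` a curve through `v` in the moving subspaces. Hence continuity of the projections
suffices, and the derivative is the velocity `σ w' v` of the curve at `v`. -/
theorem hasDerivAt_form {t r : ℝ} (h : t ≠ r) (q : E) :
    ∃ d, HasDerivAt (fun s => σ (curveProj J r s q) q) d t ∧ 0 ≤ d ∧
      G t (curveProj J r t q) ≤ d := by
  set v := curveProj J r t q with hv
  have hvJ : v ∈ J t := hJ.proj_mem h q
  obtain ⟨w, w', hw, hwJ, hd, hG⟩ := hJ.velocity t v hvJ
  refine ⟨σ w' v, ?_, hJ.velocity_nonneg hvJ hG, hG⟩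
  rw [hasDerivAt_iff_tendsto_slope] at hd ⊢
  have hP : Tendsto (fun s => curveProj J r s q) (𝓝[≠] t) (𝓝 v) := by
    have h1 : ContinuousAt (fun s => curveProj J r s q) t :=
      (hJ.continuousAt_proj h).clm_apply continuousAt_const
    exact h1.tendsto.mono_left nhdsWithin_le_nhds
  have hlim : Tendsto (fun s => -σ (curveProj J r s q) (slope w t s)) (𝓝[≠] t) (𝓝 (σ w' v)) := by
    rw [hJ.swap w' v]
    exact (((σ.isBoundedBilinearMap.continuous.tendsto (v, w')).comp
      (hP.prodMk_nhds hd))).neg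
  refine hlim.congr' ?_
  filter_upwards [nhdsWithin_le_nhds hwJ, self_mem_nhdsWithin,
    nhdsWithin_le_nhds (isOpen_ne.mem_nhds h)] with s hs hst hsr
  have hm : ∀ a, σ (curveProj J r s q - v) a = σ (curveProj J r s q - v) (a + (v - q)) := by
    intro a
    have h1 : curveProj J r s q - v ∈ J r := by
      have := (J r).sub_mem (hJ.sub_proj_mem h q) (hJ.sub_proj_mem hsr q)
      simpa [hv] using this
    have h2 : v - q ∈ J r := by
      have := (J r).neg_mem (hJ.sub_proj_mem h q)
      simpa [hv] using this
    rw [map_add (σ _), hJ.isotropic h1 h2, add_zero]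
  -- `P_s q - v` and `v - q` both lie in the Lagrangian `J r`, so `q` can be replaced by `v` in the
  -- second slot; `w s` may be subtracted because it pairs to zero with `P_s q` inside `J s`.
  have h3 : σ (curveProj J r s q) q - σ v q = σ (curveProj J r s q) (v - w s) := by
    have h4 := hm q
    have h5 := hJ.isotropic (hJ.proj_mem hsr q) hs
    simp only [add_sub_cancel, map_sub, sub_apply, hJ.alternating v, h5]
      at h4 ⊢
    linarith
  rw [slope_def_module, slope_def_module, map_smul, ← hv, h3, hw, ← neg_sub v (w s), map_neg]
  simp only [smul_eq_mul]
  ring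

theorem continuousOn_form {r : ℝ} {S : Set ℝ} (hS : r ∉ S) (q : E) :
    ContinuousOn (fun s => σ (curveProj J r s q) q) S := fun s hs => by
  obtain ⟨d, hd, -⟩ := hJ.hasDerivAt_form (ne_of_mem_of_not_mem hs hS) q
  exact hd.continuousAt.continuousWithinAt

theorem monotoneOn_form (r : ℝ) (q : E) :
    MonotoneOn (fun s => σ (curveProj J r s q) q) (Ioi r) := by
  refine monotoneOn_of_deriv_nonneg (convex_Ioi r) (hJ.continuousOn_form (by simp) q) ?_ ?_
  · rw [interior_Ioi]
    intro s hs
    obtain ⟨d, hd, -⟩ := hJ.hasDerivAt_form (ne_of_gt hs) q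
    exact hd.differentiableAt.differentiableWithinAt
  · rw [interior_Ioi]
    intro s hs
    obtain ⟨d, hd, h0, -⟩ := hJ.hasDerivAt_form (ne_of_gt hs) q
    rw [hd.deriv]; exact h0

theorem strictMonoOn_form (r : ℝ) {q : E} (hq : q ∉ J r) :
    StrictMonoOn (fun s => σ (curveProj J r s q) q) (Ioi r) := by
  refine strictMonoOn_of_deriv_pos (convex_Ioi r) (hJ.continuousOn_form (by simp) q) ?_
  rw [interior_Ioi]
  intro s hs
  obtain ⟨d, hd, -, h0⟩ := hJ.hasDerivAt_form (ne_of_gt hs) q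
  rw [hd.deriv]
  refine lt_of_lt_of_le (hJ.energy_pos _ _ (hJ.proj_mem (ne_of_gt hs) q) fun h => hq ?_) h0
  have := hJ.sub_proj_mem (ne_of_gt hs) q
  rwa [h, sub_zero] at this

/-- The vector `b = P_s q - q` lies in `J 0`, and its projection onto `J s` along `J (-1)` is `b +
q`. Monotonicity of the form based at `J (-1)`, from time `0` where it vanishes on `b` to time `s`,
gives `0 ≤ σ q b`, which is the claim with the sign reversed. -/
theorem form_nonpos {q : E} (hq : q ∈ J (-1)) {s : ℝ} (hs : 0 < s) :
    σ (curveProj J 0 s q) q ≤ 0 := by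
  set b := curveProj J 0 s q - q with hb
  have hb0 : b ∈ J 0 := by
    have := (J 0).neg_mem (hJ.sub_proj_mem hs.ne' q)
    simpa [hb] using this
  have h1 : curveProj J (-1) s b = b + q := by
    refine hJ.proj_eq (by linarith) ?_ ?_
    · simpa [hb] using hJ.proj_mem hs.ne' q
    · simpa using hq
  have h2 := hJ.monotoneOn_form (-1) b (show (0 : ℝ) ∈ Ioi (-1 : ℝ) by norm_num)
    (show s ∈ Ioi (-1 : ℝ) by simp; linarith) hs.le
  have h3 : curveProj J (-1) 0 b = b := hJ.proj_of_mem (by norm_num) hb0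
  simp only [h1, h3, map_add, add_apply, hJ.alternating] at h2
  have h4 : curveProj J 0 s q = b + q := by simp [hb]
  rw [h4]
  simp only [map_add, add_apply, hJ.alternating]
  linarith [hJ.swap q b]

/-- Decompose `q = a + r` along `J (-1)` and `J 0`. The projection ignores `r`, the diagonal term in
`a` is nonpositive, and the cross term is the constant `σ a r`. -/
theorem form_bddAbove (q : E) : ∃ C, ∀ s, 0 < s → σ (curveProj J 0 s q) q ≤ C := by
  have hq : q ∈ J (-1) ⊔ J 0 := by rw [hJ.transversal _ _ (by norm_num)]; trivial
  obtain ⟨a, ha, r, hr, rfl⟩ := Submodule.mem_sup.1 hq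
  refine ⟨σ a r, fun s hs => ?_⟩
  have h1 : curveProj J 0 s (a + r) = curveProj J 0 s a := by
    rw [map_add, hJ.proj_eq_zero hs.ne' hr, add_zero]
  have h2 : σ (a - curveProj J 0 s a) r = 0 := hJ.isotropic (hJ.sub_proj_mem hs.ne' a) hr
  have h3 := hJ.form_nonpos ha hs
  rw [h1, map_add]
  simp only [map_sub, sub_apply] at h2
  linarith

theorem form_tendsto (q : E) : ∃ a, Tendsto (fun s => σ (curveProj J 0 s q) q) atTop (𝓝 a) ∧
    ∀ s, 0 < s → σ (curveProj J 0 s q) q ≤ a := by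
  obtain ⟨C, hC⟩ := hJ.form_bddAbove q
  let f : ℝ → ℝ := fun s => σ (curveProj J 0 s q) q
  -- Truncating time at `1` turns monotonicity on positive times into monotonicity on the whole
  -- line.
  have hm : Monotone fun s : ℝ => f (max s 1) := fun s t hst =>
    hJ.monotoneOn_form 0 q (show (0 : ℝ) < _ by positivity) (show (0 : ℝ) < _ by positivity)
      (max_le_max_right 1 hst)
  have hb : BddAbove (range fun s : ℝ => f (max s 1)) :=
    ⟨C, by rintro _ ⟨s, rfl⟩; exact hC _ (by positivity)⟩
  refine ⟨_, (tendsto_atTop_ciSup hm hb).congr' ?_, fun s hs => ?_⟩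
  · filter_upwards [eventually_ge_atTop 1] with s hs
    simp [f, max_eq_left hs]
  · refine (hJ.monotoneOn_form 0 q hs (show (0 : ℝ) < max s 1 by positivity)
      (le_max_left _ _)).trans (le_ciSup hb s)

/-- Range and kernel of the projection are both isotropic, so its pairing is symmetric up to the
fixed form `σ`. This is what allows `two_mul_form` to recover it from quadratic values. -/
theorem proj_swap {s r : ℝ} (h : s ≠ r) (q q' : E) :
    σ (curveProj J r s q) q' = σ q q' + σ (curveProj J r s q') q := by
  have h1 := hJ.isotropic (hJ.proj_mem h q) (hJ.proj_mem h q')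
  have h2 := hJ.isotropic (hJ.sub_proj_mem h q) (hJ.sub_proj_mem h q')
  simp only [map_sub, sub_apply] at h2
  linarith [hJ.swap q (curveProj J r s q')]

theorem two_mul_form {s r : ℝ} (h : s ≠ r) (q q' : E) :
    2 * σ (curveProj J r s q) q' = σ (curveProj J r s (q + q')) (q + q') -
      σ (curveProj J r s q) q - σ (curveProj J r s q') q' + σ q q' := by
  have := hJ.proj_swap h q q'
  simp only [map_add, add_apply]
  linarith

theorem proj_tendsto (q : E) : ∃ v, Tendsto (fun s => curveProj J 0 s q) atTop (𝓝 v) := by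
  refine tendsto_of_forall_pairing hJ.nondegenerate fun q' => ?_
  obtain ⟨a, ha, -⟩ := hJ.form_tendsto (q + q')
  obtain ⟨b, hb, -⟩ := hJ.form_tendsto q
  obtain ⟨c, hc, -⟩ := hJ.form_tendsto q'
  refine ⟨(a - b - c + σ q q') / 2, (((ha.sub hb).sub hc).add_const (σ q q')).div_const 2
    |>.congr' ?_⟩
  filter_upwards [eventually_gt_atTop 0] with s hs
  rw [← hJ.two_mul_form hs.ne']
  ring


theorem exists_limProj :
    ∃ Q : E →L[ℝ] E, ∀ q, Tendsto (fun s => curveProj J 0 s q) atTop (𝓝 (Q q)) := by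
  choose Q hQ using hJ.proj_tendsto
  let L : E →ₗ[ℝ] E :=
    { toFun := Q
      map_add' := fun a b => tendsto_nhds_unique (hQ (a + b)) <| by
        simpa only [map_add] using (hQ a).add (hQ b)
      map_smul' := fun c a => tendsto_nhds_unique (hQ (c • a)) <| by
        simpa only [map_smul, RingHom.id_apply] using (hQ a).const_smul c }
  exact ⟨LinearMap.toContinuousLinearMap L, hQ⟩

section Limit

variable {Q : E →L[ℝ] E} (hQ : ∀ q, Tendsto (fun s => curveProj J 0 s q) atTop (𝓝 (Q q)))
include hQ

theorem sub_limProj_mem (q : E) : q - Q q ∈ J 0 := by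
  refine (J 0).closed_of_finiteDimensional.mem_of_tendsto ((hQ q).const_sub q) ?_
  filter_upwards [eventually_gt_atTop 0] with s hs
  exact hJ.sub_proj_mem hs.ne' q

theorem limProj_eq_zero {r : E} (hr : r ∈ J 0) : Q r = 0 := by
  refine tendsto_nhds_unique (hQ r) (tendsto_const_nhds.congr' ?_)
  filter_upwards [eventually_gt_atTop 0] with s hs
  exact (hJ.proj_eq_zero hs.ne' hr).symm

theorem limProj_limProj (q : E) : Q (Q q) = Q q := by
  have := hJ.limProj_eq_zero hQ (hJ.sub_limProj_mem hQ q)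
  rw [map_sub, sub_eq_zero] at this
  exact this.symm

omit hJ in
theorem tendsto_pairing {u : ℝ → E} {v : E} (hu : Tendsto u atTop (𝓝 v)) (q : E) :
    Tendsto (fun s => σ (u s) (curveProj J 0 s q)) atTop (𝓝 (σ v (Q q))) :=
  (σ.isBoundedBilinearMap.continuous.tendsto (v, Q q)).comp (hu.prodMk_nhds (hQ q))

theorem limProj_isotropic_of_tendsto {u : ℝ → E} {v : E} (hu : Tendsto u atTop (𝓝 v))
    (h : ∀ᶠ s in atTop, u s ∈ J s) (q : E) : σ v (Q q) = 0 := by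
  refine tendsto_nhds_unique (tendsto_pairing hQ hu q) (tendsto_const_nhds.congr' ?_)
  filter_upwards [eventually_gt_atTop 0, h] with s hs hm
  exact (hJ.isotropic hm (hJ.proj_mem hs.ne' q)).symm

theorem limProj_isotropic (p q : E) : σ (Q p) (Q q) = 0 :=
  hJ.limProj_isotropic_of_tendsto hQ (hQ p)
    ((eventually_gt_atTop 0).mono fun _ hs => hJ.proj_mem hs.ne' p) q

/-- The vector `v - Q v` lies in `J 0`, so it is orthogonal to `J 0` and, by hypothesis and
isotropy, to the range of `Q`; these two span, so it vanishes. -/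
theorem limProj_eq_self {v : E} (h : ∀ q, σ v (Q q) = 0) : Q v = v := by
  have hm := hJ.sub_limProj_mem hQ v
  refine (sub_eq_zero.1 (hJ.nondegenerate _ fun w => ?_)).symm
  have h1 : σ (v - Q v) (Q w) = 0 := by
    rw [map_sub, sub_apply, h, hJ.limProj_isotropic hQ, sub_zero]
  have h2 := hJ.isotropic hm (hJ.sub_limProj_mem hQ w)
  rw [map_sub, h1, sub_zero] at h2
  exact h2

theorem mem_limSubspace_iff {v : E} : v ∈ limSubspace J atTop ↔ Q v = v := by
  constructor
  · rintro ⟨u, hu, hv⟩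
    exact hJ.limProj_eq_self hQ
      (hJ.limProj_isotropic_of_tendsto hQ hv (Eventually.of_forall hu))
  · intro h
    -- Nonpositive times do not affect the limit; the value zero there keeps the curve in `J s`.
    refine ⟨fun s => if 0 < s then curveProj J 0 s v else 0, fun s => ?_, ?_⟩
    · dsimp only
      split_ifs with hs
      · exact hJ.proj_mem hs.ne' v
      · exact (J s).zero_mem
    · rw [← h]
      refine (h.symm ▸ hQ v : Tendsto (fun s => curveProj J 0 s v) atTop (𝓝 (Q v))).congr' ?_
      filter_upwards [eventually_gt_atTop 0] with s hs
      simp [hs, h]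

end Limit

theorem mem_limSubspace_iff_orthogonal {v : E} :
    v ∈ limSubspace J atTop ↔ ∀ w ∈ limSubspace J atTop, σ v w = 0 := by
  obtain ⟨Q, hQ⟩ := hJ.exists_limProj
  simp only [hJ.mem_limSubspace_iff hQ]
  constructor
  · intro hv w hw
    rw [← hv, ← hw]; exact hJ.limProj_isotropic hQ v w
  · intro h
    exact hJ.limProj_eq_self hQ fun q => h _ (hJ.limProj_limProj hQ q)

theorem eq_zero_of_mem_limSubspace {v : E} (hv : v ∈ limSubspace J atTop) (h0 : v ∈ J 0) :
    v = 0 := by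
  obtain ⟨Q, hQ⟩ := hJ.exists_limProj
  rw [← (hJ.mem_limSubspace_iff hQ).1 hv, hJ.limProj_eq_zero hQ h0]

/-- The limit and every `J s` with `s > 0` are complements of `J 0`, so projecting along `J 0`
carries a basis of the limit to a basis of `J s`, and these projections converge. -/
theorem tendstoGrassmannian : TendstoGrassmannian J atTop (limSubspace J atTop) := by
  obtain ⟨Q, hQ⟩ := hJ.exists_limProj
  let b := Module.finBasis ℝ (limSubspace J atTop)
  have hb : ∀ i, Q (b i) = b i := fun i => (hJ.mem_limSubspace_iff hQ).1 (b i).2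
  have hspan : Submodule.span ℝ (range fun i => (b i : E)) = limSubspace J atTop := by
    have h1 := congrArg (Submodule.map (limSubspace J atTop).subtype) b.span_eq
    rw [Submodule.map_span, ← range_comp, Submodule.map_top, Submodule.range_subtype] at h1
    exact h1
  have hli : LinearIndependent ℝ fun i => (b i : E) :=
    b.linearIndependent.map' (limSubspace J atTop).subtype (Submodule.ker_subtype _)
  refine ⟨_, fun s i => curveProj J 0 s (b i), fun i => (b i : E), ⟨hli, hspan⟩, ?_, fun i => ?_⟩
  · filter_upwards [eventually_gt_atTop 0] with s hs
    constructor
    · refine hli.map (f := (curveProj J 0 s).toLinearMap) ?_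
      rw [hspan, Submodule.disjoint_def]
      intro v hv hk
      refine hJ.eq_zero_of_mem_limSubspace hv ?_
      have h1 := hJ.sub_proj_mem hs.ne' v
      have h2 : curveProj J 0 s v = 0 := hk
      rwa [h2, sub_zero] at h1
    · have h1 : range (fun i => curveProj J 0 s (b i)) =
          (curveProj J 0 s).toLinearMap '' (range fun i => (b i : E)) := by
        rw [← range_comp]; rfl
      rw [h1, ← Submodule.map_span, hspan]
      refine le_antisymm ?_ fun v hv => ?_
      · rintro _ ⟨v, -, rfl⟩
        exact hJ.proj_mem hs.ne' v
      · refine ⟨Q v, (hJ.mem_limSubspace_iff hQ).2 (hJ.limProj_limProj hQ v), ?_⟩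
        refine hJ.proj_eq hs.ne' hv ?_
        have := (J 0).neg_mem (hJ.sub_limProj_mem hQ v)
        simpa using this
  · have := hQ (b i)
    rwa [hb i] at this

/-- A vector whose pairing with the vectors of `J t` is controlled by the velocity of the curve
belongs to the limit of the curve. -/
theorem mem_limSubspace_of_pairing_le {u : E} {K : ℝ}
    (h : ∀ᶠ t in atTop, ∀ z ∈ J t, σ z u ^ 2 ≤ K * G t z) : u ∈ limSubspace J atTop := by
  obtain ⟨Q, hQ⟩ := hJ.exists_limProj
  refine (hJ.mem_limSubspace_iff hQ).2 (hJ.limProj_eq_self hQ ?_)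
  by_contra! hne
  obtain ⟨z, hz⟩ := hne
  have hlim : Tendsto (fun t => σ (curveProj J 0 t z) u ^ 2) atTop (𝓝 (σ (Q z) u ^ 2)) :=
    (((σ.flip u).continuous.tendsto _).comp (hQ z)).pow 2
  have hpos : 0 < σ (Q z) u ^ 2 := by
    have : σ (Q z) u ≠ 0 := by rwa [hJ.swap, neg_ne_zero]
    positivity
  obtain ⟨a, -, ha⟩ := hJ.form_tendsto z
  have hK : 0 < K := by
    obtain ⟨t, h1, h2, ht⟩ := ((hlim.eventually (lt_mem_nhds hpos)).and
      (h.and (eventually_gt_atTop 0))).exists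
    have hm := hJ.proj_mem ht.ne' z
    have h3 := h2 _ hm
    have h4 : 0 < G t (curveProj J 0 t z) :=
      hJ.energy_pos _ _ hm fun h0 => by simp [h0] at h1
    by_contra! hK
    nlinarith
  -- Half of the limiting squared pairing, divided by `K`: an eventual lower bound for the velocity
  -- along the projections of `z`.
  set δ := σ (Q z) u ^ 2 / 2 / K with hδ
  have hδ0 : 0 < δ := by positivity
  obtain ⟨T, hT⟩ := eventually_atTop.1 (((hlim.eventually (lt_mem_nhds (half_lt_self hpos))).and
      (h.and (eventually_gt_atTop 0))))
  have hG : ∀ t ≥ T, δ ≤ G t (curveProj J 0 t z) := by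
    intro t ht
    obtain ⟨h1, h2, h3⟩ := hT t ht
    have h4 := h2 _ (hJ.proj_mem h3.ne' z)
    rw [hδ, div_le_iff₀ hK]
    linarith
  have hT0 : 0 < T := (hT T le_rfl).2.2
  have hgrow : ∀ t ≥ T, δ * (t - T) ≤
      σ (curveProj J 0 t z) z - σ (curveProj J 0 T z) z := by
    intro t ht
    refine Convex.mul_sub_le_image_sub_of_le_deriv (convex_Ici T)
      (hJ.continuousOn_form (by simpa using hT0) z) ?_ ?_ T self_mem_Ici t ht ht
    · rw [interior_Ici]
      intro s hs
      obtain ⟨d, hd, -⟩ := hJ.hasDerivAt_form (hT0.trans hs).ne' z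
      exact hd.differentiableAt.differentiableWithinAt
    · rw [interior_Ici]
      intro s hs
      obtain ⟨d, hd, -, h0⟩ := hJ.hasDerivAt_form (hT0.trans hs).ne' z
      rw [hd.deriv]
      exact (hG s (le_of_lt hs)).trans h0
  -- At this time growth at rate `δ` puts the form one unit above its upper bound `a`.
  have hb := hgrow (T + (a - σ (curveProj J 0 T z) z + 1) / δ) (by
    have := ha T hT0
    have : 0 ≤ (a - σ (curveProj J 0 T z) z + 1) / δ := div_nonneg (by linarith) hδ0.le
    linarith)
  rw [add_sub_cancel_left, mul_div_cancel₀ _ hδ0.ne'] at hb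
  have := ha (T + (a - σ (curveProj J 0 T z) z + 1) / δ) (by
    have := ha T hT0
    have : 0 ≤ (a - σ (curveProj J 0 T z) z + 1) / δ := div_nonneg (by linarith) hδ0.le
    linarith)
  linarith

/-! ### The defect between the projections and their limit, and reduction by a vector of the limit
-/

section Defect

variable {Q : E →L[ℝ] E} (hQ : ∀ q, Tendsto (fun s => curveProj J 0 s q) atTop (𝓝 (Q q)))
include hQ

/-- By `proj_swap` and its limit, the asymmetries of `Q` and of the projection are the same form
`σ`, so they cancel in the difference. -/
theorem defect_symm {t : ℝ} (ht : 0 < t) (p q : E) :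
    σ (Q p - curveProj J 0 t p) q = σ (Q q - curveProj J 0 t q) p := by
  have h1 : σ (Q p) q = σ p q + σ (Q q) p := by
    refine tendsto_nhds_unique (((σ.flip q).continuous.tendsto _).comp (hQ p)) ?_
    refine ((((σ.flip p).continuous.tendsto _).comp (hQ q)).const_add (σ p q)).congr' ?_
    filter_upwards [eventually_gt_atTop 0] with s hs
    exact (hJ.proj_swap hs.ne' p q).symm
  have h2 := hJ.proj_swap ht.ne' p q
  simp only [map_sub, sub_apply]
  linarith

theorem defect_nonneg {t : ℝ} (ht : 0 < t) (q : E) : 0 ≤ σ (Q q - curveProj J 0 t q) q := by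
  obtain ⟨a, ha, hle⟩ := hJ.form_tendsto q
  have : σ (Q q) q = a :=
    tendsto_nhds_unique (((σ.flip q).continuous.tendsto _).comp (hQ q)) ha
  rw [map_sub, sub_apply, this]
  linarith [hle t ht]

/-- The defect is still nonnegative at time `t + 1` and decreases strictly from `t` to `t + 1`. -/
theorem defect_pos {t : ℝ} (ht : 0 < t) {q : E} (hq : q ∉ J 0) :
    0 < σ (Q q - curveProj J 0 t q) q := by
  have h1 := hJ.defect_nonneg hQ (show 0 < t + 1 by linarith) q
  have h2 := hJ.strictMonoOn_form 0 hq ht (show (0 : ℝ) < t + 1 by linarith) (by linarith)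
  rw [map_sub, sub_apply] at h1 ⊢
  dsimp only at h2
  linarith

theorem defect_add_smul {t : ℝ} (ht : 0 < t) (p q : E) (a : ℝ) :
    σ (Q (p + a • q) - curveProj J 0 t (p + a • q)) (p + a • q) =
      σ (Q p - curveProj J 0 t p) p + 2 * a * σ (Q p - curveProj J 0 t p) q +
        a ^ 2 * σ (Q q - curveProj J 0 t q) q := by
  have h1 := hJ.defect_symm hQ ht p q
  simp only [map_sub, sub_apply, map_add, map_smul, add_apply, smul_apply, smul_eq_mul] at h1 ⊢
  linear_combination -a * h1

/-- Cauchy–Schwarz for a nonnegative symmetric form. -/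
theorem defect_sq_le {t : ℝ} (ht : 0 < t) (p q : E) :
    σ (Q p - curveProj J 0 t p) q ^ 2 ≤
      σ (Q p - curveProj J 0 t p) p * σ (Q q - curveProj J 0 t q) q := by
  have h := discrim_le_zero (a := σ (Q q - curveProj J 0 t q) q)
    (b := 2 * σ (Q p - curveProj J 0 t p) q) (c := σ (Q p - curveProj J 0 t p) p) fun x => by
      have h1 := hJ.defect_nonneg hQ ht (p + x • q)
      rw [hJ.defect_add_smul hQ ht] at h1
      linarith
  rw [discrim] at h
  linarith

omit hJ in
theorem defect_tendsto (p q : E) :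
    Tendsto (fun t => σ (Q p - curveProj J 0 t p) q) atTop (𝓝 0) := by
  have h1 := (hQ p).const_sub (Q p)
  have h2 := ((σ.flip q).continuous.tendsto _).comp h1
  rw [sub_self, map_zero] at h2
  exact h2

omit hQ in
theorem hasDerivAt_defect {t : ℝ} (ht : 0 < t) (q : E) :
    ∃ d, HasDerivAt (fun s => σ (Q q - curveProj J 0 s q) q) d t ∧
      G t (curveProj J 0 t q) ≤ -d := by
  obtain ⟨d, hd, -, h⟩ := hJ.hasDerivAt_form ht.ne' q
  refine ⟨-d, ?_, by simpa using h⟩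
  have := hd.const_sub (σ (Q q) q)
  simpa only [map_sub, sub_apply] using this

variable {X : E} (hX : X ∈ limSubspace J atTop) (hX0 : X ≠ 0)
include hX hX0

/-- The coefficient for which `z - a X` projects to a vector of `J t` that is orthogonal to `X`. -/
theorem reduced_orthogonal {t : ℝ} (ht : 0 < t) {z : E} (hz : z ∈ limSubspace J atTop) {a : ℝ}
    (ha : a = σ (Q z - curveProj J 0 t z) X / σ (Q X - curveProj J 0 t X) X) :
    σ (curveProj J 0 t (z - a • X)) X = 0 := by
  have hp := hJ.defect_pos hQ ht fun h => hX0 (hJ.eq_zero_of_mem_limSubspace hX h)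
  have h1 : σ z X = 0 := hJ.mem_limSubspace_iff_orthogonal.1 hz X hX
  rw [eq_div_iff hp.ne', (hJ.mem_limSubspace_iff hQ).1 hX, (hJ.mem_limSubspace_iff hQ).1 hz] at ha
  simp only [map_sub, sub_apply, map_smul, smul_apply, smul_eq_mul, hJ.alternating X, h1]
    at ha ⊢
  linarith

/-- This is a Schur complement: the coefficient `a` minimises the defect on the line through `z` in
the direction `X`. -/
theorem reduced_defect_le {t : ℝ} (ht : 0 < t) {z : E} {a : ℝ}
    (ha : a = σ (Q z - curveProj J 0 t z) X / σ (Q X - curveProj J 0 t X) X) :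
    σ (Q (z - a • X) - curveProj J 0 t (z - a • X)) (z - a • X) =
        σ (Q z - curveProj J 0 t z) z -
          σ (Q z - curveProj J 0 t z) X ^ 2 / σ (Q X - curveProj J 0 t X) X := by
  have hp := hJ.defect_pos hQ ht fun h => hX0 (hJ.eq_zero_of_mem_limSubspace hX h)
  have h1 := hJ.defect_add_smul hQ ht z X (-a)
  rw [neg_smul, ← sub_eq_add_neg] at h1
  rw [h1, ha]
  field_simp
  ring

/-- The coefficient `a t` is a quotient of two quantities tending to zero, so no bound on it is
available. Cauchy–Schwarz avoids one, because the reduced defect is at most the defect of `z`, which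
tends to zero. -/
theorem reduced_tendsto {z : E} {a : ℝ → ℝ}
    (ha : ∀ t, a t = σ (Q z - curveProj J 0 t z) X / σ (Q X - curveProj J 0 t X) X) :
    Tendsto (fun t => Q (z - a t • X) - curveProj J 0 t (z - a t • X)) atTop (𝓝 0) := by
  refine tendsto_iff_forall_pairing (σ := σ) hJ.nondegenerate fun u => ?_
  rw [map_zero, zero_apply]
  have h1 : Tendsto (fun t => σ (Q z - curveProj J 0 t z) z * σ (Q u - curveProj J 0 t u) u)
      atTop (𝓝 0) := by
    simpa using (defect_tendsto hQ z z).mul (defect_tendsto (σ := σ) hQ u u)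
  have h2 := squeeze_zero' (f := fun t =>
    σ (Q (z - a t • X) - curveProj J 0 t (z - a t • X)) u ^ 2)
    (Eventually.of_forall fun t => sq_nonneg _) (g := fun t =>
      σ (Q z - curveProj J 0 t z) z * σ (Q u - curveProj J 0 t u) u) ?_ h1
  · have h3 := h2.sqrt
    simp only [Real.sqrt_sq_eq_abs, Real.sqrt_zero] at h3
    exact (tendsto_zero_iff_abs_tendsto_zero _).2 h3
  · filter_upwards [eventually_gt_atTop 0] with t ht
    refine (hJ.defect_sq_le hQ ht _ u).trans ?_
    refine mul_le_mul_of_nonneg_right ?_ (hJ.defect_nonneg hQ ht u)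
    rw [hJ.reduced_defect_le hQ hX hX0 ht (ha t)]
    have hp := hJ.defect_pos hQ ht fun h => hX0 (hJ.eq_zero_of_mem_limSubspace hX h)
    have : 0 ≤ σ (Q z - curveProj J 0 t z) X ^ 2 / σ (Q X - curveProj J 0 t X) X := by positivity
    linarith

end Defect

/-- Vectors of the limit are limits, modulo `X`, of vectors of `J t` that are orthogonal to `X`. -/
theorem exists_reduced_approximation {X z : E} (hX : X ∈ limSubspace J atTop) (hX0 : X ≠ 0)
    (hz : z ∈ limSubspace J atTop) :
    ∃ (v : ℝ → E) (a : ℝ → ℝ), (∀ t, 0 < t → v t ∈ J t ∧ σ (v t) X = 0) ∧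
      Tendsto (fun t => v t + a t • X) atTop (𝓝 z) := by
  obtain ⟨Q, hQ⟩ := hJ.exists_limProj
  let a : ℝ → ℝ := fun t => σ (Q z - curveProj J 0 t z) X / σ (Q X - curveProj J 0 t X) X
  refine ⟨fun t => curveProj J 0 t (z - a t • X), a, fun t ht => ⟨hJ.proj_mem ht.ne' _,
    hJ.reduced_orthogonal hQ hX hX0 ht hz rfl⟩, ?_⟩
  have h := (hJ.reduced_tendsto hQ hX hX0 (z := z) (a := a) fun t => rfl).const_sub z
  rw [sub_zero] at h
  refine h.congr fun t => ?_
  rw [map_sub Q, map_smul Q, (hJ.mem_limSubspace_iff hQ).1 hX, (hJ.mem_limSubspace_iff hQ).1 hz]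
  abel

/-- The version of `mem_limSubspace_of_pairing_le` for the reduction by `X`. -/
theorem mem_limSubspace_of_reduced_pairing_le {X u : E} {K : ℝ}
    (hX : X ∈ limSubspace J atTop) (hX0 : X ≠ 0) (hu : σ X u = 0)
    (h : ∀ᶠ t in atTop, ∀ z ∈ J t, σ z X = 0 → σ z u ^ 2 ≤ K * G t z) :
    u ∈ limSubspace J atTop := by
  obtain ⟨Q, hQ⟩ := hJ.exists_limProj
  refine hJ.mem_limSubspace_iff_orthogonal.2 ?_
  by_contra! hne
  obtain ⟨z, hz, hzu⟩ := hne
  have hX0' : X ∉ J 0 := fun h => hX0 (hJ.eq_zero_of_mem_limSubspace hX h)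
  set D : ℝ → ℝ := fun t => σ (Q z - curveProj J 0 t z) z with hD
  set B : ℝ → ℝ := fun t => σ (Q z - curveProj J 0 t z) X with hB
  set C : ℝ → ℝ := fun t => σ (Q X - curveProj J 0 t X) X with hC
  let a : ℝ → ℝ := fun t => B t / C t
  let y : ℝ → E := fun t => curveProj J 0 t (z - a t • X)
  -- The minimum of the defect over `z + ℝ X`. It is nonnegative and plays the part of the bounded
  -- monotone form of the unreduced argument.
  let φ : ℝ → ℝ := fun t => D t - B t ^ 2 / C t
  have hCpos : ∀ t, 0 < t → 0 < C t := fun t ht => hJ.defect_pos hQ ht hX0'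
  have hφ0 : ∀ t, 0 < t → 0 ≤ φ t := fun t ht => by
    have h1 := hJ.reduced_defect_le hQ hX hX0 (z := z) ht (a := a t) rfl
    change 0 ≤ D t - B t ^ 2 / C t
    rw [← h1]
    exact hJ.defect_nonneg hQ ht _
  have hφd : ∀ t, 0 < t → ∃ d, HasDerivAt φ d t ∧ G t (y t) ≤ -d := by
    intro t ht
    obtain ⟨d₁, hd₁, -⟩ := hJ.hasDerivAt_defect (Q := Q) ht z
    obtain ⟨d₃, hd₃, -⟩ := hJ.hasDerivAt_defect (Q := Q) ht X
    obtain ⟨d₄, hd₄, -⟩ := hJ.hasDerivAt_defect (Q := Q) ht (z + (1 : ℝ) • X)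
    obtain ⟨d, hd, hG⟩ := hJ.hasDerivAt_defect (Q := Q) ht (z + (-a t) • X)
    -- The defect at `z + b X` is a quadratic polynomial in `b`. The value `b = 1` yields
    -- differentiability of the mixed coefficient `B`, and `b = -a t` compares derivatives at the
    -- minimiser.
    have hev : ∀ b : ℝ, (fun s => σ (Q (z + b • X) - curveProj J 0 s (z + b • X)) (z + b • X))
        =ᶠ[𝓝 t] fun s => D s + 2 * b * B s + b ^ 2 * C s := fun b => by
      filter_upwards [lt_mem_nhds ht] with s hs
      exact hJ.defect_add_smul hQ hs z X b
    have hd₂ : HasDerivAt B ((d₄ - d₁ - d₃) / 2) t := by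
      refine (((hd₄.congr_of_eventuallyEq (hev 1).symm).sub hd₁).sub hd₃).div_const 2
        |>.congr_of_eventuallyEq ?_
      refine Eventually.of_forall fun s => ?_
      simp only [hD, hC, Pi.sub_apply]
      ring
    set d₂ := (d₄ - d₁ - d₃) / 2
    have h5 := ((hd₁.add (hd₂.const_mul (2 * -a t))).add
      (hd₃.const_mul ((-a t) ^ 2))).congr_of_eventuallyEq (hev (-a t))
    have h6 := hd.unique h5
    refine ⟨d, ?_, ?_⟩
    -- Envelope principle: since `a t` is the minimiser, freezing it does not change the derivative,
    -- so `φ` has the derivative of the defect of the fixed vector `z - a t X`.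
    · have hc := (hCpos t ht).ne'
      refine (hd₁.sub ((hd₂.pow 2).div hd₃ hc)).congr_deriv ?_
      rw [h6]
      simp only [a]
      have e : σ (Q X - curveProj J 0 t X) X = C t := rfl
      rw [e]
      field_simp
      simp
      ring
    · simpa only [y, neg_smul, ← sub_eq_add_neg] using hG
  have hlim : Tendsto (fun t => σ (y t) u ^ 2) atTop (𝓝 (σ z u ^ 2)) := by
    have h1 := (hJ.reduced_tendsto hQ hX hX0 (z := z) (a := a) fun t => rfl).const_sub z
    rw [sub_zero] at h1
    have h2 := (((σ.flip u).continuous.tendsto _).comp h1).pow 2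
    refine h2.congr fun t => ?_
    have h3 : z - (Q (z - a t • X) - y t) = y t + a t • X := by
      rw [map_sub Q, map_smul Q, (hJ.mem_limSubspace_iff hQ).1 hX,
        (hJ.mem_limSubspace_iff hQ).1 hz]
      abel
    simp only [Function.comp, ContinuousLinearMap.flip_apply]
    rw [h3, map_add, map_smul, add_apply, smul_apply, hu, smul_zero, add_zero]
  have hpos : 0 < σ z u ^ 2 := by
    have : σ z u ≠ 0 := by rwa [hJ.swap, neg_ne_zero]
    positivity
  have hyJ : ∀ t, 0 < t → y t ∈ J t := fun t ht => hJ.proj_mem ht.ne' _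
  have hyX : ∀ t, 0 < t → σ (y t) X = 0 := fun t ht =>
    hJ.reduced_orthogonal hQ hX hX0 ht hz rfl
  have hK : 0 < K := by
    obtain ⟨t, h1, h2, ht⟩ := ((hlim.eventually (lt_mem_nhds hpos)).and
      (h.and (eventually_gt_atTop 0))).exists
    have h3 := h2 _ (hyJ t ht) (hyX t ht)
    have h4 : 0 < G t (y t) := hJ.energy_pos _ _ (hyJ t ht) fun h0 => by simp [h0] at h1
    by_contra! hK
    nlinarith
  set δ := σ z u ^ 2 / 2 / K with hδ
  have hδ0 : 0 < δ := by positivity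
  obtain ⟨T, hT⟩ := eventually_atTop.1 (((hlim.eventually (lt_mem_nhds (half_lt_self hpos))).and
      (h.and (eventually_gt_atTop 0))))
  have hG : ∀ t ≥ T, δ ≤ G t (y t) := by
    intro t ht
    obtain ⟨h1, h2, h3⟩ := hT t ht
    have h4 := h2 _ (hyJ t h3) (hyX t h3)
    rw [hδ, div_le_iff₀ hK]
    linarith
  have hT0 : 0 < T := (hT T le_rfl).2.2
  have hgrow : ∀ t ≥ T, φ t - φ T ≤ -δ * (t - T) := by
    intro t ht
    refine Convex.image_sub_le_mul_sub_of_deriv_le (convex_Ici T) ?_ ?_ ?_ T self_mem_Ici t ht ht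
    · intro s hs
      obtain ⟨d, hd, -⟩ := hφd s (hT0.trans_le hs)
      exact hd.continuousAt.continuousWithinAt
    · rw [interior_Ici]
      intro s hs
      obtain ⟨d, hd, -⟩ := hφd s (hT0.trans hs)
      exact hd.differentiableAt.differentiableWithinAt
    · rw [interior_Ici]
      intro s hs
      obtain ⟨d, hd, h0⟩ := hφd s (hT0.trans hs)
      rw [hd.deriv]
      linarith [hG s (le_of_lt hs)]
  -- By this time decrease at rate `δ` would bring `φ` down to `-1`.
  have hT' : T ≤ T + (φ T + 1) / δ := by
    have := hφ0 T hT0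
    have : 0 ≤ (φ T + 1) / δ := by positivity
    linarith
  have hb := hgrow _ hT'
  rw [add_sub_cancel_left, neg_mul, mul_div_cancel₀ _ hδ0.ne'] at hb
  linarith [hφ0 _ (hT0.trans_le hT')]

end IsMonotoneCurve

end LagrangianCurve

end MonotoneHam

namespace MonotoneHam

/-! ### Norms of positive forms and components orthogonal to a vector -/

section FormNorm

variable {E : Type*} [NormedAddCommGroup E] [NormedSpace ℝ E]

/-- The norm `√(g(v, v))`. -/
noncomputable def formNorm (g : E →L[ℝ] E →L[ℝ] ℝ) (v : E) : ℝ := Real.sqrt (g v v)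

/-- The component of `v` that is `g`-orthogonal to `X`. -/
noncomputable def orthComponent (g : E →L[ℝ] E →L[ℝ] ℝ) (X v : E) : E :=
  v - (g v X / g X X) • X

theorem formNorm_nonneg (g : E →L[ℝ] E →L[ℝ] ℝ) (v : E) : 0 ≤ formNorm g v := Real.sqrt_nonneg _

theorem continuous_formNorm (g : E →L[ℝ] E →L[ℝ] ℝ) : Continuous (formNorm g) := by
  unfold formNorm; fun_prop

theorem continuous_orthComponent (g : E →L[ℝ] E →L[ℝ] ℝ) (X : E) :
    Continuous (orthComponent g X) := by
  unfold orthComponent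
  have : Continuous fun v => g v X := (g.flip X).continuous
  fun_prop

theorem orthComponent_neg (g : E →L[ℝ] E →L[ℝ] ℝ) (X v : E) :
    orthComponent g (-X) v = orthComponent g X v := by
  simp [orthComponent, neg_div]

variable {g : E →L[ℝ] E →L[ℝ] ℝ} (hs : ∀ v w, g v w = g w v) (hp : ∀ v, v ≠ 0 → 0 < g v v)

theorem formNorm_smul (a : ℝ) (v : E) : formNorm g (a • v) = |a| * formNorm g v := by
  simp only [formNorm, map_smul, smul_apply, smul_eq_mul]
  rw [← mul_assoc, Real.sqrt_mul (mul_self_nonneg a), Real.sqrt_mul_self_eq_abs]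

theorem orthComponent_smul (X : E) (a : ℝ) (v : E) :
    orthComponent g X (a • v) = a • orthComponent g X v := by
  simp only [orthComponent, map_smul, smul_apply, smul_eq_mul, smul_sub, smul_smul, mul_div_assoc]

include hp

theorem form_self_nonneg (v : E) : 0 ≤ g v v := by
  by_cases h : v = 0
  · simp [h]
  · exact (hp v h).le

theorem formNorm_sq (v : E) : formNorm g v ^ 2 = g v v := Real.sq_sqrt (form_self_nonneg hp v)

theorem formNorm_eq_zero {v : E} : formNorm g v = 0 ↔ v = 0 := by
  constructor
  · intro h
    by_contra hv
    exact ((Real.sqrt_pos.2 (hp v hv)).ne' h)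
  · rintro rfl; simp [formNorm]

theorem orthComponent_add_smul {X : E} (hX : X ≠ 0) (v : E) (a : ℝ) :
    orthComponent g X (v + a • X) = orthComponent g X v := by
  have := (hp X hX).ne'
  simp only [orthComponent, map_add, map_smul, add_apply, smul_apply, smul_eq_mul]
  rw [add_div, mul_div_cancel_right₀ _ this, add_smul]
  abel

theorem form_orthComponent {X : E} (hX : X ≠ 0) (v : E) : g (orthComponent g X v) X = 0 := by
  have := (hp X hX).ne'
  simp [orthComponent, div_mul_cancel₀ _ this]

include hs

theorem form_le_formNorm_mul (v w : E) : |g v w| ≤ formNorm g v * formNorm g w := by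
  have h := discrim_le_zero (a := g w w) (b := 2 * g v w) (c := g v v) fun x => by
    have h1 := form_self_nonneg hp (v + x • w)
    simp only [map_add, map_smul, add_apply, smul_apply, smul_eq_mul, hs w v] at h1
    linarith
  rw [discrim] at h
  refine abs_le_of_sq_le_sq ?_ (mul_nonneg (formNorm_nonneg _ _) (formNorm_nonneg _ _))
  rw [mul_pow, formNorm_sq hp, formNorm_sq hp]
  linarith

theorem formNorm_add_le (v w : E) : formNorm g (v + w) ≤ formNorm g v + formNorm g w := by
  refine abs_le_of_sq_le_sq' ?_ (add_nonneg (formNorm_nonneg _ _) (formNorm_nonneg _ _)) |>.2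
  have := le_of_abs_le (form_le_formNorm_mul hs hp v w)
  rw [add_sq, formNorm_sq hp, formNorm_sq hp, formNorm_sq hp]
  simp only [map_add, add_apply, hs w v]
  linarith

/-- Pythagoras. Expressing the norm through values of `g` alone also gives its continuity as the
base point varies. -/
theorem formNorm_orthComponent_sq {X : E} (hX : X ≠ 0) (v : E) :
    formNorm g (orthComponent g X v) ^ 2 = g v v - g v X ^ 2 / g X X := by
  have h1 := form_orthComponent hp hX v
  have h2 := (hp X hX).ne'
  rw [formNorm_sq hp]
  conv_lhs => enter [2]; unfold orthComponent
  rw [map_sub, map_smul, h1, smul_zero, sub_zero]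
  simp only [orthComponent, map_sub, map_smul, sub_apply, smul_apply, smul_eq_mul, hs X v]
  ring

theorem formNorm_orthComponent_le {X : E} (hX : X ≠ 0) (v : E) :
    formNorm g (orthComponent g X v) ≤ formNorm g v := by
  refine abs_le_of_sq_le_sq' ?_ (formNorm_nonneg _ _) |>.2
  rw [formNorm_orthComponent_sq hs hp hX, formNorm_sq hp]
  have := hp X hX
  have : 0 ≤ g v X ^ 2 / g X X := by positivity
  linarith

end FormNorm

/-! ### Functions that double within a bounded time -/

section Doubling

/-- A function that doubles within each time interval of length `2T` and stays bounded on a finite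
interval is controlled by its values at the end points. -/
theorem le_max_endpoints_of_doubling {f : ℝ → ℝ} {T C L K : ℝ} (hf : ∀ t, 0 ≤ f t)
    (hC : ∀ s t, |s - t| ≤ T → f s ≤ C * f t)
    (h2 : ∀ t, ∃ s, |s - t| ≤ T ∧ 2 * f t ≤ f s) (hC1 : 0 ≤ C)
    (hK : ∀ t ∈ Icc 0 L, f t ≤ K) {t : ℝ} (ht : t ∈ Icc 0 L) :
    f t ≤ C * max (f 0) (f L) := by
  set B := sSup (f '' Icc 0 L) with hB
  have hbdd : BddAbove (f '' Icc 0 L) := ⟨K, by rintro _ ⟨s, hs, rfl⟩; exact hK s hs⟩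
  have hle : ∀ s ∈ Icc 0 L, f s ≤ B := fun s hs => le_csSup hbdd ⟨s, hs, rfl⟩
  have hB0 : 0 ≤ B := (hf t).trans (hle t ht)
  have hM : 0 ≤ C * max (f 0) (f L) := mul_nonneg hC1 ((hf 0).trans (le_max_left _ _))
  -- At distance more than `T` from both ends the doubling point stays in the interval, so the value
  -- is at most `B / 2`; elsewhere an end point is within reach of `hC`.
  have key : B ≤ max (B / 2) (C * max (f 0) (f L)) := by
    refine csSup_le ⟨_, ⟨t, ht, rfl⟩⟩ ?_
    rintro _ ⟨s, hs, rfl⟩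
    by_cases h1 : s ≤ T
    · refine le_max_of_le_right ((hC s 0 ?_).trans ?_)
      · rw [sub_zero, abs_of_nonneg hs.1]; exact h1
      · exact mul_le_mul_of_nonneg_left (le_max_left _ _) hC1
    · by_cases h3 : L - s ≤ T
      · refine le_max_of_le_right ((hC s L ?_).trans ?_)
        · rw [abs_sub_comm, abs_of_nonneg (by linarith [hs.2])]; exact h3
        · exact mul_le_mul_of_nonneg_left (le_max_right _ _) hC1
      · refine le_max_of_le_left ?_
        obtain ⟨r, hr, hr2⟩ := h2 s
        rw [abs_le] at hr
        have := hle r ⟨by linarith, by linarith⟩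
        linarith
  refine (hle t ht).trans ?_
  rcases le_max_iff.1 key with h | h
  · linarith
  · exact h

/-- A bounded function that doubles within each time interval of length `2T` decays
exponentially. -/
theorem exp_decay_of_doubling {f : ℝ → ℝ} {T C K : ℝ} (hf : ∀ t, 0 ≤ f t)
    (hT : 0 < T) (hC : ∀ s t, |s - t| ≤ T → f s ≤ C * f t)
    (h2 : ∀ t, ∃ s, |s - t| ≤ T ∧ 2 * f t ≤ f s) (hC1 : 0 ≤ C)
    (hK : ∀ t, 0 ≤ t → f t ≤ K) {t : ℝ} (ht : 0 ≤ t) :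
    f t ≤ 2 * C * Real.exp (-(Real.log 2 / T) * t) * f 0 := by
  set B := sSup (f '' Ici 0) with hB
  have hbdd : BddAbove (f '' Ici 0) := ⟨K, by rintro _ ⟨s, hs, rfl⟩; exact hK s hs⟩
  have hle : ∀ s, 0 ≤ s → f s ≤ B := fun s hs => le_csSup hbdd ⟨s, hs, rfl⟩
  have hB0 : 0 ≤ B := (hf t).trans (hle t ht)
  -- The doubling point is at most `T` earlier, hence still in the range of the previous step: each
  -- time `T` gains a factor one half.
  have hstep : ∀ j : ℕ, ∀ s, j * T ≤ s → f s ≤ (1 / 2) ^ j * B := by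
    intro j
    induction j with
    | zero => intro s hs; simpa using hle s (by simpa using hs)
    | succ j ih =>
      intro s hs
      obtain ⟨r, hr, hr2⟩ := h2 s
      rw [abs_le] at hr
      push_cast at hs
      have := ih r (by linarith)
      rw [pow_succ]
      linarith
  have hBle : B ≤ C * f 0 := by
    have key : B ≤ max (B / 2) (C * f 0) := by
      refine csSup_le ⟨_, ⟨t, ht, rfl⟩⟩ ?_
      rintro _ ⟨s, hs, rfl⟩
      by_cases h1 : s ≤ T
      · refine le_max_of_le_right (hC s 0 ?_)
        rw [sub_zero, abs_of_nonneg hs]; exact h1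
      · refine le_max_of_le_left ?_
        have := hstep 1 s (by push_cast; linarith)
        linarith
    rcases le_max_iff.1 key with h | h
    · have := mul_nonneg hC1 (hf 0)
      linarith
    · exact h
  have hj := hstep ⌊t / T⌋₊ t (by
    rw [← le_div_iff₀ hT]; exact Nat.floor_le (by positivity))
  -- Rounding down loses at most one halving, whence the factor `2` and the rate `log 2 / T`.
  have hexp : ((1 : ℝ) / 2) ^ ⌊t / T⌋₊ ≤ 2 * Real.exp (-(Real.log 2 / T) * t) := by
    have h1 : t / T < ⌊t / T⌋₊ + 1 := Nat.lt_floor_add_one _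
    have h3 : ((1 : ℝ) / 2) ^ ⌊t / T⌋₊ = Real.exp (-(Real.log 2 * ⌊t / T⌋₊)) := by
      rw [one_div, inv_pow, Real.exp_neg, mul_comm, Real.exp_nat_mul, Real.exp_log (by norm_num)]
    have h4 : (2 : ℝ) * Real.exp (-(Real.log 2 / T) * t) =
        Real.exp (Real.log 2 + -(Real.log 2 / T) * t) := by
      rw [Real.exp_add, Real.exp_log (by norm_num)]
    rw [h3, h4, Real.exp_le_exp]
    have h5 : Real.log 2 / T * t = Real.log 2 * (t / T) := by ring
    have h6 : 0 < Real.log 2 := Real.log_pos (by norm_num)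
    nlinarith
  calc f t ≤ (1 / 2) ^ ⌊t / T⌋₊ * B := hj
    _ ≤ (2 * Real.exp (-(Real.log 2 / T) * t)) * (C * f 0) := by gcongr
    _ = _ := by ring

end Doubling

/-! ### Monotone symplectic cocycles and criteria for membership in the limits -/

section Cocycle

variable {E : Type*} [NormedAddCommGroup E] [NormedSpace ℝ E] {S : Type*}

/-- A symplectic cocycle `A` over a flow `φ` on a "compact" space `S`, with an invariant field `X`
and a monotone field `Λ` of Lagrangian subspaces without conjugate points. -/
structure MonotoneCocycle (φ : ℝ → S → S) (A : ℝ → S → E →L[ℝ] E) (σ : S → E →L[ℝ] E →L[ℝ] ℝ)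
    (Λ : S → Submodule ℝ E) (X : S → E) (g : S → E →L[ℝ] E →L[ℝ] ℝ) : Prop where
  flow_zero : ∀ x, φ 0 x = x
  flow_add : ∀ s t x, φ (s + t) x = φ s (φ t x)
  deriv_zero : ∀ x v, A 0 x v = v
  deriv_add : ∀ s t x v, A (s + t) x v = A s (φ t x) (A t x v)
  alternating : ∀ x v, σ x v v = 0
  nondegenerate : ∀ x v, (∀ w, σ x v w = 0) → v = 0
  symplectic : ∀ t x u v, σ (φ t x) (A t x u) (A t x v) = σ x u v
  deriv_field : ∀ t x, A t x (X x) = X (φ t x)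
  field_ne : ∀ x, X x ≠ 0
  lagrangian : ∀ x v, v ∈ Λ x ↔ ∀ w ∈ Λ x, σ x v w = 0
  transversal : ∀ t x, t ≠ 0 → (Λ x).map (A t x).toLinearMap ⊔ Λ (φ t x) = ⊤
  metric_symm : ∀ x v w, g x v w = g x w v
  metric_pos : ∀ x v, v ≠ 0 → 0 < g x v v
  velocity : ∃ κ, 0 < κ ∧ ∀ x, ∀ v ∈ Λ x, ∃ (w : ℝ → E) (w' : E), w 0 = v ∧
    (∀ᶠ s in 𝓝 0, A s x (w s) ∈ Λ (φ s x)) ∧ HasDerivAt w w' 0 ∧ κ * g x v v ≤ σ x w' v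
  form_bounded : ∃ C, ∀ x u v, |σ x u v| ≤ C * formNorm (g x) u * formNorm (g x) v
  deriv_bounded : ∀ T, ∃ C, ∀ t x u, |t| ≤ T →
    formNorm (g (φ t x)) (A t x u) ≤ C * formNorm (g x) u
  field_bounded : ∃ C, ∀ x, formNorm (g x) (X x) ≤ C
  field_bounded_below : ∃ c, 0 < c ∧ ∀ x, c ≤ formNorm (g x) (X x)
  compact : ∀ (x : ℕ → S) (u : ℕ → E), (∀ k, formNorm (g (x k)) (u k) = 1) →
    ∃ (y : S) (v : E),
      (∀ t, Tendsto (fun k => formNorm (g (φ t (x k))) (A t (x k) (u k))) (hyperfilter ℕ)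
        (𝓝 (formNorm (g (φ t y)) (A t y v)))) ∧
      (∀ t, Tendsto (fun k => formNorm (g (φ t (x k)))
        (orthComponent (g (φ t (x k))) (X (φ t (x k))) (A t (x k) (u k)))) (hyperfilter ℕ)
        (𝓝 (formNorm (g (φ t y)) (orthComponent (g (φ t y)) (X (φ t y)) (A t y v))))) ∧
      Tendsto (fun k => σ (x k) (X (x k)) (u k)) (hyperfilter ℕ) (𝓝 (σ y (X y) v)) ∧
      ((∀ k, u k ∈ Λ (x k)) → v ∈ Λ y)

/-- The curve `t ↦ (A_t)⁻¹ Λ` through the fibre over `x`. -/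
def cocycleCurve (φ : ℝ → S → S) (A : ℝ → S → E →L[ℝ] E) (Λ : S → Submodule ℝ E) (x : S)
    (t : ℝ) : Submodule ℝ E := (Λ (φ t x)).comap (A t x).toLinearMap

/-- The vectors that are contracted to `0` in the future. -/
def stableSubspace (φ : ℝ → S → S) (A : ℝ → S → E →L[ℝ] E) (g : S → E →L[ℝ] E →L[ℝ] ℝ)
    (hs : ∀ x v w, g x v w = g x w v) (hp : ∀ x v, v ≠ 0 → 0 < g x v v) (x : S) :
    Submodule ℝ E where
  carrier := {v | Tendsto (fun t => formNorm (g (φ t x)) (A t x v)) atTop (𝓝 0)}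
  zero_mem' := by simp [formNorm]
  add_mem' {a b} ha hb := by
    refine squeeze_zero (fun t => formNorm_nonneg _ _) (fun t => ?_) (by simpa using ha.add hb)
    rw [map_add]
    exact formNorm_add_le (hs _) (hp _) _ _
  smul_mem' c a ha := by
    have := ha.const_mul |c|
    simp only [mul_zero] at this
    refine this.congr fun t => ?_
    rw [map_smul, formNorm_smul]

variable {φ : ℝ → S → S} {A : ℝ → S → E →L[ℝ] E} {σ : S → E →L[ℝ] E →L[ℝ] ℝ}
  {Λ : S → Submodule ℝ E} {X : S → E} {g : S → E →L[ℝ] E →L[ℝ] ℝ}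

theorem limSubspace_comp_neg (J : ℝ → Submodule ℝ E) :
    limSubspace (fun t => J (-t)) atTop = limSubspace J atBot := by
  ext v
  constructor
  · rintro ⟨u, hu, hv⟩
    refine ⟨fun t => u (-t), fun t => by simpa using hu (-t), ?_⟩
    exact hv.comp tendsto_neg_atBot_atTop
  · rintro ⟨u, hu, hv⟩
    exact ⟨fun t => u (-t), fun t => hu (-t), hv.comp tendsto_neg_atTop_atBot⟩

theorem tendstoGrassmannian_comp_neg {J : ℝ → Submodule ℝ E} {L : Submodule ℝ E}
    (h : TendstoGrassmannian (fun t => J (-t)) atTop L) : TendstoGrassmannian J atBot L := by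
  obtain ⟨k, e, b, hb, he, ht⟩ := h
  refine ⟨k, fun t => e (-t), b, hb, ?_, fun i => (ht i).comp tendsto_neg_atBot_atTop⟩
  have := tendsto_neg_atBot_atTop.eventually he
  simpa using this

namespace MonotoneCocycle

variable (h : MonotoneCocycle φ A σ Λ X g)
include h

/-- Time reversal changes the sign of velocities, and `-σ` restores their positivity; `-X` is the
generator of the reversed flow. Statements about the past are deduced from those about the future in
this way. -/
theorem reverse : MonotoneCocycle (fun t => φ (-t)) (fun t => A (-t)) (fun x => -σ x) Λ
    (fun x => -X x) g where
  flow_zero x := by simp [h.flow_zero]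
  flow_add s t x := by rw [neg_add, h.flow_add]
  deriv_zero x v := by simp [h.deriv_zero]
  deriv_add s t x v := by rw [neg_add, h.deriv_add]
  alternating x v := by simp [h.alternating]
  nondegenerate x v hv := h.nondegenerate x v fun w => by simpa using hv w
  symplectic t x u v := by simp [h.symplectic]
  deriv_field t x := by simp [h.deriv_field]
  field_ne x := by simpa using h.field_ne x
  lagrangian x v := by simpa using h.lagrangian x v
  transversal t x ht := h.transversal (-t) x (by simpa using ht)
  metric_symm := h.metric_symm
  metric_pos := h.metric_pos
  velocity := by
    obtain ⟨κ, hκ, hv⟩ := h.velocity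
    refine ⟨κ, hκ, fun x v hx => ?_⟩
    obtain ⟨w, w', h0, hw, hd, hle⟩ := hv x v hx
    refine ⟨fun s => w (-s), -w', by simpa using h0, ?_, ?_, by simpa using hle⟩
    · have : Tendsto (fun s : ℝ => -s) (𝓝 0) (𝓝 0) := by
        simpa using (continuous_neg.tendsto (0 : ℝ))
      exact this.eventually hw
    · have h1 : HasDerivAt w w' (-(0 : ℝ)) := by simpa using hd
      simpa [Function.comp_def] using h1.scomp (0 : ℝ) (hasDerivAt_neg 0)
  form_bounded := by
    obtain ⟨C, hC⟩ := h.form_bounded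
    exact ⟨C, fun x u v => by simpa using hC x u v⟩
  deriv_bounded T := by
    obtain ⟨C, hC⟩ := h.deriv_bounded T
    exact ⟨C, fun t x u ht => hC (-t) x u (by simpa using ht)⟩
  field_bounded := by simpa [formNorm] using h.field_bounded
  field_bounded_below := by simpa [formNorm] using h.field_bounded_below
  compact x u hu := by
    obtain ⟨y, v, h1, h2, h3, h4⟩ := h.compact x u hu
    refine ⟨y, v, fun t => h1 (-t), fun t => ?_, by simpa using h3, h4⟩
    simpa only [orthComponent_neg] using h2 (-t)

theorem deriv_neg_apply (t : ℝ) (x : S) (v : E) : A (-t) (φ t x) (A t x v) = v := by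
  rw [← h.deriv_add, neg_add_cancel, h.deriv_zero]

theorem flow_neg (t : ℝ) (x : S) : φ (-t) (φ t x) = x := by
  rw [← h.flow_add, neg_add_cancel, h.flow_zero]

theorem deriv_apply_neg (t : ℝ) (x : S) (v : E) : A t x (A (-t) (φ t x) v) = v := by
  have h1 := h.deriv_neg_apply (-t) (φ t x) v
  rwa [neg_neg, h.flow_neg] at h1

theorem deriv_surjective (t : ℝ) (x : S) (v : E) : ∃ u, A t x u = v :=
  ⟨_, h.deriv_apply_neg t x v⟩

theorem swap (x : S) (v w : E) : σ x v w = -σ x w v := alternating_swap (h.alternating x) v w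

/-- The axioms concern time zero; the cocycle identity and invariance of `σ` transport them from the
fibre over `φ t x` back to the fibre over `x`, where the energy becomes `κ |A_t v|²`. -/
theorem exists_isMonotoneCurve : ∃ κ, 0 < κ ∧ ∀ x, IsMonotoneCurve (σ x) (cocycleCurve φ A Λ x)
    fun t v => κ * formNorm (g (φ t x)) (A t x v) ^ 2 := by
  obtain ⟨κ, hκ, hv⟩ := h.velocity
  refine ⟨κ, hκ, fun x => ⟨h.alternating x, h.nondegenerate x, fun t v => ?_, fun s t hst => ?_,
    fun t v hvJ hv0 => ?_, fun t v hvJ => ?_⟩⟩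
  · refine (h.lagrangian (φ t x) (A t x v)).trans ⟨fun hw w hwJ => ?_, fun hw w hwΛ => ?_⟩
    · rw [← h.symplectic t]; exact hw _ hwJ
    · obtain ⟨u, rfl⟩ := h.deriv_surjective t x w
      rw [h.symplectic]; exact hw u hwΛ
  · rw [eq_top_iff]
    intro v _
    have h1 := h.transversal (t - s) (φ s x) (sub_ne_zero.2 hst.symm)
    rw [← h.flow_add, sub_add_cancel] at h1
    have h2 : A t x v ∈ (⊤ : Submodule ℝ E) := trivial
    rw [← h1] at h2
    obtain ⟨_, ⟨a, ha, rfl⟩, b, hb, hab⟩ := Submodule.mem_sup.1 h2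
    obtain ⟨a', rfl⟩ := h.deriv_surjective s x a
    obtain ⟨b', rfl⟩ := h.deriv_surjective t x b
    have h3 : A t x (a' + b') = A t x v := by
      rw [map_add, ← hab]
      congr 1
      have := h.deriv_add (t - s) s x a'
      rw [sub_add_cancel] at this
      exact this
    have h4 : a' + b' = v := by
      have := congrArg (A (-t) (φ t x)) h3
      rwa [h.deriv_neg_apply, h.deriv_neg_apply] at this
    exact Submodule.mem_sup.2 ⟨a', ha, b', hb, h4⟩
  · have h1 : A t x v ≠ 0 := fun h0 => hv0 <| by
      have := congrArg (A (-t) (φ t x)) h0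
      rwa [h.deriv_neg_apply, map_zero] at this
    rw [formNorm_sq (h.metric_pos _)]
    exact mul_pos hκ (h.metric_pos _ _ h1)
  · obtain ⟨w, w', h0, hw, hd, hle⟩ := hv (φ t x) (A t x v) hvJ
    refine ⟨fun s => A (-t) (φ t x) (w (s - t)), A (-t) (φ t x) w', ?_, ?_, ?_, ?_⟩
    · simp [h0, h.deriv_neg_apply]
    · have : Tendsto (fun s : ℝ => s - t) (𝓝 t) (𝓝 0) := by
        simpa using (continuous_id.sub continuous_const).tendsto (f := fun s : ℝ => s - t) t
      filter_upwards [this.eventually hw] with s hs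
      rw [← h.flow_add, sub_add_cancel] at hs
      have h1 := h.deriv_add (s - t) t x (A (-t) (φ t x) (w (s - t)))
      rw [sub_add_cancel, h.deriv_apply_neg] at h1
      change A s x _ ∈ Λ (φ s x)
      rwa [h1]
    · have h1 : HasDerivAt (fun s : ℝ => w (s - t)) w' t := by
        refine HasDerivAt.comp_sub_const t t ?_
        simpa using hd
      exact (A (-t) (φ t x)).hasFDerivAt.comp_hasDerivAt t h1
    · rw [formNorm_sq (h.metric_pos _), ← h.symplectic t, h.deriv_apply_neg]
      exact hle

variable [FiniteDimensional ℝ E]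

theorem tendstoGrassmannian_atTop (x : S) : TendstoGrassmannian (cocycleCurve φ A Λ x) atTop
    (limSubspace (cocycleCurve φ A Λ x) atTop) := by
  obtain ⟨κ, -, hκ⟩ := h.exists_isMonotoneCurve
  exact (hκ x).tendstoGrassmannian

theorem tendstoGrassmannian_atBot (x : S) : TendstoGrassmannian (cocycleCurve φ A Λ x) atBot
    (limSubspace (cocycleCurve φ A Λ x) atBot) := by
  refine tendstoGrassmannian_comp_neg ?_
  rw [← limSubspace_comp_neg]
  exact h.reverse.tendstoGrassmannian_atTop x

theorem mem_limSubspace_iff (x : S) (v : E) : v ∈ limSubspace (cocycleCurve φ A Λ x) atTop ↔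
    ∀ w ∈ limSubspace (cocycleCurve φ A Λ x) atTop, σ x v w = 0 := by
  obtain ⟨κ, -, hκ⟩ := h.exists_isMonotoneCurve
  exact (hκ x).mem_limSubspace_iff_orthogonal

theorem mem_limSubspace_iff_atBot (x : S) (v : E) :
    v ∈ limSubspace (cocycleCurve φ A Λ x) atBot ↔
    ∀ w ∈ limSubspace (cocycleCurve φ A Λ x) atBot, σ x v w = 0 := by
  have := h.reverse.mem_limSubspace_iff x v
  rw [show cocycleCurve (fun t => φ (-t)) (fun t => A (-t)) Λ x =
    fun t => cocycleCurve φ A Λ x (-t) from rfl, limSubspace_comp_neg] at this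
  simpa using this

theorem eq_zero_of_mem_limSubspace {x : S} {v : E}
    (hv : v ∈ limSubspace (cocycleCurve φ A Λ x) atTop) (hΛ : v ∈ Λ x) : v = 0 := by
  obtain ⟨κ, -, hκ⟩ := h.exists_isMonotoneCurve
  refine (hκ x).eq_zero_of_mem_limSubspace hv ?_
  change A 0 x v ∈ Λ (φ 0 x)
  rwa [h.deriv_zero, h.flow_zero]

/-- Vectors with a bounded future belong to the limit subspace. -/
theorem mem_limSubspace_of_bounded {x : S} {u : E} {K : ℝ}
    (hu : ∀ᶠ t in atTop, formNorm (g (φ t x)) (A t x u) ≤ K) :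
    u ∈ limSubspace (cocycleCurve φ A Λ x) atTop := by
  obtain ⟨κ, hκ0, hκ⟩ := h.exists_isMonotoneCurve
  obtain ⟨C, hC⟩ := h.form_bounded
  -- Invariance of the form gives `|σ z u| ≤ |C| K |A_t z|`; the square of the right side is `(C K)²
  -- / κ` times the energy.
  refine (hκ x).mem_limSubspace_of_pairing_le (K := (C * K) ^ 2 / κ) ?_
  filter_upwards [hu] with t ht z _
  have h1 := hC (φ t x) (A t x z) (A t x u)
  rw [h.symplectic] at h1
  have h2 : |σ x z u| ≤ |C| * K * formNorm (g (φ t x)) (A t x z) := by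
    calc |σ x z u| ≤ _ := h1
      _ ≤ |C| * formNorm (g (φ t x)) (A t x z) * formNorm (g (φ t x)) (A t x u) := by
        have := formNorm_nonneg (g (φ t x)) (A t x z)
        have := formNorm_nonneg (g (φ t x)) (A t x u)
        gcongr
        exact le_abs_self C
      _ ≤ |C| * formNorm (g (φ t x)) (A t x z) * K := by
        have := formNorm_nonneg (g (φ t x)) (A t x z)
        gcongr
      _ = _ := by ring
  calc σ x z u ^ 2 = |σ x z u| ^ 2 := (sq_abs _).symm
    _ ≤ (|C| * K * formNorm (g (φ t x)) (A t x z)) ^ 2 := by gcongr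
    _ = _ := by rw [mul_pow, mul_pow, sq_abs]; field_simp

/-- The orbit of `X` is `X` along the orbit of the base point, which is bounded. -/
theorem field_mem_limSubspace (x : S) : X x ∈ limSubspace (cocycleCurve φ A Λ x) atTop := by
  obtain ⟨C, hC⟩ := h.field_bounded
  refine h.mem_limSubspace_of_bounded (K := C) (Eventually.of_forall fun t => ?_)
  rw [h.deriv_field]; exact hC _

theorem pairing_eq_zero {x : S} {v : E} (hv : v ∈ limSubspace (cocycleCurve φ A Λ x) atTop) :
    σ x (X x) v = 0 := (h.mem_limSubspace_iff x (X x)).1 (h.field_mem_limSubspace x) v hv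

omit h [FiniteDimensional ℝ E] in
theorem pairing_orthComponent {x : S} {z : E} (hz : σ x z (X x) = 0) (u : E) :
    σ x z (orthComponent (g x) (X x) u) = σ x z u := by
  simp [orthComponent, hz]

/-- Vectors tangent to the level with a bounded future modulo `X` belong to the limit subspace. -/
theorem mem_limSubspace_of_reduced_bounded {x : S} {u : E} {K : ℝ} (hXu : σ x (X x) u = 0)
    (hu : ∀ᶠ t in atTop,
      formNorm (g (φ t x)) (orthComponent (g (φ t x)) (X (φ t x)) (A t x u)) ≤ K) :
    u ∈ limSubspace (cocycleCurve φ A Λ x) atTop := by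
  obtain ⟨κ, hκ0, hκ⟩ := h.exists_isMonotoneCurve
  obtain ⟨C, hC⟩ := h.form_bounded
  refine (hκ x).mem_limSubspace_of_reduced_pairing_le (K := (C * K) ^ 2 / κ)
    (h.field_mem_limSubspace x) (h.field_ne x) hXu ?_
  filter_upwards [hu] with t ht z _ hzX
  rw [← h.symplectic t, h.deriv_field] at hzX
  have h1 := hC (φ t x) (A t x z) (orthComponent (g (φ t x)) (X (φ t x)) (A t x u))
  -- Since `A_t z` is orthogonal to `X`, its pairing does not see the `X`-component of `A_t u`, and
  -- only the reduced norm enters.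
  rw [pairing_orthComponent hzX, h.symplectic] at h1
  have h2 : |σ x z u| ≤ |C| * K * formNorm (g (φ t x)) (A t x z) := by
    have h3 := formNorm_nonneg (g (φ t x)) (A t x z)
    have h4 := formNorm_nonneg (g (φ t x)) (orthComponent (g (φ t x)) (X (φ t x)) (A t x u))
    calc |σ x z u| ≤ _ := h1
      _ ≤ |C| * formNorm (g (φ t x)) (A t x z) *
          formNorm (g (φ t x)) (orthComponent (g (φ t x)) (X (φ t x)) (A t x u)) := by
        gcongr
        exact le_abs_self C
      _ ≤ |C| * formNorm (g (φ t x)) (A t x z) * K := by gcongr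
      _ = _ := by ring
  calc σ x z u ^ 2 = |σ x z u| ^ 2 := (sq_abs _).symm
    _ ≤ (|C| * K * formNorm (g (φ t x)) (A t x z)) ^ 2 := by gcongr
    _ = _ := by rw [mul_pow, mul_pow, sq_abs]; field_simp

end MonotoneCocycle

end Cocycle

end MonotoneHam

namespace MonotoneHam

/-! ### Growth modulo the invariant field -/

section Hyperbolicity

variable {E : Type*} [NormedAddCommGroup E] [NormedSpace ℝ E] {S : Type*}

/-- The norm of `A_t u` modulo the invariant field `X`. -/
noncomputable def redGrowth (φ : ℝ → S → S) (A : ℝ → S → E →L[ℝ] E) (X : S → E)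
    (g : S → E →L[ℝ] E →L[ℝ] ℝ) (x : S) (u : E) (t : ℝ) : ℝ :=
  formNorm (g (φ t x)) (orthComponent (g (φ t x)) (X (φ t x)) (A t x u))

variable {φ : ℝ → S → S} {A : ℝ → S → E →L[ℝ] E} {σ : S → E →L[ℝ] E →L[ℝ] ℝ}
  {Λ : S → Submodule ℝ E} {X : S → E} {g : S → E →L[ℝ] E →L[ℝ] ℝ}

theorem redGrowth_nonneg (x : S) (u : E) (t : ℝ) : 0 ≤ redGrowth φ A X g x u t :=
  formNorm_nonneg _ _

theorem redGrowth_smul (a : ℝ) (x : S) (u : E) (t : ℝ) :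
    redGrowth φ A X g x (a • u) t = |a| * redGrowth φ A X g x u t := by
  simp [redGrowth, orthComponent_smul, formNorm_smul]

theorem continuous_redGrowth (x : S) (t : ℝ) : Continuous fun u => redGrowth φ A X g x u t :=
  (continuous_formNorm _).comp ((continuous_orthComponent _ _).comp (A t x).continuous)

theorem redGrowth_reverse (x : S) (u : E) (t : ℝ) :
    redGrowth (fun t => φ (-t)) (fun t => A (-t)) (fun x => -X x) g x u t =
      redGrowth φ A X g x u (-t) := by
  simp [redGrowth, orthComponent_neg]

namespace MonotoneCocycle

variable (h : MonotoneCocycle φ A σ Λ X g)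
include h

theorem redGrowth_zero (x : S) (u : E) :
    redGrowth φ A X g x u 0 = formNorm (g x) (orthComponent (g x) (X x) u) := by
  simp [redGrowth, h.flow_zero, h.deriv_zero]

theorem redGrowth_add (x : S) (u : E) (s t : ℝ) :
    redGrowth φ A X g x u (s + t) = redGrowth φ A X g (φ t x) (A t x u) s := by
  simp [redGrowth, h.flow_add, h.deriv_add]

theorem redGrowth_add_smul (x : S) (u : E) (a t : ℝ) :
    redGrowth φ A X g x (u + a • X x) t = redGrowth φ A X g x u t := by
  rw [redGrowth, map_add, map_smul, h.deriv_field,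
    orthComponent_add_smul (h.metric_pos _) (h.field_ne _), redGrowth]

theorem redGrowth_le (x : S) (u : E) (t : ℝ) :
    redGrowth φ A X g x u t ≤ formNorm (g (φ t x)) (A t x u) :=
  formNorm_orthComponent_le (h.metric_symm _) (h.metric_pos _) (h.field_ne _) _

theorem redGrowth_zero_le (x : S) (u : E) : redGrowth φ A X g x u 0 ≤ formNorm (g x) u := by
  simpa [h.flow_zero, h.deriv_zero] using h.redGrowth_le x u 0

theorem redGrowth_orthComponent (x : S) (u : E) (t : ℝ) :
    redGrowth φ A X g x (orthComponent (g x) (X x) u) t = redGrowth φ A X g x u t := by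
  rw [orthComponent, sub_eq_add_neg, ← neg_smul, h.redGrowth_add_smul]

theorem redGrowth_eq_zero_of_mem_span {x : S} {u : E} (hu : u ∈ Submodule.span ℝ {X x}) (t : ℝ) :
    redGrowth φ A X g x u t = 0 := by
  obtain ⟨a, rfl⟩ := Submodule.mem_span_singleton.1 hu
  have := h.redGrowth_add_smul x 0 a t
  rw [zero_add] at this
  rw [this]
  simp [redGrowth, orthComponent, formNorm]

/-- Reduced growth ignores multiples of `X`, so the vector at time `t` may be taken orthogonal to
`X`; there its reduced norm is its norm and `deriv_bounded` applies. -/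
theorem redGrowth_bounded (T : ℝ) : ∃ C, 0 ≤ C ∧ ∀ x u s t, |s - t| ≤ T →
    redGrowth φ A X g x u s ≤ C * redGrowth φ A X g x u t := by
  obtain ⟨C, hC⟩ := h.deriv_bounded T
  refine ⟨|C|, abs_nonneg C, fun x u s t hst => ?_⟩
  have h1 := h.redGrowth_add x u (s - t) t
  rw [sub_add_cancel] at h1
  have h2 := h.redGrowth_add x u 0 t
  rw [zero_add] at h2
  rw [h1, h2, ← h.redGrowth_orthComponent, h.redGrowth_zero]
  refine (h.redGrowth_le _ _ _).trans ((hC _ _ _ hst).trans ?_)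
  exact mul_le_mul_of_nonneg_right (le_abs_self C) (formNorm_nonneg _ _)

theorem pairing_deriv (x : S) (u : E) (t : ℝ) :
    σ (φ t x) (X (φ t x)) (A t x u) = σ x (X x) u := by
  rw [← h.deriv_field, h.symplectic]

theorem pairing_orthComponent_right (x : S) (u : E) :
    σ x (X x) (orthComponent (g x) (X x) u) = σ x (X x) u := by
  simp [orthComponent, h.alternating]

variable [FiniteDimensional ℝ E]

theorem mem_atBot_of_reduced_bounded {x : S} {u : E} {K : ℝ} (hXu : σ x (X x) u = 0)
    (hu : ∀ t, 0 ≤ t → redGrowth φ A X g x u (-t) ≤ K) :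
    u ∈ limSubspace (cocycleCurve φ A Λ x) atBot := by
  rw [← limSubspace_comp_neg]
  refine h.reverse.mem_limSubspace_of_reduced_bounded (K := K) (by simpa using hXu) ?_
  filter_upwards [eventually_ge_atTop 0] with t ht
  have := hu t ht
  rw [← redGrowth_reverse] at this
  exact this

theorem mem_atTop_of_reduced_bounded {x : S} {u : E} {K : ℝ} (hXu : σ x (X x) u = 0)
    (hu : ∀ t, 0 ≤ t → redGrowth φ A X g x u t ≤ K) :
    u ∈ limSubspace (cocycleCurve φ A Λ x) atTop :=
  h.mem_limSubspace_of_reduced_bounded hXu <| (eventually_ge_atTop 0).mono fun t ht => hu t ht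

/-- If the limit subspaces meet only along `X` then vectors double, modulo `X`, within a uniform
time, in the future or in the past. -/
theorem exists_doubling (hΔ : ∀ x, limSubspace (cocycleCurve φ A Λ x) atTop ⊓
      limSubspace (cocycleCurve φ A Λ x) atBot ≤ Submodule.span ℝ {X x}) :
    ∃ T, 0 < T ∧ ∀ x u, σ x (X x) u = 0 → ∀ t, ∃ s, |s - t| ≤ T ∧
      2 * redGrowth φ A X g x u t ≤ redGrowth φ A X g x u s := by
  -- By the cocycle identity it is enough to double from time zero at every base point.
  suffices H : ∃ T, 0 < T ∧ ∀ x u, σ x (X x) u = 0 → ∃ s, |s| ≤ T ∧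
      2 * redGrowth φ A X g x u 0 ≤ redGrowth φ A X g x u s by
    obtain ⟨T, hT, H⟩ := H
    refine ⟨T, hT, fun x u hu t => ?_⟩
    obtain ⟨s, hs, hle⟩ := H (φ t x) (A t x u) (by rw [h.pairing_deriv, hu])
    rw [← h.redGrowth_add, ← h.redGrowth_add, zero_add] at hle
    exact ⟨s + t, by simpa using hs, hle⟩
  -- Otherwise normalised vectors that fail to double within time `k + 1` have a limit `w` of
  -- reduced norm one at time zero and at most two at all times, which therefore lies in both limit
  -- subspaces.
  by_contra! H
  choose x u hu hlt using fun k : ℕ => H (k + 1) (by positivity)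
  have hpos : ∀ k, 0 < redGrowth φ A X g (x k) (u k) 0 := fun k => by
    have := hlt k 0 (by simp; positivity)
    have := redGrowth_nonneg (φ := φ) (A := A) (X := X) (g := g) (x k) (u k) 0
    linarith
  let v : ℕ → E := fun k => (redGrowth φ A X g (x k) (u k) 0)⁻¹ •
    orthComponent (g (x k)) (X (x k)) (u k)
  have hv : ∀ k t, redGrowth φ A X g (x k) (v k) t =
      (redGrowth φ A X g (x k) (u k) 0)⁻¹ * redGrowth φ A X g (x k) (u k) t := fun k t => by
    rw [redGrowth_smul, h.redGrowth_orthComponent, abs_of_pos (inv_pos.2 (hpos k))]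
  have hv1 : ∀ k, formNorm (g (x k)) (v k) = 1 := fun k => by
    rw [formNorm_smul, ← h.redGrowth_zero, abs_of_pos (inv_pos.2 (hpos k)),
      inv_mul_cancel₀ (hpos k).ne']
  have hvX : ∀ k, σ (x k) (X (x k)) (v k) = 0 := fun k => by
    rw [map_smul, h.pairing_orthComponent_right, hu, smul_zero]
  obtain ⟨y, w, -, h2, h3, -⟩ := h.compact x v hv1
  have hw0 : redGrowth φ A X g y w 0 = 1 := by
    refine tendsto_nhds_unique (h2 0) (tendsto_const_nhds.congr fun k => ?_)
    have := hv k 0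
    rw [inv_mul_cancel₀ (hpos k).ne'] at this
    exact this.symm
  have hwX : σ y (X y) w = 0 := by
    refine tendsto_nhds_unique h3 (tendsto_const_nhds.congr fun k => (hvX k).symm)
  have hw2 : ∀ t, redGrowth φ A X g y w t ≤ 2 := fun t => by
    refine le_of_tendsto (h2 t) ?_
    have hev : ∀ᶠ k : ℕ in hyperfilter ℕ, |t| ≤ k := by
      refine Nat.hyperfilter_le_atTop ?_
      filter_upwards [eventually_ge_atTop ⌈|t|⌉₊] with k hk
      exact Nat.ceil_le.1 hk
    filter_upwards [hev] with k hk
    have h4 := hlt k t (by linarith)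
    change redGrowth φ A X g (x k) (v k) t ≤ 2
    rw [hv, inv_mul_le_iff₀ (hpos k)]
    linarith
  have hmem : w ∈ Submodule.span ℝ {X y} := hΔ y
    ⟨h.mem_atTop_of_reduced_bounded hwX fun t _ => hw2 t,
      h.mem_atBot_of_reduced_bounded hwX fun t _ => hw2 (-t)⟩
  rw [h.redGrowth_eq_zero_of_mem_span hmem] at hw0
  exact zero_ne_one hw0

omit [FiniteDimensional ℝ E] in
theorem redGrowth_bounded_interval (x : S) (u : E) (L : ℝ) :
    ∃ K, ∀ t ∈ Icc 0 L, redGrowth φ A X g x u t ≤ K := by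
  obtain ⟨C, -, hC⟩ := h.redGrowth_bounded L
  refine ⟨_, fun t ht => hC x u t 0 ?_⟩
  rw [sub_zero, abs_of_nonneg ht.1]; exact ht.2

section Doubling

variable (hd : ∃ T, 0 < T ∧ ∀ x u, σ x (X x) u = 0 → ∀ t, ∃ s, |s - t| ≤ T ∧
      2 * redGrowth φ A X g x u t ≤ redGrowth φ A X g x u s)
include hd

omit [FiniteDimensional ℝ E] in
theorem exists_exp_decay : ∃ C l, 0 ≤ C ∧ 0 < l ∧ ∀ x u K, σ x (X x) u = 0 →
    (∀ t, 0 ≤ t → redGrowth φ A X g x u t ≤ K) → ∀ t, 0 ≤ t →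
      redGrowth φ A X g x u t ≤ C * Real.exp (-l * t) * redGrowth φ A X g x u 0 := by
  obtain ⟨T, hT, hd⟩ := hd
  obtain ⟨C, hC0, hC⟩ := h.redGrowth_bounded T
  refine ⟨2 * C, Real.log 2 / T, by positivity, div_pos (Real.log_pos (by norm_num)) hT,
    fun x u K hu hK t ht => ?_⟩
  exact exp_decay_of_doubling (redGrowth_nonneg x u) hT (hC x u) (hd x u hu) hC0 hK ht

/-- Vectors of `Λ` are controlled by their past. -/
theorem exists_le_redGrowth_past : ∃ C, 0 ≤ C ∧ ∀ x u, u ∈ Λ x → σ x (X x) u = 0 → ∀ t, 0 ≤ t →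
    formNorm (g x) u ≤ C * redGrowth φ A X g x u (-t) := by
  obtain ⟨T, hT, hd⟩ := hd
  obtain ⟨C, hC0, hC⟩ := h.redGrowth_bounded T
  -- A failing sequence, normalised, consists of unit vectors of `Λ` whose reduced norm at time `-t
  -- k` is at most `1 / (k + 1)`. Their limit `w` turns out to be bounded modulo `X` in the past,
  -- hence in the past limit subspace, which meets `Λ` only in zero.
  by_contra! H
  choose x u hΛ hu t ht hlt using fun k : ℕ => H (k + 1) (by positivity)
  have hpos : ∀ k, 0 < formNorm (g (x k)) (u k) := fun k =>
    lt_of_le_of_lt (mul_nonneg (by positivity) (redGrowth_nonneg _ _ _)) (hlt k)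
  let v : ℕ → E := fun k => (formNorm (g (x k)) (u k))⁻¹ • u k
  have hv1 : ∀ k, formNorm (g (x k)) (v k) = 1 := fun k => by
    rw [formNorm_smul, abs_of_pos (inv_pos.2 (hpos k)), inv_mul_cancel₀ (hpos k).ne']
  have hvX : ∀ k, σ (x k) (X (x k)) (v k) = 0 := fun k => by rw [map_smul, hu, smul_zero]
  have hvΛ : ∀ k, v k ∈ Λ (x k) := fun k => (Λ (x k)).smul_mem _ (hΛ k)
  have hvt : ∀ k, (k + 1) * redGrowth φ A X g (x k) (v k) (-t k) ≤ 1 := fun k => by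
    have := hlt k
    rw [redGrowth_smul, abs_of_pos (inv_pos.2 (hpos k)), mul_left_comm,
      inv_mul_le_iff₀ (hpos k)]
    linarith
  have hvt1 : ∀ k, redGrowth φ A X g (x k) (v k) (-t k) ≤ 1 := fun k => by
    have h1 := redGrowth_nonneg (φ := φ) (A := A) (X := X) (g := g) (x k) (v k) (-t k)
    have : (0 : ℝ) ≤ k * redGrowth φ A X g (x k) (v k) (-t k) := by positivity
    linarith [hvt k]
  obtain ⟨y, w, h1, h2, h3, h4⟩ := h.compact x v hv1
  have hw1 : formNorm (g y) w = 1 := by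
    have := h1 0
    simp only [h.flow_zero, h.deriv_zero, hv1] at this
    exact tendsto_nhds_unique this tendsto_const_nhds
  have hwX : σ y (X y) w = 0 :=
    tendsto_nhds_unique h3 (tendsto_const_nhds.congr fun k => (hvX k).symm)
  have hbd : ∀ s, 0 ≤ s → redGrowth φ A X g y w (-s) ≤ C := fun s hs => by
    obtain ⟨B, hB0, hB⟩ := h.redGrowth_bounded s
    -- If `s ≤ t k`, the reduced norms at both ends of the time interval from `-t k` to `0` are at
    -- most one and doubling gives the bound `C`. Otherwise `-s` is at most time `s` beyond `-t k`,
    -- where the reduced norm is small.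
    have hk : ∀ k : ℕ, redGrowth φ A X g (x k) (v k) (-s) ≤ C + B * ((k : ℝ) + 1)⁻¹ := by
      intro k
      have hpos' : (0 : ℝ) < k + 1 := by positivity
      rcases le_total s (t k) with hst | hst
      · have h5 := le_max_endpoints_of_doubling (f := fun r => redGrowth φ A X g (x k) (v k) (-r))
          (fun r => redGrowth_nonneg _ _ _) (C := C) (T := T) (L := t k)
          (fun r r' hr => hC _ _ _ _ (by rw [← abs_neg]; simpa [neg_add_eq_sub] using hr))
          (fun r => by
            obtain ⟨r', hr', hle⟩ := hd (x k) (v k) (hvX k) (-r)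
            refine ⟨-r', ?_, by simpa using hle⟩
            rw [← abs_neg]; simpa [add_comm] using hr') hC0
          (K := (h.reverse.redGrowth_bounded_interval (x k) (v k) (t k)).choose)
          (fun r hr => by
            have := (h.reverse.redGrowth_bounded_interval (x k) (v k) (t k)).choose_spec r hr
            rwa [redGrowth_reverse] at this) (t := s) ⟨hs, hst⟩
        have h6 : max (redGrowth φ A X g (x k) (v k) (-0))
            (redGrowth φ A X g (x k) (v k) (-t k)) ≤ 1 := by
          refine max_le ?_ (hvt1 k)
          rw [neg_zero]
          exact (h.redGrowth_zero_le _ _).trans (hv1 k).le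
        have h7 : C * max (redGrowth φ A X g (x k) (v k) (-0))
            (redGrowth φ A X g (x k) (v k) (-t k)) ≤ C * 1 :=
          mul_le_mul_of_nonneg_left h6 hC0
        have h8 : 0 ≤ B * ((k : ℝ) + 1)⁻¹ := by positivity
        linarith
      · have h5 := hB (x k) (v k) (-s) (-t k) (by
          rw [abs_le]; constructor <;> linarith [ht k])
        have h6 : redGrowth φ A X g (x k) (v k) (-t k) ≤ ((k : ℝ) + 1)⁻¹ := by
          rw [inv_eq_one_div, le_div_iff₀ hpos', mul_comm]; exact hvt k
        have h7 : B * redGrowth φ A X g (x k) (v k) (-t k) ≤ B * ((k : ℝ) + 1)⁻¹ :=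
          mul_le_mul_of_nonneg_left h6 hB0
        linarith
    have hlim : Tendsto (fun k : ℕ => C + B * ((k : ℝ) + 1)⁻¹) (hyperfilter ℕ) (𝓝 C) := by
      have h5 : Tendsto (fun k : ℕ => C + B * ((k : ℝ) + 1)⁻¹) atTop (𝓝 (C + B * 0)) := by
        refine (Tendsto.const_mul B ?_).const_add C
        simpa [one_div] using tendsto_one_div_add_atTop_nhds_zero_nat (𝕜 := ℝ)
      rw [mul_zero, add_zero] at h5
      exact h5.mono_left Nat.hyperfilter_le_atTop
    exact le_of_tendsto_of_tendsto (h2 (-s)) hlim (Eventually.of_forall hk)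
  have hmem := h.mem_atBot_of_reduced_bounded hwX hbd
  rw [← limSubspace_comp_neg] at hmem
  have hw0 := h.reverse.eq_zero_of_mem_limSubspace hmem (h4 hvΛ)
  rw [hw0] at hw1
  simp [formNorm] at hw1

/-- Vectors of the limit subspace stay bounded in the future, modulo `X`. -/
theorem redGrowth_bounded_of_mem : ∃ C, ∀ x, ∀ v ∈ limSubspace (cocycleCurve φ A Λ x) atTop,
    ∀ s, 0 ≤ s → redGrowth φ A X g x v s ≤ C * redGrowth φ A X g x v 0 := by
  obtain ⟨C', hC'0, hC'⟩ := h.exists_le_redGrowth_past hd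
  obtain ⟨T, hT, hd⟩ := hd
  obtain ⟨C, hC0, hC⟩ := h.redGrowth_bounded T
  obtain ⟨κ, -, hκ⟩ := h.exists_isMonotoneCurve
  refine ⟨C * max 1 C', fun x z hz s hs => ?_⟩
  -- The approximants satisfy `A_t (v t) ∈ Λ`, so their size at time `t` is controlled by their size
  -- at time zero. Doubling then controls them on all of `[0, t]`, and the bound passes to the
  -- limit.
  obtain ⟨v, a, hv, hlim⟩ := (hκ x).exists_reduced_approximation (h.field_mem_limSubspace x)
    (h.field_ne x) hz
  have hconv : ∀ r, Tendsto (fun t => redGrowth φ A X g x (v t) r) atTop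
      (𝓝 (redGrowth φ A X g x z r)) := fun r => by
    refine (((continuous_redGrowth x r).tendsto z).comp hlim).congr fun t => ?_
    exact h.redGrowth_add_smul x (v t) (a t) r
  refine le_of_tendsto_of_tendsto (hconv s) ((hconv 0).const_mul _) ?_
  filter_upwards [eventually_gt_atTop 0, eventually_ge_atTop s] with t ht hst
  obtain ⟨hvJ, hvX⟩ := hv t ht
  have hvX' : σ x (X x) (v t) = 0 := by rw [h.swap, hvX, neg_zero]
  have h1 := le_max_endpoints_of_doubling (f := redGrowth φ A X g x (v t))
    (redGrowth_nonneg x (v t)) (hC x (v t)) (hd x (v t) hvX') hC0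
    (h.redGrowth_bounded_interval x (v t) t).choose_spec (t := s) ⟨hs, hst⟩
  have h2 := hC' (φ t x) (A t x (v t)) hvJ (by rw [h.pairing_deriv, hvX']) t ht.le
  rw [← h.redGrowth_add, neg_add_cancel] at h2
  have h3 : redGrowth φ A X g x (v t) t ≤ C' * redGrowth φ A X g x (v t) 0 :=
    (h.redGrowth_le _ _ _).trans h2
  have h4 := redGrowth_nonneg (φ := φ) (A := A) (X := X) (g := g) x (v t) 0
  rw [mul_assoc]
  refine h1.trans (mul_le_mul_of_nonneg_left ?_ hC0)
  rw [max_mul_of_nonneg _ _ h4, one_mul]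
  exact max_le_max le_rfl h3

end Doubling

end MonotoneCocycle

end Hyperbolicity

end MonotoneHam

namespace MonotoneHam

/-! ### Double orthogonals -/

section Orthogonal

variable {E : Type*} [NormedAddCommGroup E] [NormedSpace ℝ E] [FiniteDimensional ℝ E]

/-- A subspace of a finite-dimensional symplectic space is its own double orthogonal. -/
theorem mem_of_forall_orthogonal {σ : E →L[ℝ] E →L[ℝ] ℝ}
    (hnd : ∀ v, (∀ w, σ v w = 0) → v = 0) {W : Submodule ℝ E} {u : E}
    (h : ∀ z, (∀ w ∈ W, σ z w = 0) → σ z u = 0) : u ∈ W := by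
  by_contra hu
  -- A functional that vanishes on `W` but not at `u` is `σ z` for some `z`.
  obtain ⟨f, hf, hW⟩ := Submodule.exists_le_ker_of_notMem hu
  let L : E →ₗ[ℝ] Module.Dual ℝ E :=
    { toFun := fun v => (σ v).toLinearMap
      map_add' := fun a b => by ext; simp
      map_smul' := fun a b => by ext; simp }
  have hinj : Function.Injective L := by
    rw [← LinearMap.ker_eq_bot, LinearMap.ker_eq_bot']
    intro v hv
    exact hnd v fun w => congrArg (fun f : Module.Dual ℝ E => f w) hv
  obtain ⟨z, hz⟩ := (LinearMap.injective_iff_surjective_of_finrank_eq_finrank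
    (Subspace.dual_finrank_eq (K := ℝ) (V := E)).symm).1 hinj f
  have hz' : ∀ w, σ z w = f w := fun w => congrArg (fun f : Module.Dual ℝ E => f w) hz
  exact hf (by rw [← hz']; exact h z fun w hw => by rw [hz']; exact hW hw)

end Orthogonal

/-- A function whose unit time increments decay exponentially converges exponentially fast. -/
theorem exists_exp_close {h : ℝ → ℝ} {D l : ℝ} (hl : 0 < l)
    (hh : ∀ t s, 0 ≤ t → 0 ≤ s → s ≤ 1 → |h (t + s) - h t| ≤ D * Real.exp (-l * t)) :
    ∃ a, ∀ t, 0 ≤ t →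
      |h t - a| ≤ Real.exp l * (1 + 1 / (1 - Real.exp (-l))) * D * Real.exp (-l * t) := by
  have hr : Real.exp (-l) < 1 := Real.exp_lt_one_iff.2 (by linarith)
  have hpow : ∀ n : ℕ, Real.exp (-l * n) = Real.exp (-l) ^ n := fun n => by
    rw [mul_comm, Real.exp_nat_mul]
  have hD : 0 ≤ D := by
    have := (abs_nonneg _).trans (hh 0 0 le_rfl le_rfl zero_le_one)
    simpa using this
  have hu : ∀ n : ℕ, dist (h n) (h (n + 1 : ℕ)) ≤ D * Real.exp (-l) ^ n := fun n => by
    rw [dist_comm, Real.dist_eq, ← hpow]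
    push_cast
    exact hh n 1 (by positivity) zero_le_one le_rfl
  -- The values at integer times form a geometric Cauchy sequence. The fractional part of the time
  -- costs one more increment, and rounding down costs the factor `exp l`.
  obtain ⟨a, ha⟩ := cauchySeq_tendsto_of_complete
    (cauchySeq_of_le_geometric (f := fun n : ℕ => h n) _ _ hr hu)
  refine ⟨a, fun t ht => ?_⟩
  have h1 := dist_le_of_le_geometric_of_tendsto (f := fun n : ℕ => h n) _ _ hr hu ha ⌊t⌋₊
  rw [Real.dist_eq, ← hpow] at h1
  have hfl := Nat.floor_le ht
  have hfu := Nat.lt_floor_add_one t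
  have h2 := hh ⌊t⌋₊ (t - ⌊t⌋₊) (by positivity) (by linarith) (by linarith)
  rw [add_sub_cancel] at h2
  have h3 : Real.exp (-l * ⌊t⌋₊) ≤ Real.exp l * Real.exp (-l * t) := by
    rw [← Real.exp_add, Real.exp_le_exp]
    nlinarith
  have h4 : 0 < 1 - Real.exp (-l) := by linarith
  calc |h t - a| = |(h t - h ⌊t⌋₊) + (h ⌊t⌋₊ - a)| := by ring_nf
    _ ≤ |h t - h ⌊t⌋₊| + |h ⌊t⌋₊ - a| := abs_add_le _ _
    _ ≤ D * Real.exp (-l * ⌊t⌋₊) + D * Real.exp (-l * ⌊t⌋₊) / (1 - Real.exp (-l)) :=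
        add_le_add h2 h1
    _ = (1 + 1 / (1 - Real.exp (-l))) * D * Real.exp (-l * ⌊t⌋₊) := by ring
    _ ≤ (1 + 1 / (1 - Real.exp (-l))) * D * (Real.exp l * Real.exp (-l * t)) := by gcongr
    _ = _ := by ring

/-! ### Stable subspaces and the Anosov splitting -/

section Splitting

variable {E : Type*} [NormedAddCommGroup E] [NormedSpace ℝ E] {S : Type*}
  {φ : ℝ → S → S} {A : ℝ → S → E →L[ℝ] E} {σ : S → E →L[ℝ] E →L[ℝ] ℝ}
  {Λ : S → Submodule ℝ E} {X : S → E} {g : S → E →L[ℝ] E →L[ℝ] ℝ}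

namespace MonotoneCocycle

variable (h : MonotoneCocycle φ A σ Λ X g)
include h

theorem mem_stableSubspace_iff {x : S} {v : E} :
    v ∈ stableSubspace φ A g h.metric_symm h.metric_pos x ↔
      Tendsto (fun t => formNorm (g (φ t x)) (A t x v)) atTop (𝓝 0) := Iff.rfl

theorem stableSubspace_map (x : S) (t : ℝ) :
    (stableSubspace φ A g h.metric_symm h.metric_pos x).map (A t x).toLinearMap =
      stableSubspace φ A g h.metric_symm h.metric_pos (φ t x) := by
  have key : ∀ v, A t x v ∈ stableSubspace φ A g h.metric_symm h.metric_pos (φ t x) ↔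
      v ∈ stableSubspace φ A g h.metric_symm h.metric_pos x := fun v => by
    rw [h.mem_stableSubspace_iff, h.mem_stableSubspace_iff]
    simp only [← h.flow_add, ← h.deriv_add]
    constructor
    · intro hv
      have h1 := hv.comp (tendsto_atTop_add_const_right atTop (-t) tendsto_id)
      simpa [Function.comp_def] using h1
    · intro hv
      exact hv.comp (tendsto_atTop_add_const_right atTop t tendsto_id)
  ext w
  constructor
  · rintro ⟨v, hv, rfl⟩
    exact (key v).2 hv
  · intro hw
    obtain ⟨v, rfl⟩ := h.deriv_surjective t x w
    exact ⟨v, (key v).1 hw, rfl⟩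

/-- The norm of the invariant field is bounded below along the orbit, so no nonzero multiple of it
is contracted. -/
theorem eq_zero_of_smul_field_mem_stable {x : S} {a : ℝ}
    (ha : a • X x ∈ stableSubspace φ A g h.metric_symm h.metric_pos x) : a = 0 := by
  obtain ⟨c, hc, hcX⟩ := h.field_bounded_below
  rw [h.mem_stableSubspace_iff] at ha
  have h1 : |a| * c ≤ 0 := ge_of_tendsto ha <| Eventually.of_forall fun t => by
    rw [map_smul, h.deriv_field, formNorm_smul]
    exact mul_le_mul_of_nonneg_left (hcX _) (abs_nonneg a)
  have h2 := abs_nonneg a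
  exact abs_eq_zero.1 (le_antisymm (by nlinarith) h2)

variable [FiniteDimensional ℝ E]

theorem stableSubspace_le (x : S) : stableSubspace φ A g h.metric_symm h.metric_pos x ≤
    limSubspace (cocycleCurve φ A Λ x) atTop := fun _ hv =>
  h.mem_limSubspace_of_bounded (K := 1) (((h.mem_stableSubspace_iff).1 hv).eventually
    (ge_mem_nhds (zero_lt_one)))

/-- Vectors of the limit subspace decay exponentially after subtraction of a multiple of `X`. -/
theorem exists_exp_decay_sub (hd : ∃ T, 0 < T ∧ ∀ x u, σ x (X x) u = 0 → ∀ t, ∃ s, |s - t| ≤ T ∧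
      2 * redGrowth φ A X g x u t ≤ redGrowth φ A X g x u s) :
    ∃ C l, 0 < C ∧ 0 < l ∧ ∀ x, ∀ v ∈ limSubspace (cocycleCurve φ A Λ x) atTop, ∃ a : ℝ,
      ∀ t, 0 ≤ t → formNorm (g (φ t x)) (A t x (v - a • X x)) ≤
        C * Real.exp (-l * t) * formNorm (g x) v := by
  obtain ⟨C₀, hC₀⟩ := h.redGrowth_bounded_of_mem hd
  obtain ⟨C₁, l, hC₁, hl, hdec⟩ := h.exists_exp_decay hd
  obtain ⟨C₂, hC₂⟩ := h.deriv_bounded 1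
  obtain ⟨c, hc, hcX⟩ := h.field_bounded_below
  obtain ⟨B, hB⟩ := h.field_bounded
  set P := Real.exp l * (1 + 1 / (1 - Real.exp (-l))) with hP
  have hP0 : 0 ≤ P := by
    have : 0 < 1 - Real.exp (-l) := by
      have := Real.exp_lt_one_iff.2 (show -l < 0 by linarith)
      linarith
    positivity
  -- The first two terms bound the component orthogonal to `X` and the component along `X`; the
  -- final `1` makes the constant positive.
  refine ⟨C₁ + P * (|C₂| / c * C₁) * |B| + 1, l, by positivity, hl, fun x v hv => ?_⟩
  have hn : redGrowth φ A X g x v 0 ≤ formNorm (g x) v := h.redGrowth_zero_le x v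
  have hdec' : ∀ t, 0 ≤ t → redGrowth φ A X g x v t ≤
      C₁ * Real.exp (-l * t) * formNorm (g x) v := fun t ht =>
    (hdec x v _ (h.pairing_eq_zero hv) (hC₀ x v hv) t ht).trans (by gcongr)
  let η : S → E → ℝ := fun y w => g y w (X y) / g y (X y) (X y)
  have hη : ∀ y w, w = orthComponent (g y) (X y) w + η y w • X y := fun y w => by
    simp [orthComponent, η]
  have hη1 : ∀ y w (a : ℝ), η y (w + a • X y) = η y w + a := fun y w a => by
    have := (h.metric_pos y _ (h.field_ne y)).ne'
    simp only [η, map_add, map_smul, add_apply, smul_apply, smul_eq_mul]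
    field_simp
  have hηle : ∀ y w, |η y w| ≤ formNorm (g y) w / c := fun y w => by
    have h1 := form_le_formNorm_mul (h.metric_symm y) (h.metric_pos y) w (X y)
    have h2 := hc.trans_le (hcX y)
    simp only [η]
    rw [abs_div, ← formNorm_sq (h.metric_pos y) (X y), abs_of_pos (pow_pos h2 2),
      div_le_div_iff₀ (pow_pos h2 2) hc]
    have h3 := formNorm_nonneg (g y) w
    calc |g y w (X y)| * c ≤ (formNorm (g y) w * formNorm (g y) (X y)) * formNorm (g y) (X y) := by
          gcongr; exact hcX y
      _ = _ := by ring
  -- Between times `t` and `t + s` the coefficient of `X` changes only by the contribution of the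
  -- component orthogonal to `X`, which decays exponentially. Hence `H` converges, and its limit is
  -- the multiple to subtract.
  let H : ℝ → ℝ := fun t => η (φ t x) (A t x v)
  have hinc : ∀ t s, 0 ≤ t → 0 ≤ s → s ≤ 1 →
      |H (t + s) - H t| ≤ |C₂| / c * C₁ * formNorm (g x) v * Real.exp (-l * t) := by
    intro t s ht hs0 hs1
    have h1 : H (t + s) = η (φ s (φ t x)) (A s (φ t x)
        (orthComponent (g (φ t x)) (X (φ t x)) (A t x v))) + H t := by
      simp only [H]
      rw [add_comm t s, h.flow_add, h.deriv_add, ← hη1, ← h.deriv_field s, ← map_smul, ← map_add,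
        ← hη]
    rw [h1, add_sub_cancel_right]
    have h2 := hηle (φ s (φ t x)) (A s (φ t x)
        (orthComponent (g (φ t x)) (X (φ t x)) (A t x v)))
    have h3 := hC₂ s (φ t x) (orthComponent (g (φ t x)) (X (φ t x)) (A t x v))
      (by rw [abs_of_nonneg hs0]; exact hs1)
    have h4 := hdec' t ht
    have h5 : 0 ≤ redGrowth φ A X g x v t := redGrowth_nonneg _ _ _
    calc _ ≤ _ := h2
      _ ≤ |C₂| * redGrowth φ A X g x v t / c := by
        gcongr
        exact h3.trans (mul_le_mul_of_nonneg_right (le_abs_self _) h5)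
      _ ≤ |C₂| * (C₁ * Real.exp (-l * t) * formNorm (g x) v) / c := by gcongr
      _ = _ := by ring
  obtain ⟨a, ha⟩ := exists_exp_close hl hinc
  refine ⟨a, fun t ht => ?_⟩
  have h1 : A t x (v - a • X x) =
      orthComponent (g (φ t x)) (X (φ t x)) (A t x v) + (H t - a) • X (φ t x) := by
    rw [map_sub, map_smul, h.deriv_field, sub_smul, ← add_sub_assoc, ← hη]
  rw [h1]
  refine (formNorm_add_le (h.metric_symm _) (h.metric_pos _) _ _).trans ?_
  rw [formNorm_smul]
  have h2 := ha t ht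
  have h3 := hdec' t ht
  have h4 : formNorm (g (φ t x)) (X (φ t x)) ≤ |B| := (hB _).trans (le_abs_self B)
  have h5 := formNorm_nonneg (g x) v
  have h6 := formNorm_nonneg (g (φ t x)) (X (φ t x))
  have h7 : 0 ≤ Real.exp (-l * t) * formNorm (g x) v := by positivity
  calc _ ≤ C₁ * Real.exp (-l * t) * formNorm (g x) v +
        (P * (|C₂| / c * C₁ * formNorm (g x) v) * Real.exp (-l * t)) * |B| := by
        refine add_le_add h3 (mul_le_mul h2 h4 h6 ((abs_nonneg _).trans h2))
    _ ≤ C₁ * Real.exp (-l * t) * formNorm (g x) v +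
        (P * (|C₂| / c * C₁ * formNorm (g x) v) * Real.exp (-l * t)) * |B| +
          Real.exp (-l * t) * formNorm (g x) v := by linarith
    _ = _ := by ring

/-- The stable subspaces split the limit subspaces and are uniformly contracted. -/
theorem exists_stable_splitting
    (hd : ∃ T, 0 < T ∧ ∀ x u, σ x (X x) u = 0 → ∀ t, ∃ s, |s - t| ≤ T ∧
      2 * redGrowth φ A X g x u t ≤ redGrowth φ A X g x u s) :
    ∃ C l, 0 < C ∧ 0 < l ∧
      (∀ x, limSubspace (cocycleCurve φ A Λ x) atTop ≤ Submodule.span ℝ {X x} ⊔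
        stableSubspace φ A g h.metric_symm h.metric_pos x) ∧
      ∀ x, ∀ v ∈ stableSubspace φ A g h.metric_symm h.metric_pos x, ∀ t, 0 ≤ t →
        formNorm (g (φ t x)) (A t x v) ≤ C * Real.exp (-l * t) * formNorm (g x) v := by
  obtain ⟨C, l, hC, hl, hdec⟩ := h.exists_exp_decay_sub hd
  have hst : ∀ x v, ∀ w, (∀ t, 0 ≤ t → formNorm (g (φ t x)) (A t x w) ≤
        C * Real.exp (-l * t) * formNorm (g x) v) →
      w ∈ stableSubspace φ A g h.metric_symm h.metric_pos x := by
    intro x v w hw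
    rw [h.mem_stableSubspace_iff]
    refine squeeze_zero' (Eventually.of_forall fun t => formNorm_nonneg _ _)
      ((eventually_ge_atTop 0).mono hw) ?_
    have h1 : Tendsto (fun t : ℝ => -l * t) atTop atBot :=
      tendsto_id.const_mul_atTop_of_neg (by linarith)
    have h2 := ((Real.tendsto_exp_atBot.comp h1).const_mul C).mul_const (formNorm (g x) v)
    simpa using h2
  refine ⟨C, l, hC, hl, fun x v hv => ?_, fun x v hv t ht => ?_⟩
  · obtain ⟨a, ha⟩ := hdec x v hv
    exact Submodule.mem_sup.2 ⟨a • X x, Submodule.smul_mem _ _ (Submodule.mem_span_singleton_self _),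
      v - a • X x, hst x v _ ha, by abel⟩
  -- Both `v` and `v - a X` are contracted, so `a X` is too and `a = 0`: the estimate holds for `v`
  -- itself.
  · obtain ⟨a, ha⟩ := hdec x v (h.stableSubspace_le x hv)
    have h1 := Submodule.sub_mem _ hv (hst x v _ ha)
    rw [sub_sub_cancel] at h1
    have h2 := h.eq_zero_of_smul_field_mem_stable h1
    have h3 := ha t ht
    rwa [h2, zero_smul, sub_zero] at h3

theorem field_mem_limSubspace_atBot (x : S) :
    X x ∈ limSubspace (cocycleCurve φ A Λ x) atBot := by
  have := h.reverse.field_mem_limSubspace x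
  rw [show cocycleCurve (fun t => φ (-t)) (fun t => A (-t)) Λ x =
    fun t => cocycleCurve φ A Λ x (-t) from rfl, limSubspace_comp_neg] at this
  simpa using Submodule.neg_mem _ this

/-- The two limit subspaces span the tangent space of the level if and only if they intersect
along `X`. -/
theorem sup_eq_iff_inf_eq (x : S) :
    limSubspace (cocycleCurve φ A Λ x) atTop ⊔ limSubspace (cocycleCurve φ A Λ x) atBot =
        LinearMap.ker (σ x (X x)).toLinearMap ↔
      limSubspace (cocycleCurve φ A Λ x) atTop ⊓ limSubspace (cocycleCurve φ A Λ x) atBot =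
        Submodule.span ℝ {X x} := by
  set P := limSubspace (cocycleCurve φ A Λ x) atTop
  set N := limSubspace (cocycleCurve φ A Λ x) atBot
  have hP := h.mem_limSubspace_iff x
  have hN := h.mem_limSubspace_iff_atBot x
  have hXP : X x ∈ P := h.field_mem_limSubspace x
  have hXN : X x ∈ N := h.field_mem_limSubspace_atBot x
  have hle : Submodule.span ℝ {X x} ≤ P ⊓ N :=
    Submodule.span_le.2 (singleton_subset_iff.2 ⟨hXP, hXN⟩)
  have hle' : P ⊔ N ≤ LinearMap.ker (σ x (X x)).toLinearMap :=
    sup_le (fun v hv => (hP _).1 hXP v hv) fun v hv => (hN _).1 hXN v hv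
  -- Both directions are duality: `P` and `N` are their own orthogonals, so the orthogonal of their
  -- sum is their intersection, while the orthogonal of the line of `X` is the kernel of `σ X`.
  constructor
  · intro hsup
    refine le_antisymm (fun v hv => mem_of_forall_orthogonal (h.nondegenerate x) fun z hz => ?_) hle
    have h1 : z ∈ P ⊔ N := by
      rw [hsup]
      change σ x (X x) z = 0
      rw [h.swap, hz _ (Submodule.mem_span_singleton_self _), neg_zero]
    obtain ⟨p, hp, n, hn, rfl⟩ := Submodule.mem_sup.1 h1
    rw [map_add, add_apply, (hP p).1 hp v hv.1, (hN n).1 hn v hv.2, add_zero]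
  · intro hinf
    refine le_antisymm hle' fun u hu => mem_of_forall_orthogonal (h.nondegenerate x) fun z hz => ?_
    have h1 : z ∈ P ⊓ N := ⟨(hP z).2 fun w hw => hz w (Submodule.mem_sup_left hw),
      (hN z).2 fun w hw => hz w (Submodule.mem_sup_right hw)⟩
    rw [hinf] at h1
    obtain ⟨a, rfl⟩ := Submodule.mem_span_singleton.1 h1
    have h2 : σ x (X x) u = 0 := hu
    rw [map_smul, smul_apply, h2, smul_zero]

/-- An Anosov splitting forces the limit subspaces to span the tangent space of the level. -/
theorem sup_eq_of_splitting {x : S} {Ep Em : Submodule ℝ E} {Kp Km : E → ℝ}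
    (hsup : Submodule.span ℝ {X x} ⊔ Ep ⊔ Em = LinearMap.ker (σ x (X x)).toLinearMap)
    (hp : ∀ v ∈ Ep, ∀ t, 0 ≤ t → formNorm (g (φ t x)) (A t x v) ≤ Kp v)
    (hm : ∀ v ∈ Em, ∀ t, 0 ≤ t → formNorm (g (φ (-t) x)) (A (-t) x v) ≤ Km v) :
    limSubspace (cocycleCurve φ A Λ x) atTop ⊔ limSubspace (cocycleCurve φ A Λ x) atBot =
        LinearMap.ker (σ x (X x)).toLinearMap := by
  refine le_antisymm ?_ (hsup ▸ sup_le (sup_le ?_ ?_) ?_)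
  · exact sup_le (fun v hv => (h.mem_limSubspace_iff x _).1 (h.field_mem_limSubspace x) v hv)
      fun v hv => (h.mem_limSubspace_iff_atBot x _).1 (h.field_mem_limSubspace_atBot x) v hv
  · exact Submodule.span_le.2 (singleton_subset_iff.2
      (Submodule.mem_sup_left (h.field_mem_limSubspace x)))
  · exact fun v hv => Submodule.mem_sup_left (h.mem_limSubspace_of_bounded (K := Kp v)
      ((eventually_ge_atTop 0).mono fun t ht => hp v hv t ht))
  · intro v hv
    refine Submodule.mem_sup_right ?_
    rw [← limSubspace_comp_neg]
    exact h.reverse.mem_limSubspace_of_bounded (K := Km v)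
      ((eventually_ge_atTop 0).mono fun t ht => hm v hv t ht)

/-- If the limit subspaces meet only along `X` then the cocycle is hyperbolic transversally
to `X`. -/
theorem exists_anosov_splitting (hΔ : ∀ x, limSubspace (cocycleCurve φ A Λ x) atTop ⊓
      limSubspace (cocycleCurve φ A Λ x) atBot = Submodule.span ℝ {X x}) :
    ∃ (Ep Em : S → Submodule ℝ E) (c₁ c₂ : ℝ), 0 < c₁ ∧ 0 < c₂ ∧ ∀ x,
      (iSupIndep ![Submodule.span ℝ {X x}, Ep x, Em x] ∧
        Submodule.span ℝ {X x} ⊔ Ep x ⊔ Em x = LinearMap.ker (σ x (X x)).toLinearMap) ∧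
      (∀ t, (Ep x).map (A t x).toLinearMap = Ep (φ t x) ∧
        (Em x).map (A t x).toLinearMap = Em (φ t x)) ∧
      (∀ t, 0 ≤ t → ∀ v ∈ Ep x,
        formNorm (g (φ t x)) (A t x v) ≤ c₁ * Real.exp (-c₂ * t) * formNorm (g x) v) ∧
      (∀ t, 0 ≤ t → ∀ v ∈ Em x,
        formNorm (g (φ (-t) x)) (A (-t) x v) ≤
          c₁ * Real.exp (-c₂ * t) * formNorm (g x) v) := by
  have hr := h.reverse
  have hrlim : ∀ x, limSubspace (cocycleCurve (fun t => φ (-t)) (fun t => A (-t)) Λ x) atTop =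
      limSubspace (cocycleCurve φ A Λ x) atBot := fun x =>
    limSubspace_comp_neg (cocycleCurve φ A Λ x)
  have hd := h.exists_doubling fun x => (hΔ x).le
  have hdr : ∃ T, 0 < T ∧ ∀ x u, (-σ x) (-X x) u = 0 → ∀ t, ∃ s, |s - t| ≤ T ∧
      2 * redGrowth (fun t => φ (-t)) (fun t => A (-t)) (fun x => -X x) g x u t ≤
        redGrowth (fun t => φ (-t)) (fun t => A (-t)) (fun x => -X x) g x u s := by
    obtain ⟨T, hT, H⟩ := hd
    refine ⟨T, hT, fun x u hu t => ?_⟩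
    obtain ⟨s, hs, hle⟩ := H x u (by simpa using hu) (-t)
    refine ⟨-s, ?_, by simpa only [redGrowth_reverse, neg_neg] using hle⟩
    rw [← abs_neg]; simpa [add_comm] using hs
  obtain ⟨C, l, hC, hl, hsp, hcon⟩ := h.exists_stable_splitting hd
  obtain ⟨C', l', hC', hl', hsp', hcon'⟩ := hr.exists_stable_splitting hdr
  have hle1 : ∀ t, 0 ≤ t → C * Real.exp (-l * t) ≤ max C C' * Real.exp (-min l l' * t) :=
    fun t ht => by
      gcongr
      · exact le_max_left _ _
      · exact min_le_left _ _
  have hle2 : ∀ t, 0 ≤ t → C' * Real.exp (-l' * t) ≤ max C C' * Real.exp (-min l l' * t) :=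
    fun t ht => by
      gcongr
      · exact le_max_right _ _
      · exact min_le_right _ _
  set Ep := stableSubspace φ A g h.metric_symm h.metric_pos
  set Em := stableSubspace (fun t => φ (-t)) (fun t => A (-t)) g hr.metric_symm hr.metric_pos
  have hEp : ∀ x, Ep x ≤ limSubspace (cocycleCurve φ A Λ x) atTop := h.stableSubspace_le
  have hEm : ∀ x, Em x ≤ limSubspace (cocycleCurve φ A Λ x) atBot := fun x =>
    (hr.stableSubspace_le x).trans (hrlim x).le
  have hXp : ∀ x, Submodule.span ℝ {X x} ≤ limSubspace (cocycleCurve φ A Λ x) atTop := fun x =>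
    (hΔ x).ge.trans inf_le_left
  have hXm : ∀ x, Submodule.span ℝ {X x} ≤ limSubspace (cocycleCurve φ A Λ x) atBot := fun x =>
    (hΔ x).ge.trans inf_le_right
  have hp0 : ∀ x, ∀ v ∈ Ep x, v ∈ Submodule.span ℝ {X x} → v = 0 := fun x v hv hvX => by
    obtain ⟨a, rfl⟩ := Submodule.mem_span_singleton.1 hvX
    rw [h.eq_zero_of_smul_field_mem_stable hv, zero_smul]
  have hm0 : ∀ x, ∀ v ∈ Em x, v ∈ Submodule.span ℝ {X x} → v = 0 := fun x v hv hvX => by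
    obtain ⟨a, rfl⟩ := Submodule.mem_span_singleton.1 hvX
    have h1 : -a • -X x ∈ Em x := by simpa using hv
    have := hr.eq_zero_of_smul_field_mem_stable h1
    rw [neg_eq_zero.1 this, zero_smul]
  refine ⟨Ep, Em, max C C', min l l', lt_max_of_lt_left hC, lt_min hl hl', fun x =>
    ⟨⟨?_, ?_⟩, fun t => ⟨h.stableSubspace_map x t, ?_⟩, fun t ht v hv => ?_, fun t ht v hv => ?_⟩⟩
  · rw [iSupIndep_iff_finsetSum_eq_zero_imp_eq_zero]
    intro s v hv hs i hi
    classical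
    let v' : Fin 3 → E := fun i => if i ∈ s then v i else 0
    have hv' : ∀ i, v' i ∈ (![Submodule.span ℝ {X x}, Ep x, Em x] : Fin 3 → Submodule ℝ E) i :=
      fun i => by
        simp only [v']
        split_ifs with hi
        · exact hv i hi
        · exact Submodule.zero_mem _
    have hsum : v' 0 + v' 1 + v' 2 = 0 := by
      rw [← Fin.sum_univ_three v', ← hs]
      simp [v', Finset.sum_ite_mem]
    have h0 : v' 0 ∈ Submodule.span ℝ {X x} := hv' 0
    have h1 : v' 1 ∈ Ep x := hv' 1
    have h2 : v' 2 ∈ Em x := hv' 2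
    -- The component in `Em` is minus the sum of the other two, so it lies in both limit subspaces
    -- and hence on the line of `X`, which meets `Em` only in zero.
    have e2 : v' 2 = 0 := by
      refine hm0 x _ h2 ((hΔ x).le ⟨?_, hEm x h2⟩)
      have : v' 2 = -(v' 0 + v' 1) := (neg_eq_of_add_eq_zero_right hsum).symm
      rw [this]
      exact Submodule.neg_mem _ (Submodule.add_mem _ (hXp x h0) (hEp x h1))
    rw [e2, add_zero] at hsum
    have e1 : v' 1 = 0 := by
      refine hp0 x _ h1 ?_
      rw [← neg_eq_of_add_eq_zero_right hsum]
      exact Submodule.neg_mem _ h0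
    rw [e1, add_zero] at hsum
    have hall : v' i = 0 := by
      fin_cases i
      · exact hsum
      · exact e1
      · exact e2
    simpa [v', hi] using hall
  · rw [← (h.sup_eq_iff_inf_eq x).2 (hΔ x)]
    refine le_antisymm (sup_le (sup_le ((hXp x).trans le_sup_left) ((hEp x).trans le_sup_left))
      ((hEm x).trans le_sup_right)) (sup_le ((hsp x).trans le_sup_left) ?_)
    have h1 := hsp' x
    rw [hrlim, show Submodule.span ℝ {-X x} = Submodule.span ℝ {X x} by
      rw [← Set.neg_singleton, Submodule.span_neg]] at h1
    refine h1.trans (sup_le ?_ le_sup_right)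
    exact le_sup_left.trans le_sup_left
  · simpa using hr.stableSubspace_map x (-t)
  · exact (hcon x v hv t ht).trans (mul_le_mul_of_nonneg_right (hle1 t ht) (formNorm_nonneg _ _))
  · exact (hcon' x v hv t ht).trans (mul_le_mul_of_nonneg_right (hle2 t ht) (formNorm_nonneg _ _))

end MonotoneCocycle

end Splitting

end MonotoneHam

namespace MonotoneHam

/-! ### Differentiable dependence of local flows on the initial point -/

section LocalFlow

variable {E : Type*} [NormedAddCommGroup E] [NormedSpace ℝ E]

theorem norm_le_gronwallBound_of_mem_Ioo {e e' : ℝ → E} {K δ ε : ℝ}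
    (he : ∀ t ∈ Ioo (-ε) ε, HasDerivAt e (e' t) t) (h0 : e 0 = 0)
    (hb : ∀ t ∈ Ioo (-ε) ε, ‖e' t‖ ≤ K * ‖e t‖ + δ) {t : ℝ} (ht : t ∈ Ioo (-ε) ε) :
    ‖e t‖ ≤ gronwallBound 0 K δ |t| := by
  have key : ∀ (e e' : ℝ → E), (∀ t ∈ Ioo (-ε) ε, HasDerivAt e (e' t) t) → e 0 = 0 →
      (∀ t ∈ Ioo (-ε) ε, ‖e' t‖ ≤ K * ‖e t‖ + δ) → ∀ t ∈ Ioo (-ε) ε, 0 ≤ t →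
      ‖e t‖ ≤ gronwallBound 0 K δ |t| := by
    intro e e' he h0 hb t ht ht0
    have hs : ∀ s ∈ Icc 0 t, s ∈ Ioo (-ε) ε := fun s hs =>
      ⟨by linarith [hs.1, ht.1, ht.2], hs.2.trans_lt ht.2⟩
    have := norm_le_gronwallBound_of_norm_deriv_right_le (f := e) (f' := e') (δ := 0) (K := K)
      (ε := δ) (a := 0) (b := t)
      (fun s hs' => (he s (hs s hs')).continuousAt.continuousWithinAt)
      (fun s hs' => (he s (hs s (Ico_subset_Icc_self hs'))).hasDerivWithinAt)
      (by simp [h0]) (fun s hs' => hb s (hs s (Ico_subset_Icc_self hs'))) t ⟨ht0, le_rfl⟩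
    rw [abs_of_nonneg ht0]
    rwa [sub_zero] at this
  rcases le_total 0 t with h | h
  · exact key e e' he h0 hb t ht h
  · have h1 := key (fun s => e (-s)) (fun s => -e' (-s)) (fun s hs => by
      have := (he (-s) ⟨by linarith [hs.2], by linarith [hs.1]⟩).scomp s (hasDerivAt_neg s)
      simpa [Function.comp_def] using this) (by simpa using h0) (fun s hs => by
      simpa using hb (-s) ⟨by linarith [hs.2], by linarith [hs.1]⟩) (-t)
      ⟨by linarith [ht.2], by linarith [ht.1]⟩ (by linarith)
    simpa using h1

/-- On the ball about `x` of radius `‖y - x‖`, the derivative differs from its value at `x` by at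
most `C ‖y - x‖`; the mean value inequality gives a quadratic remainder without a second derivative.
-/
theorem norm_sub_sub_fderiv_le {f : E → E} {s : Set E} (hs : Convex ℝ s)
    (hd : ∀ z ∈ s, DifferentiableAt ℝ f z) {C : NNReal} (hC : LipschitzOnWith C (fderiv ℝ f) s)
    {x y : E} (hx : x ∈ s) (hy : y ∈ s) :
    ‖f y - f x - fderiv ℝ f x (y - x)‖ ≤ C * ‖y - x‖ ^ 2 := by
  have h := (hs.inter (convex_closedBall x ‖y - x‖)).norm_image_sub_le_of_norm_fderiv_le'
    (f := f) (φ := fderiv ℝ f x) (C := C * ‖y - x‖) (𝕜 := ℝ) (x := x) (y := y)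
    (fun z hz => hd z hz.1) (fun z hz => ?_) ⟨hx, by simp⟩ ⟨hy, by simp [dist_eq_norm]⟩
  · rwa [mul_assoc, ← sq] at h
  · refine (hC.norm_sub_le hz.1 hx).trans ?_
    have : ‖z - x‖ ≤ ‖y - x‖ := by simpa [dist_eq_norm] using hz.2
    gcongr

/-- A `C²` vector field has a local flow which is differentiable with respect to the initial
point; the derivative is continuous and satisfies the variational equation. -/
theorem exists_local_flow [CompleteSpace E] {f : E → E} {y₀ : E} (hf : ContDiffAt ℝ 2 f y₀)
    {U : Set E} (hU : U ∈ 𝓝 y₀) :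
    ∃ (ε r : ℝ) (Φ : ℝ → E → E) (D : ℝ → E → E →L[ℝ] E), 0 < ε ∧ 0 < r ∧
      (∀ y ∈ Metric.ball y₀ r, Φ 0 y = y ∧ D 0 y = ContinuousLinearMap.id ℝ E ∧
        ∀ t ∈ Ioo (-ε) ε, Φ t y ∈ U ∧ HasDerivAt (fun s => Φ s y) (f (Φ t y)) t ∧
          HasDerivAt (fun s => D s y) ((fderiv ℝ f (Φ t y)).comp (D t y)) t ∧
          HasFDerivAt (Φ t) (D t y) y) ∧
      ContinuousOn (fun p : ℝ × E => Φ p.1 p.2) (Ioo (-ε) ε ×ˢ Metric.ball y₀ r) ∧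
      ContinuousOn (fun p : ℝ × E => D p.1 p.2) (Ioo (-ε) ε ×ˢ Metric.ball y₀ r) := by
  have hf1 : ContDiffAt ℝ 1 (fderiv ℝ f) y₀ := hf.fderiv_right (by norm_num)
  -- Augmented by the variational equation, the system is still `C¹`, so Picard–Lindelöf yields the
  -- flow and its candidate derivative at once, with Lipschitz dependence on the initial data.
  let G : E × (E →L[ℝ] E) → E × (E →L[ℝ] E) := fun p => (f p.1, (fderiv ℝ f p.1).comp p.2)
  let p₀ : E × (E →L[ℝ] E) := (y₀, ContinuousLinearMap.id ℝ E)
  have hG : ContDiffAt ℝ 1 G p₀ := by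
    refine ContDiffAt.prodMk ?_ ?_
    · exact (hf.of_le (by norm_num)).comp p₀ contDiffAt_fst
    · exact ContDiffAt.clm_comp (hf1.comp p₀ contDiffAt_fst) contDiffAt_snd
  obtain ⟨ε₀, hε₀, a, r₀, L, K, hr₀, hPL⟩ := IsPicardLindelof.of_contDiffAt_one hG
  obtain ⟨α, hα, L', hL'⟩ :=
    (hPL 0).exists_forall_mem_closedBall_eq_hasDerivWithinAt_lipschitzOnWith
  simp only [zero_sub, zero_add] at hα hL'
  have hαc : ContinuousOn (Function.uncurry α)
      (Metric.closedBall p₀ r₀ ×ˢ Icc (-ε₀) ε₀) :=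
    continuousOn_prod_of_continuousOn_lipschitzOnWith _ L'
      (fun x hx => HasDerivWithinAt.continuousOn (hα x hx).2) hL'
  -- the good neighbourhood
  obtain ⟨C, s, hs, hC⟩ := hf1.exists_lipschitzOnWith
  have hev : ∀ᶠ z in 𝓝 y₀, DifferentiableAt ℝ f z := by
    filter_upwards [hf.eventually (by simp)] with z hz
    exact hz.differentiableAt (by norm_num)
  have hKb : ∀ᶠ z in 𝓝 y₀, ‖fderiv ℝ f z‖ < ‖fderiv ℝ f y₀‖ + 1 :=
    hf1.continuousAt.norm.eventually (gt_mem_nhds (by linarith))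
  obtain ⟨ρ, hρ, hball⟩ := Metric.mem_nhds_iff.1
    (inter_mem (inter_mem hs hev) (inter_mem hKb hU))
  set B := Metric.ball y₀ ρ
  set K' := ‖fderiv ℝ f y₀‖ + 1 with hK'
  have hK'0 : 0 < K' := by positivity
  let ι : E → E × (E →L[ℝ] E) := fun y => (y, ContinuousLinearMap.id ℝ E)
  have hι : Continuous ι := by fun_prop
  have hι0 : ι y₀ = p₀ := rfl
  -- shrink
  have hmem0 : Metric.closedBall p₀ r₀ ×ˢ Icc (-ε₀) ε₀ ∈ 𝓝 (p₀, (0 : ℝ)) :=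
    prod_mem_nhds (Metric.closedBall_mem_nhds _ hr₀) (Icc_mem_nhds (by linarith) hε₀)
  have hcont0 : ContinuousAt (Function.uncurry α) (p₀, (0 : ℝ)) := hαc.continuousAt hmem0
  have hα00 : α p₀ 0 = p₀ := (hα p₀ (Metric.mem_closedBall_self r₀.2)).1
  have hN : {q : (E × (E →L[ℝ] E)) × ℝ | q ∈ Metric.closedBall p₀ r₀ ×ˢ Icc (-ε₀) ε₀ ∧
      (Function.uncurry α q).1 ∈ B} ∈ 𝓝 (p₀, (0 : ℝ)) := by
    have h1 : ContinuousAt (fun q => (Function.uncurry α q).1) (p₀, (0 : ℝ)) :=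
      continuous_fst.continuousAt.comp hcont0
    have h2 : B ∈ 𝓝 (Function.uncurry α (p₀, (0 : ℝ))).1 := by
      change B ∈ 𝓝 (α p₀ 0).1
      rw [hα00]
      exact Metric.ball_mem_nhds _ hρ
    exact inter_mem hmem0 (h1.preimage_mem_nhds h2)
  have hιc : ContinuousAt (fun q : ℝ × E => (ι q.2, q.1)) (0, y₀) := by fun_prop
  have hN' := hιc.preimage_mem_nhds (hι0 ▸ hN)
  rw [nhds_prod_eq, mem_prod_iff] at hN'
  obtain ⟨T, hT, R, hR, hTR⟩ := hN'
  obtain ⟨ε, hε, hεT⟩ := Metric.mem_nhds_iff.1 hT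
  obtain ⟨r, hr, hrR⟩ := Metric.mem_nhds_iff.1 hR
  rw [Real.ball_zero_eq_Ioo] at hεT
  have hgood : ∀ t ∈ Ioo (-ε) ε, ∀ y ∈ Metric.ball y₀ r, ι y ∈ Metric.closedBall p₀ r₀ ∧
      t ∈ Icc (-ε₀) ε₀ ∧ (α (ι y) t).1 ∈ B := fun t ht y hy => by
    have := hTR (show (t, y) ∈ T ×ˢ R from ⟨hεT ht, hrR hy⟩)
    exact ⟨this.1.1, this.1.2, this.2⟩
  have hder : ∀ y ∈ Metric.ball y₀ r, ∀ t ∈ Ioo (-ε) ε,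
      HasDerivAt (α (ι y)) (G (α (ι y) t)) t := fun y hy t ht => by
    have hnb : Icc (-ε₀) ε₀ ∈ 𝓝 t := mem_of_superset (Ioo_mem_nhds ht.1 ht.2)
      fun s hs => (hgood s hs y hy).2.1
    exact ((hα _ (hgood t ht y hy).1).2 t (hgood t ht y hy).2.1).hasDerivAt hnb
  have h0 : (0 : ℝ) ∈ Ioo (-ε) ε := ⟨by linarith, hε⟩
  have hder1 : ∀ y ∈ Metric.ball y₀ r, ∀ t ∈ Ioo (-ε) ε,
      HasDerivAt (fun s => (α (ι y) s).1) (f (α (ι y) t).1) t := fun y hy t ht =>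
    (hder y hy t ht).fst
  have hder2 : ∀ y ∈ Metric.ball y₀ r, ∀ t ∈ Ioo (-ε) ε, HasDerivAt (fun s => (α (ι y) s).2)
      ((fderiv ℝ f (α (ι y) t).1).comp (α (ι y) t).2) t := fun y hy t ht =>
    (hder y hy t ht).snd
  have hα0 : ∀ y ∈ Metric.ball y₀ r, α (ι y) 0 = ι y := fun y hy =>
    (hα _ (hgood 0 h0 y hy).1).1
  -- The linearisation error starts at zero and solves the variational equation up to a forcing term
  -- quadratic in `‖z - y‖`; Gronwall keeps it quadratic, so the candidate is the derivative.
  have hest : ∀ t ∈ Ioo (-ε) ε, ∀ y ∈ Metric.ball y₀ r, ∀ z ∈ Metric.ball y₀ r,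
      ‖(α (ι z) t).1 - (α (ι y) t).1 - (α (ι y) t).2 (z - y)‖ ≤
        C * L' ^ 2 / K' * (Real.exp (K' * |t|) - 1) * ‖z - y‖ ^ 2 := by
    intro t ht y hy z hz
    have hb := norm_le_gronwallBound_of_mem_Ioo
      (e := fun t => (α (ι z) t).1 - (α (ι y) t).1 - (α (ι y) t).2 (z - y))
      (e' := fun t => f (α (ι z) t).1 - f (α (ι y) t).1 -
        (fderiv ℝ f (α (ι y) t).1) ((α (ι y) t).2 (z - y)))
      (K := K') (δ := C * (L' * ‖z - y‖) ^ 2) (ε := ε)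
      (fun t ht => ((hder1 z hz t ht).sub (hder1 y hy t ht)).sub
        (by simpa using (hder2 y hy t ht).clm_apply (hasDerivAt_const t (z - y))))
      (by simp [hα0 y hy, hα0 z hz, ι]) ?_ ht
    · rw [gronwallBound_of_K_ne_0 hK'0.ne'] at hb
      refine hb.trans (le_of_eq ?_)
      ring
    · intro t ht
      have hyB := (hgood t ht y hy).2.2
      have hzB := (hgood t ht z hz).2.2
      have h1 := norm_sub_sub_fderiv_le (convex_ball y₀ ρ) (fun w hw => (hball hw).1.2)
        (hC.mono fun w hw => (hball hw).1.1) hyB hzB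
      have h2 : ‖(α (ι z) t).1 - (α (ι y) t).1‖ ≤ L' * ‖z - y‖ := by
        have h3 := (hL' t (hgood t ht y hy).2.1).norm_sub_le (hgood t ht z hz).1
          (hgood t ht y hy).1
        refine (norm_fst_le (α (ι z) t - α (ι y) t)).trans (h3.trans (le_of_eq ?_))
        simp [ι, Prod.norm_def]
      have h4 : f (α (ι z) t).1 - f (α (ι y) t).1 -
          (fderiv ℝ f (α (ι y) t).1) ((α (ι y) t).2 (z - y)) =
          (fderiv ℝ f (α (ι y) t).1) ((α (ι z) t).1 - (α (ι y) t).1 - (α (ι y) t).2 (z - y)) +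
          (f (α (ι z) t).1 - f (α (ι y) t).1 -
            (fderiv ℝ f (α (ι y) t).1) ((α (ι z) t).1 - (α (ι y) t).1)) := by
        rw [map_sub _ ((α (ι z) t).1 - (α (ι y) t).1)]
        abel
      rw [h4]
      refine (norm_add_le _ _).trans (add_le_add ?_ (h1.trans ?_))
      · refine (ContinuousLinearMap.le_opNorm _ _).trans ?_
        exact mul_le_mul_of_nonneg_right (hball hyB).2.1.le (norm_nonneg _)
      · gcongr
  refine ⟨ε, r, fun t y => (α (ι y) t).1, fun t y => (α (ι y) t).2, hε, hr,
    fun y hy => ⟨by simp [hα0 y hy, ι], by simp [hα0 y hy, ι], fun t ht =>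
      ⟨(hball (hgood t ht y hy).2.2).2.2, hder1 y hy t ht, hder2 y hy t ht, ?_⟩⟩, ?_, ?_⟩
  · rw [hasFDerivAt_iff_isLittleO_nhds_zero]
    refine Asymptotics.IsBigO.trans_isLittleO (g := fun h => ‖h‖ ^ 2) ?_
      (Asymptotics.isLittleO_norm_pow_id one_lt_two)
    refine Asymptotics.IsBigO.of_bound (C * L' ^ 2 / K' * (Real.exp (K' * |t|) - 1)) ?_
    have : Tendsto (fun h : E => y + h) (𝓝 0) (𝓝 y) := by
      simpa using (continuous_const.add continuous_id).tendsto (f := fun h : E => y + h) 0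
    filter_upwards [this.eventually (Metric.isOpen_ball.mem_nhds hy)] with h hh
    simpa using hest t ht y hy (y + h) hh
  · have : ContinuousOn (fun p : ℝ × E => Function.uncurry α (ι p.2, p.1))
        (Ioo (-ε) ε ×ˢ Metric.ball y₀ r) :=
      hαc.comp (by fun_prop) fun p hp => ⟨(hgood p.1 hp.1 p.2 hp.2).1, (hgood p.1 hp.1 p.2 hp.2).2.1⟩
    exact continuous_fst.comp_continuousOn this
  · have : ContinuousOn (fun p : ℝ × E => Function.uncurry α (ι p.2, p.1))
        (Ioo (-ε) ε ×ˢ Metric.ball y₀ r) :=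
      hαc.comp (by fun_prop) fun p hp => ⟨(hgood p.1 hp.1 p.2 hp.2).1, (hgood p.1 hp.1 p.2 hp.2).2.1⟩
    exact continuous_snd.comp_continuousOn this

end LocalFlow

end MonotoneHam

namespace MonotoneHam

/-- An operator on a finite-dimensional space is a tuple of vectors, the images of a basis. -/
theorem contDiffAt_clm_of_apply {D E F : Type*} [NormedAddCommGroup D] [NormedSpace ℝ D]
    [NormedAddCommGroup E] [NormedSpace ℝ E] [NormedAddCommGroup F] [NormedSpace ℝ F]
    [FiniteDimensional ℝ E] {n : ℕ∞ω} {f : D → E →L[ℝ] F} {x : D}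
    (h : ∀ y, ContDiffAt ℝ n (fun x => f x y) x) : ContDiffAt ℝ n f x := by
  let d := Module.finrank ℝ E
  have hd : d = Module.finrank ℝ (Fin d → ℝ) := Module.finrank_fin_fun ℝ |>.symm
  let e₁ := ContinuousLinearEquiv.ofFinrankEq hd
  let e₂ := (e₁.arrowCongr (1 : F ≃L[ℝ] F)).trans (ContinuousLinearEquiv.piRing (Fin d))
  rw [← Function.id_comp f, ← e₂.symm_comp_self]
  exact e₂.symm.contDiff.contDiffAt.comp x (contDiffAt_pi.mpr fun i => h _)

/-! ### Fields and forms read in a preferred chart -/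

section ChartRep

variable {E : Type*} [NormedAddCommGroup E] [NormedSpace ℝ E]
  {M : Type*} [TopologicalSpace M] [ChartedSpace E M]

/-- The derivative of the inverse of the preferred chart at `x₀`. -/
noncomputable def chartFrame (x₀ : M) (y : E) : E →L[ℝ] E :=
  mfderivWithin 𝓘(ℝ, E) 𝓘(ℝ, E) (extChartAt 𝓘(ℝ, E) x₀).symm (range 𝓘(ℝ, E)) y

/-- The derivative of the preferred chart at `x₀`. -/
noncomputable def chartCoframe (x₀ x : M) : E →L[ℝ] E :=
  mfderiv 𝓘(ℝ, E) 𝓘(ℝ, E) (extChartAt 𝓘(ℝ, E) x₀) x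

/-- A vector field, read in the preferred chart at `x₀`. -/
noncomputable def chartRep (x₀ : M) (V : Π x : M, TangentSpace 𝓘(ℝ, E) x) (y : E) : E :=
  chartCoframe x₀ ((extChartAt 𝓘(ℝ, E) x₀).symm y) (V ((extChartAt 𝓘(ℝ, E) x₀).symm y))

/-- A bilinear form on the tangent spaces, read in the preferred chart at `x₀`. -/
noncomputable def chartForm (x₀ : M)
    (b : Π x : M, TangentSpace 𝓘(ℝ, E) x →L[ℝ] TangentSpace 𝓘(ℝ, E) x →L[ℝ] ℝ) (y : E) :
    E →L[ℝ] E →L[ℝ] ℝ :=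
  (fun B : E →L[ℝ] E →L[ℝ] ℝ => B.bilinearComp (chartFrame x₀ y) (chartFrame x₀ y))
    (b ((extChartAt 𝓘(ℝ, E) x₀).symm y))

theorem mem_extChartAt_source_iff {x₀ x : M} :
    x ∈ (extChartAt 𝓘(ℝ, E) x₀).source ↔ x ∈ (chartAt E x₀).source := by
  rw [extChartAt_source]

theorem eventually_mem_target (x₀ : M) :
    ∀ᶠ y in 𝓝 (extChartAt 𝓘(ℝ, E) x₀ x₀), y ∈ (extChartAt 𝓘(ℝ, E) x₀).target :=
  extChartAt_target_mem_nhds x₀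

theorem chartForm_apply (x₀ : M)
    (b : Π x : M, TangentSpace 𝓘(ℝ, E) x →L[ℝ] TangentSpace 𝓘(ℝ, E) x →L[ℝ] ℝ) (y u v : E) :
    chartForm x₀ b y u v =
      b ((extChartAt 𝓘(ℝ, E) x₀).symm y) (chartFrame x₀ y u) (chartFrame x₀ y v) := rfl

variable [IsManifold 𝓘(ℝ, E) ∞ M]

theorem isManifold_one (E : Type*) [NormedAddCommGroup E] [NormedSpace ℝ E]
    (M : Type*) [TopologicalSpace M] [ChartedSpace E M] [IsManifold 𝓘(ℝ, E) ∞ M] :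
    IsManifold 𝓘(ℝ, E) 1 M := .of_le (n := ∞) (by simp)

theorem chartCoframe_chartFrame {x₀ : M} {y : E} (hy : y ∈ (extChartAt 𝓘(ℝ, E) x₀).target)
    (v : E) : chartCoframe x₀ ((extChartAt 𝓘(ℝ, E) x₀).symm y) (chartFrame x₀ y v) = v := by
  have := isManifold_one E M
  exact congrArg (fun L : E →L[ℝ] E => L v)
    (mfderiv_extChartAt_comp_mfderivWithin_extChartAt_symm (I := 𝓘(ℝ, E)) hy)

theorem chartFrame_chartCoframe {x₀ : M} {y : E} (hy : y ∈ (extChartAt 𝓘(ℝ, E) x₀).target)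
    (v : E) : chartFrame x₀ y (chartCoframe x₀ ((extChartAt 𝓘(ℝ, E) x₀).symm y) v) = v := by
  have := isManifold_one E M
  exact congrArg (fun L : E →L[ℝ] E => L v)
    (mfderivWithin_extChartAt_symm_comp_mfderiv_extChartAt (I := 𝓘(ℝ, E)) hy)

theorem chartFrame_chartRep {x₀ : M} {y : E} (hy : y ∈ (extChartAt 𝓘(ℝ, E) x₀).target)
    (V : Π x : M, TangentSpace 𝓘(ℝ, E) x) :
    chartFrame x₀ y (chartRep x₀ V y) = V ((extChartAt 𝓘(ℝ, E) x₀).symm y) :=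
  chartFrame_chartCoframe hy _

theorem chartFrame_self (x₀ : M) :
    chartFrame x₀ (extChartAt 𝓘(ℝ, E) x₀ x₀) = ContinuousLinearMap.id ℝ E := by
  have := isManifold_one E M
  exact mfderivWithin_range_extChartAt_symm

theorem chartCoframe_self (x₀ : M) : chartCoframe x₀ x₀ = ContinuousLinearMap.id ℝ E := by
  have := isManifold_one E M
  exact mfderiv_extChartAt_self

theorem chartRep_self (x₀ : M) (V : Π x : M, TangentSpace 𝓘(ℝ, E) x) :
    chartRep x₀ V (extChartAt 𝓘(ℝ, E) x₀ x₀) = V x₀ := by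
  rw [chartRep, extChartAt_to_inv, chartCoframe_self]; rfl

theorem chartForm_self (x₀ : M)
    (b : Π x : M, TangentSpace 𝓘(ℝ, E) x →L[ℝ] TangentSpace 𝓘(ℝ, E) x →L[ℝ] ℝ) :
    chartForm x₀ b (extChartAt 𝓘(ℝ, E) x₀ x₀) = b x₀ := by
  rw [chartForm, extChartAt_to_inv, chartFrame_self]; rfl

theorem chartRep_eq_mpullbackWithin {x₀ : M} {y : E} (hy : y ∈ (extChartAt 𝓘(ℝ, E) x₀).target)
    (V : Π x : M, TangentSpace 𝓘(ℝ, E) x) :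
    chartRep x₀ V y = VectorField.mpullbackWithin 𝓘(ℝ, E) 𝓘(ℝ, E) (extChartAt 𝓘(ℝ, E) x₀).symm V
      (range 𝓘(ℝ, E)) y := by
  have := isManifold_one E M
  rw [VectorField.mpullbackWithin_apply, ← chartFrame_chartRep hy V]
  have h := isInvertible_mfderivWithin_extChartAt_symm (I := 𝓘(ℝ, E)) hy
  exact (congrArg (fun L : E →L[ℝ] E => L (chartRep x₀ V y)) h.inverse_comp_self).symm

/-- At the centre of its preferred chart the derivative of the chart is the identity of `E`, so the
bracket computed in the chart needs no conversion. -/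
theorem mlieBracket_eq_lieBracket_chartRep (V W : Π x : M, TangentSpace 𝓘(ℝ, E) x) (x₀ : M) :
    VectorField.mlieBracket 𝓘(ℝ, E) V W x₀ = VectorField.lieBracket ℝ (chartRep x₀ V)
      (chartRep x₀ W) (extChartAt 𝓘(ℝ, E) x₀ x₀) := by
  have := isManifold_one E M
  have h1 : chartRep x₀ V =ᶠ[𝓝 (extChartAt 𝓘(ℝ, E) x₀ x₀)] VectorField.mpullbackWithin 𝓘(ℝ, E)
      𝓘(ℝ, E) (extChartAt 𝓘(ℝ, E) x₀).symm V (range 𝓘(ℝ, E)) := by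
    filter_upwards [eventually_mem_target x₀] with y hy using chartRep_eq_mpullbackWithin hy V
  have h2 : chartRep x₀ W =ᶠ[𝓝 (extChartAt 𝓘(ℝ, E) x₀ x₀)] VectorField.mpullbackWithin 𝓘(ℝ, E)
      𝓘(ℝ, E) (extChartAt 𝓘(ℝ, E) x₀).symm W (range 𝓘(ℝ, E)) := by
    filter_upwards [eventually_mem_target x₀] with y hy using chartRep_eq_mpullbackWithin hy W
  rw [h1.lieBracket_vectorField_eq h2, ← VectorField.mlieBracketWithin_univ,
    VectorField.mlieBracketWithin_apply, mfderiv_extChartAt_self]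
  have h3 : range 𝓘(ℝ, E) = univ := 𝓘(ℝ, E).range_eq_univ
  refine (congrArg (fun L : E →L[ℝ] E => L _) (ContinuousLinearMap.inverse_id)).trans ?_
  rw [h3, preimage_univ, univ_inter]
  exact congrFun (VectorField.lieBracketWithin_univ (𝕜 := ℝ) (E := E)) _

/-- The trivialisation of the tangent bundle is the derivative of the chart. Through this,
continuity and smoothness in the bundle become statements about `chartCoframe`. -/
theorem trivializationAt_snd_eq {x₀ x : M} (hx : x ∈ (chartAt E x₀).source)
    (v : TangentSpace 𝓘(ℝ, E) x) :
    (trivializationAt E (TangentSpace 𝓘(ℝ, E)) x₀ ⟨x, v⟩).2 = chartCoframe (E := E) x₀ x v := by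
  have := isManifold_one E M
  have h1 : (trivializationAt E (TangentSpace 𝓘(ℝ, E)) x₀).continuousLinearMapAt ℝ x v =
      (trivializationAt E (TangentSpace 𝓘(ℝ, E)) x₀ ⟨x, v⟩).2 := by
    rw [Bundle.Trivialization.continuousLinearMapAt_apply,
      Bundle.Trivialization.linearMapAt_apply, if_pos (by simpa using hx)]
  exact h1.symm.trans (congrArg (fun L : E →L[ℝ] E => L v)
    (TangentBundle.continuousLinearMapAt_trivializationAt (I := 𝓘(ℝ, E)) hx))

theorem contMDiffAt_iff_contDiffAt_chartRep {x₀ : M} {n : ℕ∞ω} (hn : n ≤ ∞)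
    {V : Π x : M, TangentSpace 𝓘(ℝ, E) x} :
    ContMDiffAt 𝓘(ℝ, E) 𝓘(ℝ, E).tangent n
      (fun x => (⟨x, V x⟩ : TangentBundle 𝓘(ℝ, E) M)) x₀ ↔
    ContDiffAt ℝ n (chartRep x₀ V) (extChartAt 𝓘(ℝ, E) x₀ x₀) := by
  have := isManifold_one E M
  have : IsManifold 𝓘(ℝ, E) n M := .of_le hn
  have : IsManifold 𝓘(ℝ, E) (n + 1) M := .of_le (n := ∞) (by
    calc n + 1 ≤ ∞ + 1 := by gcongr
      _ = ∞ := rfl)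
  have := TangentBundle.contMDiffVectorBundle (I := 𝓘(ℝ, E)) (M := M) (n := n)
  rw [Bundle.contMDiffAt_section, ← contMDiffAt_iff_contDiffAt]
  have hB : ∀ x ∈ (chartAt E x₀).source,
      (trivializationAt E (TangentSpace 𝓘(ℝ, E)) x₀ ⟨x, V x⟩).2 =
        chartCoframe (E := E) x₀ x (V x) := fun x hx => trivializationAt_snd_eq hx (V x)
  constructor
  · intro h
    have h1 : ContMDiffAt 𝓘(ℝ, E) 𝓘(ℝ, E) n (extChartAt 𝓘(ℝ, E) x₀).symm
        (extChartAt 𝓘(ℝ, E) x₀ x₀) := by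
      have := contMDiffOn_extChartAt_symm (I := 𝓘(ℝ, E)) (n := n) x₀
      exact this.contMDiffAt (eventually_mem_target x₀)
    refine (h.comp_of_eq h1 (extChartAt_to_inv x₀)).congr_of_eventuallyEq ?_
    filter_upwards [eventually_mem_target x₀] with y hy
    exact (hB _ (mem_extChartAt_source_iff.1 ((extChartAt 𝓘(ℝ, E) x₀).map_target hy))).symm
  · intro h
    have h1 : ContMDiffAt 𝓘(ℝ, E) 𝓘(ℝ, E) n (extChartAt 𝓘(ℝ, E) x₀) x₀ := contMDiffAt_extChartAt
    refine (h.comp x₀ h1).congr_of_eventuallyEq ?_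
    filter_upwards [extChartAt_source_mem_nhds (I := 𝓘(ℝ, E)) x₀] with x hx
    rw [hB x (mem_extChartAt_source_iff.1 hx)]
    simp only [Function.comp, chartRep]
    rw [(extChartAt 𝓘(ℝ, E) x₀).left_inv hx]

theorem chartRep_chartFrame {x₀ : M} {y : E} (hy : y ∈ (extChartAt 𝓘(ℝ, E) x₀).target)
    (V : E → E) :
    chartRep x₀ (fun x => chartFrame x₀ (extChartAt 𝓘(ℝ, E) x₀ x) (V (extChartAt 𝓘(ℝ, E) x₀ x))) y
      = V y := by
  have h := chartCoframe_chartFrame hy (V y)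
  nth_rewrite 2 [← (extChartAt 𝓘(ℝ, E) x₀).right_inv hy] at h
  nth_rewrite 3 [← (extChartAt 𝓘(ℝ, E) x₀).right_inv hy] at h
  exact h

theorem contMDiffAt_chartFrame (x₀ : M) {V : E → E} {n : ℕ∞ω} (hn : n ≤ ∞)
    (hV : ContDiffAt ℝ n V (extChartAt 𝓘(ℝ, E) x₀ x₀)) :
    ContMDiffAt 𝓘(ℝ, E) 𝓘(ℝ, E).tangent n
      (fun x => (⟨x, chartFrame x₀ (extChartAt 𝓘(ℝ, E) x₀ x) (V (extChartAt 𝓘(ℝ, E) x₀ x))⟩ :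
        TangentBundle 𝓘(ℝ, E) M)) x₀ := by
  refine (contMDiffAt_iff_contDiffAt_chartRep hn (x₀ := x₀)
    (V := fun x => chartFrame x₀ (extChartAt 𝓘(ℝ, E) x₀ x) (V (extChartAt 𝓘(ℝ, E) x₀ x)))).2 ?_
  refine hV.congr_of_eventuallyEq ?_
  filter_upwards [eventually_mem_target x₀] with y hy using chartRep_chartFrame hy V

theorem contMDiffAt_chart_symm (x₀ : M) {n : ℕ∞ω} (hn : n ≤ ∞) :
    ContMDiffAt 𝓘(ℝ, E) 𝓘(ℝ, E) n (extChartAt 𝓘(ℝ, E) x₀).symm (extChartAt 𝓘(ℝ, E) x₀ x₀) := by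
  have : IsManifold 𝓘(ℝ, E) n M := .of_le hn
  exact (contMDiffOn_extChartAt_symm (I := 𝓘(ℝ, E)) (n := n) x₀).contMDiffAt
    (eventually_mem_target x₀)

theorem contDiffAt_comp_chart_symm {F : Type*} [NormedAddCommGroup F] [NormedSpace ℝ F] {x₀ : M}
    {n : ℕ∞ω} (hn : n ≤ ∞) {f : M → F} (hf : ContMDiffAt 𝓘(ℝ, E) 𝓘(ℝ, F) n f x₀) :
    ContDiffAt ℝ n (fun y => f ((extChartAt 𝓘(ℝ, E) x₀).symm y)) (extChartAt 𝓘(ℝ, E) x₀ x₀) :=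
  contMDiffAt_iff_contDiffAt.1
    (hf.comp_of_eq (contMDiffAt_chart_symm x₀ hn) (extChartAt_to_inv x₀))

theorem contMDiffAt_form_apply
    {b : Π x : M, TangentSpace 𝓘(ℝ, E) x →L[ℝ] TangentSpace 𝓘(ℝ, E) x →L[ℝ] ℝ}
    {x₀ : M} (hb : ContMDiffAt 𝓘(ℝ, E) (𝓘(ℝ, E).prod 𝓘(ℝ, E →L[ℝ] E →L[ℝ] ℝ)) ∞
      (fun x => Bundle.TotalSpace.mk' (E →L[ℝ] E →L[ℝ] ℝ)
        (E := fun x : M => TangentSpace 𝓘(ℝ, E) x →L[ℝ] TangentSpace 𝓘(ℝ, E) x →L[ℝ] ℝ)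
        x (b x)) x₀)
    {V W : Π x : M, TangentSpace 𝓘(ℝ, E) x}
    (hV : ContMDiffAt 𝓘(ℝ, E) 𝓘(ℝ, E).tangent ∞
      (fun x => (⟨x, V x⟩ : TangentBundle 𝓘(ℝ, E) M)) x₀)
    (hW : ContMDiffAt 𝓘(ℝ, E) 𝓘(ℝ, E).tangent ∞
      (fun x => (⟨x, W x⟩ : TangentBundle 𝓘(ℝ, E) M)) x₀) :
    ContMDiffAt 𝓘(ℝ, E) 𝓘(ℝ, ℝ) ∞ (fun x => b x (V x) (W x)) x₀ := by
  have := isManifold_one E M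
  have h : ContMDiffAt 𝓘(ℝ, E) (𝓘(ℝ, E).prod 𝓘(ℝ, ℝ)) ∞
      (fun m => Bundle.TotalSpace.mk' ℝ (E := Bundle.Trivial M ℝ) m (b m (V m) (W m))) x₀ :=
    ContMDiffAt.clm_bundle_apply₂ (F₁ := E) (F₂ := E) (F₃ := ℝ) hb hV hW
  exact (Bundle.contMDiffAt_totalSpace.1 h).2

/-- It suffices to evaluate on constant vectors, and there the form is evaluated on smooth fields,
those with constant reading in the chart. -/
theorem contDiffAt_chartForm [FiniteDimensional ℝ E]
    {b : Π x : M, TangentSpace 𝓘(ℝ, E) x →L[ℝ] TangentSpace 𝓘(ℝ, E) x →L[ℝ] ℝ}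
    {x₀ : M} (hb : ContMDiffAt 𝓘(ℝ, E) (𝓘(ℝ, E).prod 𝓘(ℝ, E →L[ℝ] E →L[ℝ] ℝ)) ∞
      (fun x => Bundle.TotalSpace.mk' (E →L[ℝ] E →L[ℝ] ℝ)
        (E := fun x : M => TangentSpace 𝓘(ℝ, E) x →L[ℝ] TangentSpace 𝓘(ℝ, E) x →L[ℝ] ℝ)
        x (b x)) x₀) :
    ContDiffAt ℝ ∞ (chartForm x₀ b) (extChartAt 𝓘(ℝ, E) x₀ x₀) := by
  refine contDiffAt_clm_of_apply fun u => contDiffAt_clm_of_apply fun v => ?_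
  have h1 := contDiffAt_comp_chart_symm le_rfl
    (contMDiffAt_form_apply hb (contMDiffAt_chartFrame x₀ le_rfl (contDiffAt_const (c := u)))
      (contMDiffAt_chartFrame x₀ le_rfl (contDiffAt_const (c := v))))
  refine h1.congr_of_eventuallyEq ?_
  filter_upwards [eventually_mem_target x₀] with y hy
  rw [chartForm_apply, (extChartAt 𝓘(ℝ, E) x₀).right_inv hy]

end ChartRep

end MonotoneHam

namespace MonotoneHam

/-! ### Smoothness of the Hamiltonian field and infinitesimal invariance of the form -/

section HamField

variable {E : Type*} [NormedAddCommGroup E] [NormedSpace ℝ E]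
  {M : Type*} [TopologicalSpace M] [ChartedSpace E M] [IsManifold 𝓘(ℝ, E) ∞ M]

theorem hasMFDerivAt_chart_symm {x₀ : M} {y : E} (hy : y ∈ (extChartAt 𝓘(ℝ, E) x₀).target) :
    HasMFDerivAt 𝓘(ℝ, E) 𝓘(ℝ, E) (extChartAt 𝓘(ℝ, E) x₀).symm y (chartFrame (E := E) x₀ y) := by
  have := isManifold_one E M
  have h := (mdifferentiableWithinAt_extChartAt_symm (I := 𝓘(ℝ, E)) hy).hasMFDerivWithinAt
  have h3 : range 𝓘(ℝ, E) = univ := 𝓘(ℝ, E).range_eq_univ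
  exact hasMFDerivWithinAt_univ.1 (h.mono_of_mem_nhdsWithin (by rw [h3]; exact univ_mem))

theorem hasMFDerivAt_chart {x₀ x : M} (hx : x ∈ (extChartAt 𝓘(ℝ, E) x₀).source) :
    HasMFDerivAt 𝓘(ℝ, E) 𝓘(ℝ, E) (extChartAt 𝓘(ℝ, E) x₀) x (chartCoframe (E := E) x₀ x) := by
  have := isManifold_one E M
  exact (mdifferentiableAt_extChartAt (I := 𝓘(ℝ, E))
    (mem_extChartAt_source_iff.1 hx)).hasMFDerivAt

/-- Coordinate fields are constant in the trivialisation. They serve as test fields in the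
closedness of the form. -/
theorem smoothFieldAt_chartFrame (x₀ : M) (u : E) :
    SmoothFieldAt (fun x : M => chartFrame x₀ (extChartAt 𝓘(ℝ, E) x₀ x) u) x₀ := by
  have := isManifold_one E M
  refine ⟨(trivializationAt E (TangentSpace 𝓘(ℝ, E)) x₀).baseSet,
    (trivializationAt E (TangentSpace 𝓘(ℝ, E)) x₀).open_baseSet,
    FiberBundle.mem_baseSet_trivializationAt' x₀, ?_⟩
  refine ((trivializationAt E (TangentSpace 𝓘(ℝ, E) : M → Type _)
    x₀).contMDiffOn_section_baseSet_iff (E := (TangentSpace 𝓘(ℝ, E) : M → Type _))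
    (n := ∞) (IB := 𝓘(ℝ, E))
    (s := fun x : M => chartFrame x₀ (extChartAt 𝓘(ℝ, E) x₀ x) u)).2 ?_
  refine (contMDiffOn_const (c := u)).congr fun x hx => ?_
  have hx' : x ∈ (chartAt E x₀).source := by simpa using hx
  have hx2 : x ∈ (extChartAt 𝓘(ℝ, E) x₀).source := mem_extChartAt_source_iff.2 hx'
  have h := chartCoframe_chartFrame ((extChartAt 𝓘(ℝ, E) x₀).map_source hx2) u
  rw [(extChartAt 𝓘(ℝ, E) x₀).left_inv hx2] at h
  exact (trivializationAt_snd_eq hx' _).trans h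

omit [IsManifold 𝓘(ℝ, E) ∞ M] in
theorem dirDeriv_eq_fderiv {f : M → ℝ} {x₀ : M} (hf : MDifferentiableAt 𝓘(ℝ, E) 𝓘(ℝ, ℝ) f x₀)
    (v : E) : dirDeriv f x₀ v = fderiv ℝ (fun y => f ((extChartAt 𝓘(ℝ, E) x₀).symm y))
      (extChartAt 𝓘(ℝ, E) x₀ x₀) v := by
  have h3 : range 𝓘(ℝ, E) = univ := 𝓘(ℝ, E).range_eq_univ
  have h : mfderiv 𝓘(ℝ, E) 𝓘(ℝ, ℝ) f x₀ =
      fderiv ℝ (fun y => f ((extChartAt 𝓘(ℝ, E) x₀).symm y)) (extChartAt 𝓘(ℝ, E) x₀ x₀) := by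
    unfold mfderiv
    refine (if_pos hf).trans ?_
    rw [h3]
    exact congrFun fderivWithin_univ _
  exact congrArg (fun L : E →L[ℝ] ℝ => L v) h

theorem dirDeriv_chartFrame {f : M → ℝ} {x₀ : M} {y : E}
    (hy : y ∈ (extChartAt 𝓘(ℝ, E) x₀).target)
    (hf : MDifferentiableAt 𝓘(ℝ, E) 𝓘(ℝ, ℝ) f ((extChartAt 𝓘(ℝ, E) x₀).symm y)) (u : E) :
    dirDeriv f ((extChartAt 𝓘(ℝ, E) x₀).symm y) (chartFrame (E := E) x₀ y u) =
      fderiv ℝ (fun y => f ((extChartAt 𝓘(ℝ, E) x₀).symm y)) y u := by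
  let L : E →L[ℝ] ℝ := mfderiv 𝓘(ℝ, E) 𝓘(ℝ, ℝ) f ((extChartAt 𝓘(ℝ, E) x₀).symm y)
  have h : HasFDerivAt (fun y => f ((extChartAt 𝓘(ℝ, E) x₀).symm y)) (L.comp (chartFrame x₀ y)) y :=
    hasMFDerivAt_iff_hasFDerivAt.1 (hf.hasMFDerivAt.comp y (hasMFDerivAt_chart_symm hy))
  rw [h.fderiv]
  rfl

variable {Ω : Π x : M, TangentSpace 𝓘(ℝ, E) x →L[ℝ] TangentSpace 𝓘(ℝ, E) x →L[ℝ] ℝ} {H : M → ℝ}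

theorem chartForm_hamField [FiniteDimensional ℝ E] (hΩ : IsSymplecticForm Ω)
    (hH : ContMDiff 𝓘(ℝ, E) 𝓘(ℝ, ℝ) ∞ H) {x₀ : M} {y : E}
    (hy : y ∈ (extChartAt 𝓘(ℝ, E) x₀).target) :
    chartForm x₀ Ω y (chartRep x₀ (hamField Ω H) y) =
      -fderiv ℝ (fun y => H ((extChartAt 𝓘(ℝ, E) x₀).symm y)) y := by
  ext u
  rw [chartForm_apply, chartFrame_chartRep hy]
  refine (hamField_spec Ω H _ (hΩ.nondegenerate _) _).trans ?_
  exact congrArg Neg.neg (dirDeriv_chartFrame hy (hH.mdifferentiable (by simp) _) u)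

theorem IsSymplecticForm.exists_equiv [FiniteDimensional ℝ E] (hΩ : IsSymplecticForm Ω) (x : M) :
    ∃ e : E ≃L[ℝ] (E →L[ℝ] ℝ), (e : E →L[ℝ] E →L[ℝ] ℝ) = Ω x := by
  let L : E →L[ℝ] E →L[ℝ] ℝ := Ω x
  have hinj : Function.Injective (L : E →ₗ[ℝ] E →L[ℝ] ℝ) := by
    rw [← LinearMap.ker_eq_bot, LinearMap.ker_eq_bot']
    exact fun v hv => hΩ.nondegenerate x v fun w =>
      congrArg (fun f : E →L[ℝ] ℝ => f w) hv
  have hd : Module.finrank ℝ E = Module.finrank ℝ (E →L[ℝ] ℝ) := by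
    rw [← (LinearMap.toContinuousLinearMap : (E →ₗ[ℝ] ℝ) ≃ₗ[ℝ] _).finrank_eq]
    exact (Subspace.dual_finrank_eq (K := ℝ) (V := E)).symm
  refine ⟨(LinearEquiv.ofInjectiveOfFinrankEq (L : E →ₗ[ℝ] E →L[ℝ] ℝ) hinj hd
    ).toContinuousLinearEquiv, ?_⟩
  ext v w
  rfl

/-- In a chart the field is the inverse of the form applied to `-dH`, and inversion of operators is
smooth at an invertible one. -/
theorem contMDiff_hamField [FiniteDimensional ℝ E] (hΩ : IsSymplecticForm Ω)
    (hH : ContMDiff 𝓘(ℝ, E) 𝓘(ℝ, ℝ) ∞ H) :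
    ContMDiff 𝓘(ℝ, E) 𝓘(ℝ, E).tangent ∞
      (fun x => (⟨x, hamField Ω H x⟩ : TangentBundle 𝓘(ℝ, E) M)) := by
  intro x₀
  refine (contMDiffAt_iff_contDiffAt_chartRep le_rfl).2 ?_
  set y₀ := extChartAt 𝓘(ℝ, E) x₀ x₀
  obtain ⟨e, he⟩ := hΩ.exists_equiv x₀
  have he' : chartForm x₀ Ω y₀ = e := by rw [he]; exact chartForm_self x₀ Ω
  have h1 : ContDiffAt ℝ ∞ (chartForm x₀ Ω) y₀ := contDiffAt_chartForm (hΩ.smooth x₀)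
  have h2 : ContDiffAt ℝ ∞ (fun y => H ((extChartAt 𝓘(ℝ, E) x₀).symm y)) y₀ :=
    contDiffAt_comp_chart_symm le_rfl (hH x₀)
  have h3 : ContDiffAt ℝ ∞ (fderiv ℝ (fun y => H ((extChartAt 𝓘(ℝ, E) x₀).symm y))) y₀ :=
    h2.fderiv_right (by rfl)
  have h4 : ContDiffAt ℝ ∞ (fun y => (chartForm x₀ Ω y).inverse) y₀ :=
    ContDiffAt.comp y₀ (g := ContinuousLinearMap.inverse)
      (by rw [he']; exact contDiffAt_map_inverse e) h1
  refine (h4.clm_apply h3.neg).congr_of_eventuallyEq ?_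
  have h5 : ∀ᶠ y in 𝓝 y₀, chartForm x₀ Ω y ∈ range ((↑) : (E ≃L[ℝ] (E →L[ℝ] ℝ)) → _) :=
    h1.continuousAt.eventually (by rw [he']; exact ContinuousLinearEquiv.nhds e)
  filter_upwards [eventually_mem_target x₀, h5] with y hy ⟨e', he'⟩
  rw [← chartForm_hamField hΩ hH hy, ← he', ContinuousLinearMap.inverse_equiv]
  simp

/-- The vanishing Lie derivative of the form along `X`, in coordinates. Closedness is applied to `X`
and two coordinate fields: the latter commute, their brackets with `X` are minus derivatives of `X`,
and the terms containing `Ω(X, ·) = -dH` are mixed second derivatives of `H`, which cancel by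
symmetry. -/
theorem fderiv_chartForm_hamField [FiniteDimensional ℝ E] (hΩ : IsSymplecticForm Ω)
    (hH : ContMDiff 𝓘(ℝ, E) 𝓘(ℝ, ℝ) ∞ H) (x₀ : M) (u v : E) :
    fderiv ℝ (chartForm x₀ Ω) (extChartAt 𝓘(ℝ, E) x₀ x₀)
        (chartRep x₀ (hamField Ω H) (extChartAt 𝓘(ℝ, E) x₀ x₀)) u v
      + chartForm x₀ Ω (extChartAt 𝓘(ℝ, E) x₀ x₀)
          (fderiv ℝ (chartRep x₀ (hamField Ω H)) (extChartAt 𝓘(ℝ, E) x₀ x₀) u) v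
      + chartForm x₀ Ω (extChartAt 𝓘(ℝ, E) x₀ x₀) u
          (fderiv ℝ (chartRep x₀ (hamField Ω H)) (extChartAt 𝓘(ℝ, E) x₀ x₀) v) = 0 := by
  set y₀ := extChartAt 𝓘(ℝ, E) x₀ x₀ with hy₀
  set X := hamField Ω H with hX
  set h : E → ℝ := fun y => H ((extChartAt 𝓘(ℝ, E) x₀).symm y) with hh
  let F : E → Π x : M, TangentSpace 𝓘(ℝ, E) x :=
    fun u x => chartFrame x₀ (extChartAt 𝓘(ℝ, E) x₀ x) u
  have hXs := contMDiff_hamField hΩ hH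
  have hFs : ∀ u, ContMDiffAt 𝓘(ℝ, E) 𝓘(ℝ, E).tangent ∞
      (fun x => (⟨x, F u x⟩ : TangentBundle 𝓘(ℝ, E) M)) x₀ := fun u =>
    contMDiffAt_chartFrame x₀ le_rfl (contDiffAt_const (c := u))
  have hF0 : ∀ u, F u x₀ = u := fun u => by
    change chartFrame x₀ y₀ u = u
    rw [hy₀, chartFrame_self]; rfl
  have hrepF : ∀ u, chartRep x₀ (F u) =ᶠ[𝓝 y₀] fun _ => u := fun u => by
    filter_upwards [eventually_mem_target x₀] with y hy using chartRep_chartFrame hy fun _ => u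
  have hX0 : chartRep x₀ X y₀ = X x₀ := chartRep_self x₀ X
  have hc := hΩ.closed x₀ X (F u) (F v) ⟨univ, isOpen_univ, mem_univ _, hXs.contMDiffOn⟩
    (smoothFieldAt_chartFrame x₀ u) (smoothFieldAt_chartFrame x₀ v)
  have hbX : ∀ u, VectorField.mlieBracket 𝓘(ℝ, E) X (F u) x₀ =
      (-fderiv ℝ (chartRep x₀ X) y₀ u : E) := fun u => by
    refine (mlieBracket_eq_lieBracket_chartRep _ _ _).trans ?_
    rw [EventuallyEq.lieBracket_vectorField_eq (EventuallyEq.refl _ _) (hrepF u),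
      VectorField.lieBracket]
    simp [hy₀]
    rfl
  have hbF : VectorField.mlieBracket 𝓘(ℝ, E) (F u) (F v) x₀ = (0 : E) := by
    refine (mlieBracket_eq_lieBracket_chartRep _ _ _).trans ?_
    rw [EventuallyEq.lieBracket_vectorField_eq (hrepF u) (hrepF v), VectorField.lieBracket]
    simp
    rfl
  have hform : ContDiffAt ℝ ∞ (chartForm x₀ Ω) y₀ := contDiffAt_chartForm (hΩ.smooth x₀)
  have hd1 : dirDeriv (fun y => Ω y (F u y) (F v y)) x₀ (X x₀) =
      fderiv ℝ (chartForm x₀ Ω) y₀ (chartRep x₀ X y₀) u v := by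
    refine (dirDeriv_eq_fderiv ((contMDiffAt_form_apply (hΩ.smooth x₀) (hFs u)
      (hFs v)).mdifferentiableAt (by simp)) _).trans ?_
    have e1 : (fun y => Ω ((extChartAt 𝓘(ℝ, E) x₀).symm y) (F u ((extChartAt 𝓘(ℝ, E) x₀).symm y))
        (F v ((extChartAt 𝓘(ℝ, E) x₀).symm y))) =ᶠ[𝓝 y₀] fun y => chartForm x₀ Ω y u v := by
      filter_upwards [eventually_mem_target x₀] with y hy
      simp only [F]
      rw [chartForm_apply, (extChartAt 𝓘(ℝ, E) x₀).right_inv hy]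
    rw [e1.fderiv_eq]
    have h1 := (hform.differentiableAt (by simp)).hasFDerivAt
    have h2 := (h1.clm_apply (hasFDerivAt_const u y₀)).clm_apply (hasFDerivAt_const v y₀)
    rw [h2.fderiv]
    have e2 : (X x₀ : E) = chartRep x₀ X y₀ := hX0.symm
    refine (congrArg (fun w : E => _) e2).trans ?_
    simp
  have hdH : ∀ u v, dirDeriv (fun y => Ω y (X y) (F v y)) x₀ (F u x₀) =
      -fderiv ℝ (fderiv ℝ h) y₀ u v := fun u v => by
    rw [hF0]
    refine (dirDeriv_eq_fderiv ((contMDiffAt_form_apply (hΩ.smooth x₀) (hXs x₀)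
      (hFs v)).mdifferentiableAt (by simp)) _).trans ?_
    have e1 : (fun y => Ω ((extChartAt 𝓘(ℝ, E) x₀).symm y) (X ((extChartAt 𝓘(ℝ, E) x₀).symm y))
        (F v ((extChartAt 𝓘(ℝ, E) x₀).symm y))) =ᶠ[𝓝 y₀] fun y => -fderiv ℝ h y v := by
      filter_upwards [eventually_mem_target x₀] with y hy
      have := congrArg (fun L : E →L[ℝ] ℝ => L v) (chartForm_hamField hΩ hH hy)
      simp only [chartForm_apply, chartFrame_chartRep hy] at this
      simp only [F]
      rw [(extChartAt 𝓘(ℝ, E) x₀).right_inv hy]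
      exact this
    rw [e1.fderiv_eq]
    have h2 : ContDiffAt ℝ ∞ h y₀ := contDiffAt_comp_chart_symm le_rfl (hH x₀)
    have h3 : ContDiffAt ℝ ∞ (fderiv ℝ h) y₀ := h2.fderiv_right (by rfl)
    have h4 := (((h3.differentiableAt (by simp)).hasFDerivAt).clm_apply
      (hasFDerivAt_const v y₀)).fun_neg
    rw [h4.fderiv]
    simp
  have hsymm : IsSymmSndFDerivAt ℝ h y₀ := by
    have h2 : ContDiffAt ℝ ∞ h y₀ := contDiffAt_comp_chart_symm le_rfl (hH x₀)
    exact h2.isSymmSndFDerivAt (by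
      rw [minSmoothness_of_isRCLikeNormedField]
      exact WithTop.coe_le_coe.2 (le_top : (2 : ℕ∞) ≤ ⊤))
  rw [hd1, hdH, hdH, hbX, hbX, hbF, hF0, hF0] at hc
  have hs : Ω x₀ = chartForm x₀ Ω y₀ := (chartForm_self x₀ Ω).symm
  set B : E →L[ℝ] E →L[ℝ] ℝ := chartForm x₀ Ω y₀
  have hc' : fderiv ℝ (chartForm x₀ Ω) y₀ (chartRep x₀ X y₀) u v
      - -fderiv ℝ (fderiv ℝ h) y₀ u v + -fderiv ℝ (fderiv ℝ h) y₀ v u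
      - B (-fderiv ℝ (chartRep x₀ X) y₀ u) v + B (-fderiv ℝ (chartRep x₀ X) y₀ v) u
      - B 0 (X x₀) = 0 := by
    rw [hs] at hc
    exact hc
  have ha : ∀ a : E, B a a = 0 := fun a => by
    have := hΩ.alternating x₀ a
    rw [hs] at this
    exact this
  have hsw := alternating_swap ha u (fderiv ℝ (chartRep x₀ X) y₀ v)
  have hsy := hsymm u v
  have hz : B 0 (X x₀) = 0 := by
    rw [map_zero]
    rfl
  rw [hz] at hc'
  simp only [map_neg, neg_apply] at hc'
  linarith

end HamField

end MonotoneHam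

namespace MonotoneHam

/-! ### The maximal flow and flow boxes -/

section Flow

variable {E : Type*} [NormedAddCommGroup E] [NormedSpace ℝ E] [FiniteDimensional ℝ E]
  {M : Type*} [TopologicalSpace M] [T2Space M] [ChartedSpace E M] [IsManifold 𝓘(ℝ, E) ∞ M]
  {X : Π x : M, TangentSpace 𝓘(ℝ, E) x}

theorem eqOn_Ioo_of_isMIntegralCurveOn
    (hX : ContMDiff 𝓘(ℝ, E) 𝓘(ℝ, E).tangent ∞ (fun x => (⟨x, X x⟩ : TangentBundle 𝓘(ℝ, E) M)))
    {γ γ' : ℝ → M} {a b t₀ : ℝ} (ht₀ : t₀ ∈ Ioo a b) (hγ : IsMIntegralCurveOn γ X (Ioo a b))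
    (hγ' : IsMIntegralCurveOn γ' X (Ioo a b)) (h : γ t₀ = γ' t₀) : EqOn γ γ' (Ioo a b) := by
  have := isManifold_one E M
  have : CompleteSpace E := FiniteDimensional.complete ℝ E
  exact isMIntegralCurveOn_Ioo_eqOn_of_contMDiff_boundaryless ht₀ (hX.of_le (by simp)) hγ hγ' h

theorem IsTrajectory.eq_of_isTrajectory
    (hX : ContMDiff 𝓘(ℝ, E) 𝓘(ℝ, E).tangent ∞ (fun x => (⟨x, X x⟩ : TangentBundle 𝓘(ℝ, E) M)))
    {γ γ' : ℝ → M} {x : M} {t : ℝ} (h : IsTrajectory X x t γ) (h' : IsTrajectory X x t γ') :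
    γ t = γ' t := by
  obtain ⟨h0, a, b, h1, h2, h3⟩ := h
  obtain ⟨h0', a', b', h1', h2', h3'⟩ := h'
  refine eqOn_Ioo_of_isMIntegralCurveOn hX (a := max a a') (b := min b b') (t₀ := 0)
    ⟨max_lt h1.1 h1'.1, lt_min h1.2 h1'.2⟩
    (h3.mono (Ioo_subset_Ioo (le_max_left ..) (min_le_left ..)))
    (h3'.mono (Ioo_subset_Ioo (le_max_right ..) (min_le_right ..))) (h0.trans h0'.symm)
    ⟨max_lt h2.1 h2'.1, lt_min h2.2 h2'.2⟩

theorem IsTrajectory.flow_eq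
    (hX : ContMDiff 𝓘(ℝ, E) 𝓘(ℝ, E).tangent ∞ (fun x => (⟨x, X x⟩ : TangentBundle 𝓘(ℝ, E) M)))
    {γ : ℝ → M} {x : M} {t : ℝ} (h : IsTrajectory X x t γ) : flow X t x = γ t := by
  have hex : ∃ γ : ℝ → M, IsTrajectory X x t γ := ⟨γ, h⟩
  rw [flow, dif_pos hex]
  exact hex.choose_spec.eq_of_isTrajectory hX h

theorem flow_eqOn_Ioo
    (hX : ContMDiff 𝓘(ℝ, E) 𝓘(ℝ, E).tangent ∞ (fun x => (⟨x, X x⟩ : TangentBundle 𝓘(ℝ, E) M)))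
    {γ : ℝ → M} {a b : ℝ} (h0 : (0 : ℝ) ∈ Ioo a b) (hγ : IsMIntegralCurveOn γ X (Ioo a b)) :
    ∀ t ∈ Ioo a b, (t, γ 0) ∈ flowDomain X ∧ flow X t (γ 0) = γ t := fun _ ht =>
  ⟨⟨γ, rfl, a, b, h0, ht, hγ⟩, IsTrajectory.flow_eq hX ⟨rfl, a, b, h0, ht, hγ⟩⟩

theorem exists_isMIntegralCurveOn_flow
    (hX : ContMDiff 𝓘(ℝ, E) 𝓘(ℝ, E).tangent ∞ (fun x => (⟨x, X x⟩ : TangentBundle 𝓘(ℝ, E) M)))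
    {x : M} {t : ℝ} (h : (t, x) ∈ flowDomain X) : ∃ a b : ℝ, (0 : ℝ) ∈ Ioo a b ∧ t ∈ Ioo a b ∧
      (∀ s ∈ Ioo a b, (s, x) ∈ flowDomain X) ∧
      IsMIntegralCurveOn (fun s => flow X s x) X (Ioo a b) := by
  obtain ⟨γ, h0, a, b, h1, h2, h3⟩ := h
  simp only at h0 h2
  have h4 := flow_eqOn_Ioo hX h1 h3
  rw [h0] at h4
  refine ⟨a, b, h1, h2, fun s hs => (h4 s hs).1, fun s hs => ?_⟩
  have h5 := HasMFDerivWithinAt.congr_of_eventuallyEq (h3 s hs)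
    (eventually_mem_nhdsWithin.mono fun r hr => (h4 r hr).2) (h4 s hs).2
  exact h5.congr_mfderiv (by
    refine congrArg (fun z : M => ((1 : ℝ →L[ℝ] ℝ).smulRight (X z : E))) ?_
    exact (h4 s hs).2.symm)

theorem hasMFDerivAt_flow_time
    (hX : ContMDiff 𝓘(ℝ, E) 𝓘(ℝ, E).tangent ∞ (fun x => (⟨x, X x⟩ : TangentBundle 𝓘(ℝ, E) M)))
    {x : M} {t : ℝ} (h : (t, x) ∈ flowDomain X) :
    HasMFDerivAt 𝓘(ℝ, ℝ) 𝓘(ℝ, E) (fun s => flow X s x) t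
      ((1 : ℝ →L[ℝ] ℝ).smulRight (X (flow X t x))) := by
  obtain ⟨a, b, -, h2, -, h3⟩ := exists_isMIntegralCurveOn_flow hX h
  exact (h3 t h2).hasMFDerivAt (Ioo_mem_nhds h2.1 h2.2)

/-- The second trajectory, translated by `t`, is glued to the first; the result is a trajectory from
`x` reaching time `s + t`, and uniqueness identifies it with the flow. -/
theorem flow_add_of_mem
    (hX : ContMDiff 𝓘(ℝ, E) 𝓘(ℝ, E).tangent ∞ (fun x => (⟨x, X x⟩ : TangentBundle 𝓘(ℝ, E) M)))
    {x : M} {s t : ℝ} (ht : (t, x) ∈ flowDomain X) (hs : (s, flow X t x) ∈ flowDomain X) :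
    (s + t, x) ∈ flowDomain X ∧ flow X (s + t) x = flow X s (flow X t x) := by
  have := isManifold_one E M
  have : CompleteSpace E := FiniteDimensional.complete ℝ E
  have hfl := IsTrajectory.flow_eq hX ht.choose_spec
  obtain ⟨h0, a, b, h1, h2, h3⟩ := ht.choose_spec
  obtain ⟨γ', h0', a', b', h1', h2', h3'⟩ := hs
  set γ := ht.choose
  simp only at h0' h0 hfl h2 h2'
  rw [hfl] at h0'
  have h4 : IsMIntegralCurveOn (γ' ∘ (· + -t)) X (Ioo (a' + t) (b' + t)) := by
    refine (h3'.comp_add (-t)).mono fun r hr => ?_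
    exact ⟨by linarith [hr.1], by linarith [hr.2]⟩
  have hmem : t ∈ Ioo a b ∩ Ioo (a' + t) (b' + t) :=
    ⟨h2, by linarith [h1'.1], by linarith [h1'.2]⟩
  have heq : γ t = (γ' ∘ (· + -t)) t := by simp [h0']
  have h5 := isMIntegralCurveOn_piecewise (hX.of_le (by simp)) h3 h4 hmem heq
  have h6 := eqOn_piecewise_of_isMIntegralCurveOn_Ioo (hX.of_le (by simp)) h3 h4 hmem heq
  rw [Ioo_union_Ioo' (by linarith [hmem.2.1, hmem.1.2]) (by linarith [hmem.1.1, hmem.2.2])] at h5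
  set δ := piecewise (Ioo a b) γ (γ' ∘ (· + -t))
  have hδ0 : δ 0 = x := by rw [← h0]; exact piecewise_eqOn _ _ _ h1
  have hst : s + t ∈ Ioo (a' + t) (b' + t) := ⟨by linarith [h2'.1], by linarith [h2'.2]⟩
  have h7 := flow_eqOn_Ioo hX (a := min a (a' + t)) (b := max b (b' + t))
    ⟨min_lt_of_left_lt h1.1, lt_max_of_lt_left h1.2⟩ h5 (s + t)
    ⟨min_lt_of_right_lt hst.1, lt_max_of_lt_right hst.2⟩
  rw [hδ0] at h7
  refine ⟨h7.1, h7.2.trans ((h6 hst).trans ?_)⟩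
  rw [hfl, ← h0']
  have := (flow_eqOn_Ioo hX h1' h3' s h2').2
  rw [this]
  simp

/-- Near `x₀` the flow of `X` is, in the preferred chart, the flow `Φ` of the vector field read in the
chart; `D` is the derivative of `Φ` with respect to the initial point. -/
structure IsFlowBox (X : Π x : M, TangentSpace 𝓘(ℝ, E) x) (x₀ : M) (ε r : ℝ) (Φ : ℝ → E → E)
    (D : ℝ → E → E →L[ℝ] E) : Prop where
  time_pos : 0 < ε
  radius_pos : 0 < r
  zero : ∀ y ∈ Metric.ball (extChartAt 𝓘(ℝ, E) x₀ x₀) r, Φ 0 y = y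
  deriv_zero : ∀ y ∈ Metric.ball (extChartAt 𝓘(ℝ, E) x₀ x₀) r,
    D 0 y = ContinuousLinearMap.id ℝ E
  mem_target : ∀ y ∈ Metric.ball (extChartAt 𝓘(ℝ, E) x₀ x₀) r, ∀ t ∈ Ioo (-ε) ε,
    Φ t y ∈ (extChartAt 𝓘(ℝ, E) x₀).target
  hasDerivAt : ∀ y ∈ Metric.ball (extChartAt 𝓘(ℝ, E) x₀ x₀) r, ∀ t ∈ Ioo (-ε) ε,
    HasDerivAt (fun s => Φ s y) (chartRep x₀ X (Φ t y)) t
  hasDerivAt_deriv : ∀ y ∈ Metric.ball (extChartAt 𝓘(ℝ, E) x₀ x₀) r, ∀ t ∈ Ioo (-ε) ε,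
    HasDerivAt (fun s => D s y) ((fderiv ℝ (chartRep x₀ X) (Φ t y)).comp (D t y)) t
  hasFDerivAt : ∀ y ∈ Metric.ball (extChartAt 𝓘(ℝ, E) x₀ x₀) r, ∀ t ∈ Ioo (-ε) ε,
    HasFDerivAt (Φ t) (D t y) y
  mem_flowDomain : ∀ y ∈ Metric.ball (extChartAt 𝓘(ℝ, E) x₀ x₀) r, ∀ t ∈ Ioo (-ε) ε,
    (t, (extChartAt 𝓘(ℝ, E) x₀).symm y) ∈ flowDomain X
  flow_eq : ∀ y ∈ Metric.ball (extChartAt 𝓘(ℝ, E) x₀ x₀) r, ∀ t ∈ Ioo (-ε) ε,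
    flow X t ((extChartAt 𝓘(ℝ, E) x₀).symm y) = (extChartAt 𝓘(ℝ, E) x₀).symm (Φ t y)
  continuousOn : ContinuousOn (fun p : ℝ × E => Φ p.1 p.2)
    (Ioo (-ε) ε ×ˢ Metric.ball (extChartAt 𝓘(ℝ, E) x₀ x₀) r)
  continuousOn_deriv : ContinuousOn (fun p : ℝ × E => D p.1 p.2)
    (Ioo (-ε) ε ×ˢ Metric.ball (extChartAt 𝓘(ℝ, E) x₀ x₀) r)

/-- The inverse chart carries local solutions in the chart to integral curves on the manifold, so
uniqueness identifies the flow, defined by choice, with a regular one. -/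
theorem exists_isFlowBox
    (hX : ContMDiff 𝓘(ℝ, E) 𝓘(ℝ, E).tangent ∞ (fun x => (⟨x, X x⟩ : TangentBundle 𝓘(ℝ, E) M)))
    (x₀ : M) : ∃ (ε r : ℝ) (Φ : ℝ → E → E) (D : ℝ → E → E →L[ℝ] E), IsFlowBox X x₀ ε r Φ D := by
  have : CompleteSpace E := FiniteDimensional.complete ℝ E
  have hf : ContDiffAt ℝ 2 (chartRep x₀ X) (extChartAt 𝓘(ℝ, E) x₀ x₀) :=
    ((contMDiffAt_iff_contDiffAt_chartRep le_rfl).1 (hX x₀)).of_le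
      (WithTop.coe_le_coe.2 (le_top : (2 : ℕ∞) ≤ ⊤))
  obtain ⟨ε, r, Φ, D, hε, hr, h, h1, h2⟩ := exists_local_flow hf (eventually_mem_target x₀)
  have hint : ∀ y ∈ Metric.ball (extChartAt 𝓘(ℝ, E) x₀ x₀) r, IsMIntegralCurveOn (fun s => (extChartAt 𝓘(ℝ, E) x₀).symm (Φ s y)) X
      (Ioo (-ε) ε) := by
    intro y hy s hs
    have h3 := (h y hy).2.2
    have h4 := (hasMFDerivAt_chart_symm (h3 s hs).1).comp s (h3 s hs).2.1.hasFDerivAt.hasMFDerivAt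
    have h5 : ((chartFrame x₀ (Φ s y)).comp ((1 : ℝ →L[ℝ] ℝ).smulRight (chartRep x₀ X (Φ s y)))) =
        (1 : ℝ →L[ℝ] ℝ).smulRight
          (X ((extChartAt 𝓘(ℝ, E) x₀).symm (Φ s y)) : E) := by
      ext
      simp only [ContinuousLinearMap.comp_apply, ContinuousLinearMap.smulRight_apply,
        map_smul, chartFrame_chartRep (h3 s hs).1]
      rfl
    exact (HasMFDerivAt.congr_mfderiv h4 h5).hasMFDerivWithinAt
  have h6 : ∀ y ∈ Metric.ball (extChartAt 𝓘(ℝ, E) x₀ x₀) r, ∀ t ∈ Ioo (-ε) ε,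
      (t, (extChartAt 𝓘(ℝ, E) x₀).symm y) ∈ flowDomain X ∧
      flow X t ((extChartAt 𝓘(ℝ, E) x₀).symm y) = (extChartAt 𝓘(ℝ, E) x₀).symm (Φ t y) := by
    intro y hy
    have := flow_eqOn_Ioo hX ⟨by linarith, hε⟩ (hint y hy)
    simpa only [(h y hy).1] using this
  exact ⟨ε, r, Φ, D, hε, hr, fun y hy => (h y hy).1, fun y hy => (h y hy).2.1,
    fun y hy t ht => ((h y hy).2.2 t ht).1, fun y hy t ht => ((h y hy).2.2 t ht).2.1,
    fun y hy t ht => ((h y hy).2.2 t ht).2.2.1, fun y hy t ht => ((h y hy).2.2 t ht).2.2.2,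
    fun y hy t ht => (h6 y hy t ht).1, fun y hy t ht => (h6 y hy t ht).2, h1, h2⟩

end Flow

end MonotoneHam

namespace MonotoneHam

/-! ### Regularity of the flow inside a flow box -/

section FlowBox

variable {E : Type*} [NormedAddCommGroup E] [NormedSpace ℝ E] [FiniteDimensional ℝ E]
  {M : Type*} [TopologicalSpace M] [T2Space M] [ChartedSpace E M] [IsManifold 𝓘(ℝ, E) ∞ M]
  {X : Π x : M, TangentSpace 𝓘(ℝ, E) x} {x₀ : M} {ε r : ℝ} {Φ : ℝ → E → E}
  {D : ℝ → E → E →L[ℝ] E}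

omit [FiniteDimensional ℝ E] [T2Space M] [IsManifold 𝓘(ℝ, E) ∞ M] in
theorem IsFlowBox.zero_mem (h : IsFlowBox X x₀ ε r Φ D) : (0 : ℝ) ∈ Ioo (-ε) ε :=
  ⟨by linarith [h.time_pos], h.time_pos⟩

omit [FiniteDimensional ℝ E] [T2Space M] [IsManifold 𝓘(ℝ, E) ∞ M] in
theorem IsFlowBox.center_mem (h : IsFlowBox X x₀ ε r Φ D) :
    extChartAt 𝓘(ℝ, E) x₀ x₀ ∈ Metric.ball (extChartAt 𝓘(ℝ, E) x₀ x₀) r :=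
  Metric.mem_ball_self h.radius_pos

omit [FiniteDimensional ℝ E] [T2Space M] [IsManifold 𝓘(ℝ, E) ∞ M] in
theorem IsFlowBox.ball_subset (h : IsFlowBox X x₀ ε r Φ D) {y : E}
    (hy : y ∈ Metric.ball (extChartAt 𝓘(ℝ, E) x₀ x₀) r) : y ∈ (extChartAt 𝓘(ℝ, E) x₀).target := by
  have := h.mem_target y hy 0 h.zero_mem
  rwa [h.zero y hy] at this

omit [FiniteDimensional ℝ E] [T2Space M] [IsManifold 𝓘(ℝ, E) ∞ M] in
theorem IsFlowBox.eventually_mem (h : IsFlowBox X x₀ ε r Φ D) {y : E}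
    (hy : y ∈ Metric.ball (extChartAt 𝓘(ℝ, E) x₀ x₀) r) :
    ∀ᶠ x in 𝓝 ((extChartAt 𝓘(ℝ, E) x₀).symm y), x ∈ (extChartAt 𝓘(ℝ, E) x₀).source ∧
      extChartAt 𝓘(ℝ, E) x₀ x ∈ Metric.ball (extChartAt 𝓘(ℝ, E) x₀ x₀) r := by
  have hsrc := (extChartAt 𝓘(ℝ, E) x₀).map_target (h.ball_subset hy)
  have h1 : ContinuousAt (extChartAt 𝓘(ℝ, E) x₀) ((extChartAt 𝓘(ℝ, E) x₀).symm y) :=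
    continuousAt_extChartAt' hsrc
  refine Eventually.and ((isOpen_extChartAt_source x₀).mem_nhds hsrc)
    (h1.eventually (Metric.isOpen_ball.mem_nhds ?_))
  rwa [(extChartAt 𝓘(ℝ, E) x₀).right_inv (h.ball_subset hy)]

omit [FiniteDimensional ℝ E] [T2Space M] [IsManifold 𝓘(ℝ, E) ∞ M] in
theorem IsFlowBox.eventually_mem_self (h : IsFlowBox X x₀ ε r Φ D) :
    ∀ᶠ x in 𝓝 x₀, x ∈ (extChartAt 𝓘(ℝ, E) x₀).source ∧
      extChartAt 𝓘(ℝ, E) x₀ x ∈ Metric.ball (extChartAt 𝓘(ℝ, E) x₀ x₀) r := by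
  have := h.eventually_mem h.center_mem
  rwa [extChartAt_to_inv] at this

omit [FiniteDimensional ℝ E] [T2Space M] [IsManifold 𝓘(ℝ, E) ∞ M] in
theorem IsFlowBox.eventuallyEq (h : IsFlowBox X x₀ ε r Φ D) {y : E}
    (hy : y ∈ Metric.ball (extChartAt 𝓘(ℝ, E) x₀ x₀) r) {t : ℝ} (ht : t ∈ Ioo (-ε) ε) :
    flow X t =ᶠ[𝓝 ((extChartAt 𝓘(ℝ, E) x₀).symm y)]
      (extChartAt 𝓘(ℝ, E) x₀).symm ∘ (Φ t ∘ extChartAt 𝓘(ℝ, E) x₀) := by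
  filter_upwards [h.eventually_mem hy] with x hx
  have := h.flow_eq _ hx.2 t ht
  rwa [(extChartAt 𝓘(ℝ, E) x₀).left_inv hx.1] at this

omit [FiniteDimensional ℝ E] [T2Space M] in
theorem IsFlowBox.dflow_eq (h : IsFlowBox X x₀ ε r Φ D) {y : E}
    (hy : y ∈ Metric.ball (extChartAt 𝓘(ℝ, E) x₀ x₀) r) {t : ℝ} (ht : t ∈ Ioo (-ε) ε) (v : E) :
    dflow X t ((extChartAt 𝓘(ℝ, E) x₀).symm y) v = chartFrame (E := E) x₀ (Φ t y)
      (D t y (chartCoframe (E := E) x₀ ((extChartAt 𝓘(ℝ, E) x₀).symm y) v)) := by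
  have hsrc := (extChartAt 𝓘(ℝ, E) x₀).map_target (h.ball_subset hy)
  have h1 := hasMFDerivAt_chart hsrc
  have h2 : HasMFDerivAt 𝓘(ℝ, E) 𝓘(ℝ, E) (Φ t)
      (extChartAt 𝓘(ℝ, E) x₀ ((extChartAt 𝓘(ℝ, E) x₀).symm y)) (D t y) := by
    rw [(extChartAt 𝓘(ℝ, E) x₀).right_inv (h.ball_subset hy)]
    exact (h.hasFDerivAt y hy t ht).hasMFDerivAt
  have h3 : HasMFDerivAt 𝓘(ℝ, E) 𝓘(ℝ, E) (extChartAt 𝓘(ℝ, E) x₀).symm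
      (Φ t (extChartAt 𝓘(ℝ, E) x₀ ((extChartAt 𝓘(ℝ, E) x₀).symm y)))
      (chartFrame (E := E) x₀ (Φ t y)) := by
    rw [(extChartAt 𝓘(ℝ, E) x₀).right_inv (h.ball_subset hy)]
    exact hasMFDerivAt_chart_symm (h.mem_target y hy t ht)
  have h4 := HasMFDerivAt.congr_of_eventuallyEq
    (HasMFDerivAt.comp (f := Φ t ∘ extChartAt 𝓘(ℝ, E) x₀) ((extChartAt 𝓘(ℝ, E) x₀).symm y) h3
      (h2.comp ((extChartAt 𝓘(ℝ, E) x₀).symm y) h1)) (h.eventuallyEq hy ht)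
  exact congrArg (fun L : E →L[ℝ] E => L v) h4.mfderiv

omit [FiniteDimensional ℝ E] [T2Space M] in
theorem IsFlowBox.contMDiffAt (h : IsFlowBox X x₀ ε r Φ D) {y : E}
    (hy : y ∈ Metric.ball (extChartAt 𝓘(ℝ, E) x₀ x₀) r) {t : ℝ} (ht : t ∈ Ioo (-ε) ε) :
    ContMDiffAt 𝓘(ℝ, E) 𝓘(ℝ, E) 1 (flow X t) ((extChartAt 𝓘(ℝ, E) x₀).symm y) := by
  have := isManifold_one E M
  have hsrc := (extChartAt 𝓘(ℝ, E) x₀).map_target (h.ball_subset hy)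
  have h1 : ContMDiffAt 𝓘(ℝ, E) 𝓘(ℝ, E) 1 (extChartAt 𝓘(ℝ, E) x₀)
      ((extChartAt 𝓘(ℝ, E) x₀).symm y) := contMDiffAt_extChartAt' (mem_extChartAt_source_iff.1 hsrc)
  have h2 : ContMDiffAt 𝓘(ℝ, E) 𝓘(ℝ, E) 1 (Φ t) y := by
    refine ContDiffAt.contMDiffAt (contDiffAt_one_iff.2 ⟨D t, _,
      Metric.isOpen_ball.mem_nhds hy, ?_, fun z hz => h.hasFDerivAt z hz t ht⟩)
    exact h.continuousOn_deriv.comp (f := fun z => (t, z)) (by fun_prop) fun z hz => ⟨ht, hz⟩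
  have h3 : ContMDiffAt 𝓘(ℝ, E) 𝓘(ℝ, E) 1 (extChartAt 𝓘(ℝ, E) x₀).symm (Φ t y) :=
    (contMDiffOn_extChartAt_symm (I := 𝓘(ℝ, E)) (n := 1) x₀).contMDiffAt
      ((isOpen_extChartAt_target x₀).mem_nhds (h.mem_target y hy t ht))
  refine ContMDiffAt.congr_of_eventuallyEq ?_ (h.eventuallyEq hy ht)
  refine ContMDiffAt.comp_of_eq h3 (h2.comp_of_eq h1 ?_) ?_
  · exact (extChartAt 𝓘(ℝ, E) x₀).right_inv (h.ball_subset hy)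
  · simp only [Function.comp]
    rw [(extChartAt 𝓘(ℝ, E) x₀).right_inv (h.ball_subset hy)]

omit [FiniteDimensional ℝ E] [T2Space M] in
theorem IsFlowBox.eventually_contMDiffAt (h : IsFlowBox X x₀ ε r Φ D) :
    ∀ᶠ x in 𝓝 x₀, ∀ t ∈ Ioo (-ε) ε, (t, x) ∈ flowDomain X ∧
      ContMDiffAt 𝓘(ℝ, E) 𝓘(ℝ, E) 1 (flow X t) x := by
  filter_upwards [h.eventually_mem_self] with x hx t ht
  have h1 := h.mem_flowDomain _ hx.2 t ht
  have h2 := h.contMDiffAt hx.2 ht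
  rw [(extChartAt 𝓘(ℝ, E) x₀).left_inv hx.1] at h1 h2
  exact ⟨h1, h2⟩

/-- Read in the trivialisation, the differential is `D`, which is jointly continuous in time and
space and equals the identity at time zero. -/
theorem tendsto_tangent_flow_zero
    (hX : ContMDiff 𝓘(ℝ, E) 𝓘(ℝ, E).tangent ∞ (fun x => (⟨x, X x⟩ : TangentBundle 𝓘(ℝ, E) M)))
    (p : TangentBundle 𝓘(ℝ, E) M) :
    Tendsto (fun q : ℝ × TangentBundle 𝓘(ℝ, E) M =>
      (⟨flow X q.1 q.2.1, dflow X q.1 q.2.1 q.2.2⟩ : TangentBundle 𝓘(ℝ, E) M)) (𝓝 (0, p)) (𝓝 p) := by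
  have := isManifold_one E M
  obtain ⟨ε, r, Φ, D, h⟩ := exists_isFlowBox hX p.1
  set x₀ := p.1 with hx₀
  set e := trivializationAt E (TangentSpace 𝓘(ℝ, E) : M → Type _) x₀ with he
  have hp : p ∈ e.source := by
    rw [e.mem_source]; exact FiberBundle.mem_baseSet_trivializationAt' x₀
  have hproj : ContinuousAt (fun q : ℝ × TangentBundle 𝓘(ℝ, E) M => q.2.1) (0, p) :=
    ((FiberBundle.continuous_proj E (TangentSpace 𝓘(ℝ, E) : M → Type _)).comp
      continuous_snd).continuousAt
  have hmem : ∀ᶠ q : ℝ × TangentBundle 𝓘(ℝ, E) M in 𝓝 (0, p), q.1 ∈ Ioo (-ε) ε ∧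
      (q.2.1 ∈ (extChartAt 𝓘(ℝ, E) x₀).source ∧
        extChartAt 𝓘(ℝ, E) x₀ q.2.1 ∈ Metric.ball (extChartAt 𝓘(ℝ, E) x₀ x₀) r) := by
    refine Eventually.and ?_ (hproj.eventually h.eventually_mem_self)
    exact continuous_fst.continuousAt.eventually (Ioo_mem_nhds h.zero_mem.1 h.zero_mem.2)
  have hchart : ContinuousAt (fun q : ℝ × TangentBundle 𝓘(ℝ, E) M =>
      (q.1, extChartAt 𝓘(ℝ, E) x₀ q.2.1)) (0, p) :=
    continuous_fst.continuousAt.prodMk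
      (ContinuousAt.comp (g := extChartAt 𝓘(ℝ, E) x₀) (continuousAt_extChartAt x₀) hproj)
  have hnb : Ioo (-ε) ε ×ˢ Metric.ball (extChartAt 𝓘(ℝ, E) x₀ x₀) r ∈
      𝓝 ((0 : ℝ), extChartAt 𝓘(ℝ, E) x₀ x₀) :=
    prod_mem_nhds (Ioo_mem_nhds h.zero_mem.1 h.zero_mem.2)
      (Metric.isOpen_ball.mem_nhds h.center_mem)
  have hflow : ∀ᶠ q : ℝ × TangentBundle 𝓘(ℝ, E) M in 𝓝 (0, p),
      flow X q.1 q.2.1 = (extChartAt 𝓘(ℝ, E) x₀).symm (Φ q.1 (extChartAt 𝓘(ℝ, E) x₀ q.2.1)) := by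
    filter_upwards [hmem] with q hq
    have := h.flow_eq _ hq.2.2 q.1 hq.1
    rwa [(extChartAt 𝓘(ℝ, E) x₀).left_inv hq.2.1] at this
  have hΦ : ContinuousAt (fun q : ℝ × TangentBundle 𝓘(ℝ, E) M =>
      Φ q.1 (extChartAt 𝓘(ℝ, E) x₀ q.2.1)) (0, p) :=
    ContinuousAt.comp (g := fun p : ℝ × E => Φ p.1 p.2)
      (f := fun q : ℝ × TangentBundle 𝓘(ℝ, E) M => (q.1, extChartAt 𝓘(ℝ, E) x₀ q.2.1)) (h.continuousOn.continuousAt hnb) hchart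
  have hD : ContinuousAt (fun q : ℝ × TangentBundle 𝓘(ℝ, E) M =>
      D q.1 (extChartAt 𝓘(ℝ, E) x₀ q.2.1)) (0, p) :=
    ContinuousAt.comp (g := fun p : ℝ × E => D p.1 p.2)
      (f := fun q : ℝ × TangentBundle 𝓘(ℝ, E) M => (q.1, extChartAt 𝓘(ℝ, E) x₀ q.2.1)) (h.continuousOn_deriv.continuousAt hnb)
      hchart
  rw [e.tendsto_nhds_iff hp]
  constructor
  · have h1 : ContinuousAt (fun q : ℝ × TangentBundle 𝓘(ℝ, E) M =>
        (extChartAt 𝓘(ℝ, E) x₀).symm (Φ q.1 (extChartAt 𝓘(ℝ, E) x₀ q.2.1))) (0, p) := by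
      refine ContinuousAt.comp (g := (extChartAt 𝓘(ℝ, E) x₀).symm) ?_ hΦ
      simp only [← hx₀]
      rw [h.zero _ h.center_mem]
      exact continuousAt_extChartAt_symm x₀
    have h2 := h1.tendsto
    simp only [← hx₀] at h2
    rw [h.zero _ h.center_mem, extChartAt_to_inv] at h2
    exact h2.congr' (hflow.mono fun q hq => hq.symm)
  · have he2 : ContinuousAt (fun q : ℝ × TangentBundle 𝓘(ℝ, E) M => (e q.2).2) (0, p) :=
      continuous_snd.continuousAt.comp
        (ContinuousAt.comp (g := e) (e.continuousAt hp) continuous_snd.continuousAt)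
    have h1 := (hD.clm_apply he2).tendsto
    simp only [← hx₀] at h1
    rw [h.deriv_zero _ h.center_mem] at h1
    refine h1.congr' ?_
    filter_upwards [hmem, hflow] with q hq hq'
    have hd := h.dflow_eq hq.2.2 hq.1
    rw [(extChartAt 𝓘(ℝ, E) x₀).left_inv hq.2.1] at hd
    have ht := h.mem_target _ hq.2.2 q.1 hq.1
    have h3 : flow X q.1 q.2.1 ∈ (chartAt E x₀).source := by
      rw [hq']
      exact mem_extChartAt_source_iff.1 ((extChartAt 𝓘(ℝ, E) x₀).map_target ht)
    have h4 := trivializationAt_snd_eq h3 (dflow X q.1 q.2.1 q.2.2)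
    have h5 := trivializationAt_snd_eq (mem_extChartAt_source_iff.1 hq.2.1) q.2.2
    refine Eq.trans ?_ h4.symm
    have h6 : chartCoframe (E := E) x₀ (flow X q.1 q.2.1) (dflow X q.1 q.2.1 q.2.2) =
        D q.1 (extChartAt 𝓘(ℝ, E) x₀ q.2.1) (chartCoframe (E := E) x₀ q.2.1 q.2.2) := by
      have h7 := chartCoframe_chartFrame ht
        (D q.1 (extChartAt 𝓘(ℝ, E) x₀ q.2.1) (chartCoframe (E := E) x₀ q.2.1 q.2.2))
      rw [← hq'] at h7
      exact (congrArg (fun v : E => chartCoframe (E := E) x₀ (flow X q.1 q.2.1) v)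
        (hd q.2.2)).trans h7
    rw [h6, ← h5]

end FlowBox

end MonotoneHam

namespace MonotoneHam

/-! ### Derivatives at time zero along the flow -/

section Infinitesimal

variable {E : Type*} [NormedAddCommGroup E] [NormedSpace ℝ E] [FiniteDimensional ℝ E]
  {M : Type*} [TopologicalSpace M] [T2Space M] [ChartedSpace E M] [IsManifold 𝓘(ℝ, E) ∞ M]
  {X : Π x : M, TangentSpace 𝓘(ℝ, E) x} {x₀ : M} {ε r : ℝ} {Φ : ℝ → E → E}
  {D : ℝ → E → E →L[ℝ] E}

omit [FiniteDimensional ℝ E] [T2Space M] in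
theorem IsFlowBox.dflow_center (h : IsFlowBox X x₀ ε r Φ D) {t : ℝ} (ht : t ∈ Ioo (-ε) ε) (v : E) :
    dflow X t x₀ v = chartFrame (E := E) x₀ (Φ t (extChartAt 𝓘(ℝ, E) x₀ x₀))
      (D t (extChartAt 𝓘(ℝ, E) x₀ x₀) v) := by
  have h1 := h.dflow_eq h.center_mem ht v
  rw [extChartAt_to_inv, chartCoframe_self] at h1
  exact h1

omit [FiniteDimensional ℝ E] [T2Space M] [IsManifold 𝓘(ℝ, E) ∞ M] in
theorem IsFlowBox.flow_center (h : IsFlowBox X x₀ ε r Φ D) {t : ℝ} (ht : t ∈ Ioo (-ε) ε) :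
    flow X t x₀ = (extChartAt 𝓘(ℝ, E) x₀).symm (Φ t (extChartAt 𝓘(ℝ, E) x₀ x₀)) := by
  have h1 := h.flow_eq _ h.center_mem t ht
  rwa [extChartAt_to_inv] at h1

/-- A section, pulled back by the flow, has the Lie bracket as its velocity at time `0`. -/
theorem exists_hasDerivAt_mlieBracket
    (hX : ContMDiff 𝓘(ℝ, E) 𝓘(ℝ, E).tangent ∞ (fun x => (⟨x, X x⟩ : TangentBundle 𝓘(ℝ, E) M)))
    {V : Π x : M, TangentSpace 𝓘(ℝ, E) x}
    (hV : ContMDiffAt 𝓘(ℝ, E) 𝓘(ℝ, E).tangent ∞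
      (fun x => (⟨x, V x⟩ : TangentBundle 𝓘(ℝ, E) M)) x₀) :
    ∃ w : ℝ → E, w 0 = V x₀ ∧ (∀ᶠ s in 𝓝 0, dflow X s x₀ (w s) = V (flow X s x₀)) ∧
      HasDerivAt w (VectorField.mlieBracket 𝓘(ℝ, E) X V x₀) 0 := by
  have : CompleteSpace E := FiniteDimensional.complete ℝ E
  obtain ⟨ε, r, Φ, D, h⟩ := exists_isFlowBox hX x₀
  set y₀ := extChartAt 𝓘(ℝ, E) x₀ x₀ with hy₀
  have hΦ0 : Φ 0 y₀ = y₀ := h.zero _ h.center_mem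
  have hD0 : D 0 y₀ = 1 := h.deriv_zero _ h.center_mem
  have hVd : HasFDerivAt (chartRep x₀ V) (fderiv ℝ (chartRep x₀ V) y₀) y₀ :=
    (((contMDiffAt_iff_contDiffAt_chartRep le_rfl).1 hV).differentiableAt (by simp)).hasFDerivAt
  have hΦd := h.hasDerivAt _ h.center_mem 0 h.zero_mem
  have hDd := h.hasDerivAt_deriv _ h.center_mem 0 h.zero_mem
  rw [← hy₀, hΦ0] at hΦd hDd
  rw [hD0] at hDd
  have hinv : HasDerivAt (fun s => Ring.inverse (D s y₀)) (-fderiv ℝ (chartRep x₀ X) y₀) 0 := by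
    have h1 := hasFDerivAt_ringInverse (𝕜 := ℝ) (1 : (E →L[ℝ] E)ˣ)
    refine (h1.comp_hasDerivAt_of_eq 0 hDd (by simp [hD0])).congr_deriv ?_
    ext v
    simp [ContinuousLinearMap.one_def]
  have hw := hinv.clm_apply (hVd.comp_hasDerivAt_of_eq 0 hΦd hΦ0.symm)
  -- The pullback of `V` in the chart. Differentiating the inverse contributes `-dX(V)` and the
  -- chain rule `dV(X)`, which add up to the bracket.
  refine ⟨fun s => Ring.inverse (D s y₀) (chartRep x₀ V (Φ s y₀)), ?_, ?_, hw.congr_deriv ?_⟩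
  · have h1 : Ring.inverse (D 0 y₀) (chartRep x₀ V (Φ 0 y₀)) = chartRep x₀ V y₀ := by
      rw [hD0, hΦ0, Ring.inverse_one]; rfl
    exact h1.trans (chartRep_self x₀ V)
  · have hu : ∀ᶠ s in 𝓝 (0 : ℝ), IsUnit (D s y₀) :=
      hDd.continuousAt.eventually (by
        change ∀ᶠ y in 𝓝 (D 0 y₀), IsUnit y
        rw [hD0]; exact Units.nhds (1 : (E →L[ℝ] E)ˣ))
    filter_upwards [hu, Ioo_mem_nhds h.zero_mem.1 h.zero_mem.2] with s hs hs'
    have h1 := h.dflow_center hs' (Ring.inverse (D s y₀) (chartRep x₀ V (Φ s y₀)))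
    have h2 : D s y₀ (Ring.inverse (D s y₀) (chartRep x₀ V (Φ s y₀))) = chartRep x₀ V (Φ s y₀) :=
      congrArg (fun L : E →L[ℝ] E => L (chartRep x₀ V (Φ s y₀))) (Ring.mul_inverse_cancel _ hs)
    rw [← hy₀, h2, chartFrame_chartRep (h.mem_target _ h.center_mem s hs'),
      ← h.flow_center hs'] at h1
    exact h1
  · refine Eq.trans ?_ (mlieBracket_eq_lieBracket_chartRep X V x₀).symm
    simp only [VectorField.lieBracket, ← hy₀, hD0, Ring.inverse_one, Function.comp, hΦ0, neg_apply, one_apply_eq_self]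
    abel

omit [FiniteDimensional ℝ E] [T2Space M] in
theorem IsFlowBox.form_dflow_center (h : IsFlowBox X x₀ ε r Φ D)
    (Ω : Π x : M, TangentSpace 𝓘(ℝ, E) x →L[ℝ] TangentSpace 𝓘(ℝ, E) x →L[ℝ] ℝ)
    {t : ℝ} (ht : t ∈ Ioo (-ε) ε) (u v : E) :
    Ω (flow X t x₀) (dflow X t x₀ u) (dflow X t x₀ v) =
      chartForm x₀ Ω (Φ t (extChartAt 𝓘(ℝ, E) x₀ x₀)) (D t (extChartAt 𝓘(ℝ, E) x₀ x₀) u)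
        (D t (extChartAt 𝓘(ℝ, E) x₀ x₀) v) := by
  have e1 := h.dflow_center ht u
  have e2 := h.dflow_center ht v
  rw [chartForm_apply, ← h.flow_center ht]
  exact congrArg₂ (fun a b : E => (Ω (flow X t x₀) : E →L[ℝ] E →L[ℝ] ℝ) a b) e1 e2

theorem hasDerivAt_form_comp {F : Type*} [NormedAddCommGroup F] [NormedSpace ℝ F]
    {B : F → F →L[ℝ] F →L[ℝ] ℝ} {B' : F →L[ℝ] F →L[ℝ] F →L[ℝ] ℝ} {c : ℝ → F} {c' : F}
    {D : ℝ → F →L[ℝ] F} {D' : F →L[ℝ] F} {y₀ : F} (hB : HasFDerivAt B B' y₀) (hc0 : c 0 = y₀)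
    (hc : HasDerivAt c c' 0) (hD0 : D 0 = ContinuousLinearMap.id ℝ F) (hD : HasDerivAt D D' 0)
    (u v : F) : HasDerivAt (fun s => B (c s) (D s u) (D s v))
      (B' c' u v + B y₀ (D' u) v + B y₀ u (D' v)) 0 := by
  have h1 : HasDerivAt (fun s => B (c s)) (B' c') 0 :=
    HasFDerivAt.comp_hasDerivAt_of_eq (E := F →L[ℝ] F →L[ℝ] ℝ) (0 : ℝ) hB hc hc0.symm
  have h2 : ∀ w, HasDerivAt (fun s => D s w) (D' w) 0 := fun w => by
    simpa using hD.clm_apply (hasDerivAt_const (0 : ℝ) w)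
  have h3 : HasDerivAt (fun s => B (c s) (D s u)) (B' c' (D 0 u) + B (c 0) (D' u)) 0 :=
    h1.clm_apply (h2 u)
  have h4 := h3.clm_apply (h2 v)
  simpa [hD0, hc0] using h4

/-- By the product rule and the variational equation, the left side of `h0` is the derivative at
time zero. -/
theorem hasDerivAt_form_dflow_zero_of_fderiv
    (hX : ContMDiff 𝓘(ℝ, E) 𝓘(ℝ, E).tangent ∞ (fun x => (⟨x, X x⟩ : TangentBundle 𝓘(ℝ, E) M)))
    {Ω : Π x : M, TangentSpace 𝓘(ℝ, E) x →L[ℝ] TangentSpace 𝓘(ℝ, E) x →L[ℝ] ℝ}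
    (hΩ : DifferentiableAt ℝ (chartForm x₀ Ω) (extChartAt 𝓘(ℝ, E) x₀ x₀)) (u v : E)
    (h0 : fderiv ℝ (chartForm x₀ Ω) (extChartAt 𝓘(ℝ, E) x₀ x₀)
        (chartRep x₀ X (extChartAt 𝓘(ℝ, E) x₀ x₀)) u v
      + chartForm x₀ Ω (extChartAt 𝓘(ℝ, E) x₀ x₀)
          (fderiv ℝ (chartRep x₀ X) (extChartAt 𝓘(ℝ, E) x₀ x₀) u) v
      + chartForm x₀ Ω (extChartAt 𝓘(ℝ, E) x₀ x₀) u
          (fderiv ℝ (chartRep x₀ X) (extChartAt 𝓘(ℝ, E) x₀ x₀) v) = 0) :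
    HasDerivAt (fun s => (Ω (flow X s x₀) (dflow X s x₀ u) (dflow X s x₀ v) : ℝ)) 0 0 := by
  obtain ⟨ε, r, Φ, D, h⟩ := exists_isFlowBox hX x₀
  have hform := fun t ht => h.form_dflow_center Ω (t := t) ht u v
  have hΦ0 := h.zero _ h.center_mem
  have hD0 := h.deriv_zero _ h.center_mem
  have hΦd := h.hasDerivAt _ h.center_mem 0 h.zero_mem
  have hDd := h.hasDerivAt_deriv _ h.center_mem 0 h.zero_mem
  have hε := h.zero_mem
  clear h
  generalize extChartAt 𝓘(ℝ, E) x₀ x₀ = y₀ at *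
  rw [hΦ0] at hΦd hDd
  rw [hD0, ContinuousLinearMap.comp_id] at hDd
  have h1 := hasDerivAt_form_comp hΩ.hasFDerivAt hΦ0 hΦd hD0 hDd u v
  rw [h0] at h1
  refine h1.congr_of_eventuallyEq ?_
  filter_upwards [Ioo_mem_nhds hε.1 hε.2] with s hs using hform s hs

theorem hasDerivAt_form_dflow_zero
    {Ω : Π x : M, TangentSpace 𝓘(ℝ, E) x →L[ℝ] TangentSpace 𝓘(ℝ, E) x →L[ℝ] ℝ} {H : M → ℝ}
    (hΩ : IsSymplecticForm Ω) (hH : ContMDiff 𝓘(ℝ, E) 𝓘(ℝ, ℝ) ∞ H) (x₀ : M) (u v : E) :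
    HasDerivAt (fun s => (Ω (flow (hamField Ω H) s x₀) (dflow (hamField Ω H) s x₀ u)
      (dflow (hamField Ω H) s x₀ v) : ℝ)) 0 0 :=
  hasDerivAt_form_dflow_zero_of_fderiv (contMDiff_hamField hΩ hH)
    ((contDiffAt_chartForm (hΩ.smooth x₀)).differentiableAt (by simp)) u v
    (fderiv_chartForm_hamField hΩ hH x₀ u v)

end Infinitesimal

end MonotoneHam

namespace MonotoneHam

/-! ### Completeness and regularity of the flow on compact invariant sets -/

section Compact

variable {E : Type*} [NormedAddCommGroup E] [NormedSpace ℝ E] [FiniteDimensional ℝ E]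
  {M : Type*} [TopologicalSpace M] [T2Space M] [ChartedSpace E M] [IsManifold 𝓘(ℝ, E) ∞ M]
  {X : Π x : M, TangentSpace 𝓘(ℝ, E) x} {K : Set M}

theorem mem_flowDomain_zero
    (hX : ContMDiff 𝓘(ℝ, E) 𝓘(ℝ, E).tangent ∞ (fun x => (⟨x, X x⟩ : TangentBundle 𝓘(ℝ, E) M)))
    (x : M) : ((0 : ℝ), x) ∈ flowDomain X ∧ flow X 0 x = x := by
  obtain ⟨ε, r, Φ, D, h⟩ := exists_isFlowBox hX x
  have h1 := h.mem_flowDomain _ h.center_mem 0 h.zero_mem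
  rw [extChartAt_to_inv] at h1
  refine ⟨h1, ?_⟩
  rw [h.flow_center h.zero_mem, h.zero _ h.center_mem, extChartAt_to_inv]

theorem flow_zero_eq_id
    (hX : ContMDiff 𝓘(ℝ, E) 𝓘(ℝ, E).tangent ∞ (fun x => (⟨x, X x⟩ : TangentBundle 𝓘(ℝ, E) M))) :
    flow X 0 = id := funext fun x => (mem_flowDomain_zero hX x).2

theorem dflow_zero_apply
    (hX : ContMDiff 𝓘(ℝ, E) 𝓘(ℝ, E).tangent ∞ (fun x => (⟨x, X x⟩ : TangentBundle 𝓘(ℝ, E) M)))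
    (x : M) (v : E) : dflow X 0 x v = v := by
  unfold dflow
  rw [flow_zero_eq_id hX]
  exact congrArg (fun L : E →L[ℝ] E => L v) (mfderiv_id (I := 𝓘(ℝ, E)) (x := x))

theorem exists_uniform_time
    (hX : ContMDiff 𝓘(ℝ, E) 𝓘(ℝ, E).tangent ∞ (fun x => (⟨x, X x⟩ : TangentBundle 𝓘(ℝ, E) M)))
    (hK : IsCompact K) : ∃ ε : ℝ, 0 < ε ∧ ∀ x ∈ K, ∀ᶠ x' in 𝓝 x, ∀ t ∈ Ioo (-ε) ε,
      (t, x') ∈ flowDomain X ∧ ContMDiffAt 𝓘(ℝ, E) 𝓘(ℝ, E) 1 (flow X t) x' := by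
  refine hK.induction_on (p := fun S => ∃ ε : ℝ, 0 < ε ∧ ∀ x ∈ S, ∀ᶠ x' in 𝓝 x, ∀ t ∈ Ioo (-ε) ε,
      (t, x') ∈ flowDomain X ∧ ContMDiffAt 𝓘(ℝ, E) 𝓘(ℝ, E) 1 (flow X t) x') ?_ ?_ ?_ ?_
  · exact ⟨1, one_pos, fun x hx => absurd hx (notMem_empty x)⟩
  · rintro s t hst ⟨ε, hε, h⟩
    exact ⟨ε, hε, fun x hx => h x (hst hx)⟩
  · rintro s t ⟨ε, hε, h⟩ ⟨ε', hε', h'⟩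
    refine ⟨min ε ε', lt_min hε hε', ?_⟩
    rintro x (hx | hx)
    · filter_upwards [h x hx] with x' hx' t ht
      exact hx' t ⟨by linarith [ht.1, min_le_left ε ε'], by linarith [ht.2, min_le_left ε ε']⟩
    · filter_upwards [h' x hx] with x' hx' t ht
      exact hx' t ⟨by linarith [ht.1, min_le_right ε ε'], by linarith [ht.2, min_le_right ε ε']⟩
  · intro x _
    obtain ⟨ε, r, Φ, D, h⟩ := exists_isFlowBox hX x
    obtain ⟨U, hU, hUo, hxU⟩ := eventually_nhds_iff.1 h.eventually_contMDiffAt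
    refine ⟨U, mem_nhdsWithin_of_mem_nhds (hUo.mem_nhds hxU), ε, h.time_pos, fun y hy => ?_⟩
    exact (hUo.eventually_mem hy).mono fun x' hx' => hU x' hx'

/-- On a compact invariant set the flow is defined for all times, and it is of class `C¹` near
it. -/
theorem eventually_contMDiffAt_flow
    (hX : ContMDiff 𝓘(ℝ, E) 𝓘(ℝ, E).tangent ∞ (fun x => (⟨x, X x⟩ : TangentBundle 𝓘(ℝ, E) M)))
    (hK : IsCompact K) (hinv : ∀ x ∈ K, ∀ t, (t, x) ∈ flowDomain X → flow X t x ∈ K)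
    (t : ℝ) {x : M} (hx : x ∈ K) : (∀ᶠ x' in 𝓝 x, (t, x') ∈ flowDomain X) ∧
      ContMDiffAt 𝓘(ℝ, E) 𝓘(ℝ, E) 1 (flow X t) x := by
  obtain ⟨ε, hε, h⟩ := exists_uniform_time hX hK
  -- Every step ends in `K`, so the uniform time is available again. An arbitrary `t` is then
  -- divided into `n` equal steps shorter than `ε`.
  have step : ∀ s ∈ Ioo (-ε) ε, ∀ n : ℕ, ∀ x ∈ K, (∀ᶠ x' in 𝓝 x, ((n : ℝ) * s, x') ∈ flowDomain X) ∧
      ContMDiffAt 𝓘(ℝ, E) 𝓘(ℝ, E) 1 (flow X ((n : ℝ) * s)) x := by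
    intro s hs n
    induction n with
    | zero =>
      intro x hx
      simp only [Nat.cast_zero, zero_mul]
      refine ⟨Eventually.of_forall fun x' => (mem_flowDomain_zero hX x').1, ?_⟩
      rw [flow_zero_eq_id hX]
      exact contMDiffAt_id
    | succ n ih =>
      intro x hx
      obtain ⟨h1, h2⟩ := ih x hx
      have h3 := hinv x hx _ h1.self_of_nhds
      have h4 := h _ h3
      have h5 := h2.continuousAt.eventually h4
      have h6 : ∀ᶠ x' in 𝓝 x, (s + n * s, x') ∈ flowDomain X ∧
          flow X (s + n * s) x' = flow X s (flow X (n * s) x') := by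
        filter_upwards [h1, h5] with x' h7 h8 using flow_add_of_mem hX h7 (h8 s hs).1
      have e : ((n + 1 : ℕ) : ℝ) * s = s + n * s := by push_cast; ring
      rw [e]
      refine ⟨h6.mono fun x' hx' => hx'.1, ?_⟩
      refine ContMDiffAt.congr_of_eventuallyEq ?_ (h6.mono fun x' hx' => hx'.2)
      exact ContMDiffAt.comp x (h4.self_of_nhds s hs).2 h2
  obtain ⟨n, hn⟩ := exists_nat_gt (|t| / ε)
  have hn0 : (0 : ℝ) < n := (div_nonneg (abs_nonneg t) hε.le).trans_lt hn
  have := step (t / n) (abs_lt.1 (by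
    rw [abs_div, abs_of_pos hn0, div_lt_iff₀ hn0]
    rwa [div_lt_iff₀ hε, mul_comm] at hn)) n x hx
  rwa [mul_div_cancel₀ _ hn0.ne'] at this

variable (hX : ContMDiff 𝓘(ℝ, E) 𝓘(ℝ, E).tangent ∞
    (fun x => (⟨x, X x⟩ : TangentBundle 𝓘(ℝ, E) M)))
  (hK : IsCompact K) (hinv : ∀ x ∈ K, ∀ t, (t, x) ∈ flowDomain X → flow X t x ∈ K)

include hX hK hinv

theorem mem_flowDomain_of_mem {x : M} (hx : x ∈ K) (t : ℝ) : (t, x) ∈ flowDomain X :=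
  (eventually_contMDiffAt_flow hX hK hinv t hx).1.self_of_nhds

theorem flow_mem_of_mem {x : M} (hx : x ∈ K) (t : ℝ) : flow X t x ∈ K :=
  hinv x hx t (mem_flowDomain_of_mem hX hK hinv hx t)

theorem mdifferentiableAt_flow {x : M} (hx : x ∈ K) (t : ℝ) :
    MDifferentiableAt 𝓘(ℝ, E) 𝓘(ℝ, E) (flow X t) x :=
  (eventually_contMDiffAt_flow hX hK hinv t hx).2.mdifferentiableAt one_ne_zero

theorem flow_add_apply {x : M} (hx : x ∈ K) (s t : ℝ) :
    flow X (s + t) x = flow X s (flow X t x) :=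
  (flow_add_of_mem hX (mem_flowDomain_of_mem hX hK hinv hx t)
    (mem_flowDomain_of_mem hX hK hinv (flow_mem_of_mem hX hK hinv hx t) s)).2

theorem dflow_add_apply {x : M} (hx : x ∈ K) (s t : ℝ) (v : E) :
    dflow X (s + t) x v = dflow X s (flow X t x) (dflow X t x v) := by
  have hc := eventually_contMDiffAt_flow hX hK hinv t hx
  have h1 := flow_mem_of_mem hX hK hinv hx t
  have h2 := hc.2.continuousAt.eventually (eventually_contMDiffAt_flow hX hK hinv s h1).1
  have h3 : flow X (s + t) =ᶠ[𝓝 x] flow X s ∘ flow X t := by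
    filter_upwards [hc.1, h2] with x' h4 h5 using (flow_add_of_mem hX h4 h5).2
  have h4 := HasMFDerivAt.congr_of_eventuallyEq
    (HasMFDerivAt.comp x (mdifferentiableAt_flow hX hK hinv h1 s).hasMFDerivAt
      (mdifferentiableAt_flow hX hK hinv hx t).hasMFDerivAt) h3
  exact congrArg (fun L : E →L[ℝ] E => L v) h4.mfderiv

/-- Differentiate `φ_{t+s}(x) = φ_t(φ_s(x))` in `s` at zero. -/
theorem dflow_field {x : M} (hx : x ∈ K) (t : ℝ) : dflow X t x (X x) = X (flow X t x) := by
  have h0 := mem_flowDomain_zero hX x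
  have h1 := hasMFDerivAt_flow_time hX h0.1
  have h2 : HasMFDerivAt 𝓘(ℝ, E) 𝓘(ℝ, E) (flow X t) (flow X 0 x) (dflow X t (flow X 0 x)) := by
    rw [h0.2]
    exact (mdifferentiableAt_flow hX hK hinv hx t).hasMFDerivAt
  have h3 := HasMFDerivAt.comp (0 : ℝ) h2 h1
  have h4 : (fun s => flow X s x) ∘ (fun s => t + s) =ᶠ[𝓝 0] flow X t ∘ fun s => flow X s x :=
    Eventually.of_forall fun s => flow_add_apply hX hK hinv hx t s
  have h5 : HasMFDerivAt 𝓘(ℝ, ℝ) 𝓘(ℝ, E) (fun s => flow X s x) (t + 0)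
      ((1 : ℝ →L[ℝ] ℝ).smulRight (X (flow X (t + 0) x))) :=
    hasMFDerivAt_flow_time hX (mem_flowDomain_of_mem hX hK hinv hx (t + 0))
  have h6 : HasMFDerivAt 𝓘(ℝ, ℝ) 𝓘(ℝ, ℝ) (fun s : ℝ => t + s) 0 (ContinuousLinearMap.id ℝ ℝ) :=
    ((hasFDerivAt_id (0 : ℝ)).const_add t).hasMFDerivAt
  have h7 := HasMFDerivAt.congr_of_eventuallyEq (HasMFDerivAt.comp (0 : ℝ) h5 h6) h4.symm
  have h8 := hasMFDerivAt_unique h3 h7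
  have h9 := congrArg (fun L : ℝ →L[ℝ] E => L 1) h8
  rw [h0.2] at h9
  have e1 : ∀ (L : E →L[ℝ] E) (w : E), (L.comp ((1 : ℝ →L[ℝ] ℝ).smulRight w)) 1 = L w :=
    fun L w => by simp
  have e2 : ∀ (w : E), (((1 : ℝ →L[ℝ] ℝ).smulRight w).comp (ContinuousLinearMap.id ℝ ℝ)) 1 = w :=
    fun w => by simp
  exact (e1 _ _).symm.trans (h9.trans ((e2 _).trans (by rw [add_zero])))

/-- The derivative of the flow is jointly continuous in time and in the tangent vector, along
compact invariant sets. -/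
theorem tendsto_tangent_flow {ι : Type*} {l : Filter ι} {t : ι → ℝ} {t₀ : ℝ}
    (ht : Tendsto t l (𝓝 t₀)) {p : ι → TangentBundle 𝓘(ℝ, E) M} {p₀ : TangentBundle 𝓘(ℝ, E) M}
    (hp : Tendsto p l (𝓝 p₀)) (hpK : ∀ i, (p i).1 ∈ K) (hp₀ : p₀.1 ∈ K) :
    Tendsto (fun i => (⟨flow X (t i) (p i).1, dflow X (t i) (p i).1 (p i).2⟩ :
      TangentBundle 𝓘(ℝ, E) M)) l (𝓝 ⟨flow X t₀ p₀.1, dflow X t₀ p₀.1 p₀.2⟩) := by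
  -- Time is split as `(t i - t₀) + t₀`: the map at the fixed time `t₀` is `C¹`, so its tangent map
  -- is continuous, and the small remainder is covered by continuity at time zero.
  have h1 : ContinuousAt (tangentMap 𝓘(ℝ, E) 𝓘(ℝ, E) (flow X t₀)) p₀ := by
    have := isManifold_one E M
    obtain ⟨u, hu, huc⟩ := ((contMDiffAt_iff_contMDiffOn_nhds (by simp)).1
      (eventually_contMDiffAt_flow hX hK hinv t₀ hp₀).2)
    obtain ⟨w, hwu, hwo, hxw⟩ := mem_nhds_iff.1 hu
    have h2 := (huc.mono hwu).continuousOn_tangentMapWithin le_rfl hwo.uniqueMDiffOn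
    have h3 : Bundle.TotalSpace.proj ⁻¹' w ∈ 𝓝 p₀ :=
      (hwo.preimage (FiberBundle.continuous_proj E (TangentSpace 𝓘(ℝ, E) : M → Type _))).mem_nhds
        hxw
    refine (h2.continuousAt h3).congr ?_
    filter_upwards [h3] with q hq
    exact tangentMapWithin_eq_tangentMap (hwo.uniqueMDiffOn _ hq)
      (((huc.mono hwu).contMDiffAt (hwo.mem_nhds hq)).mdifferentiableAt one_ne_zero)
  have h2 : Tendsto (fun i => tangentMap 𝓘(ℝ, E) 𝓘(ℝ, E) (flow X t₀) (p i)) l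
      (𝓝 (tangentMap 𝓘(ℝ, E) 𝓘(ℝ, E) (flow X t₀) p₀)) := h1.tendsto.comp hp
  have h3 : Tendsto (fun i => t i - t₀) l (𝓝 0) := by simpa using ht.sub_const t₀
  have h4 := (tendsto_tangent_flow_zero hX (tangentMap 𝓘(ℝ, E) 𝓘(ℝ, E) (flow X t₀) p₀)).comp
    (h3.prodMk_nhds h2)
  refine h4.congr fun i => ?_
  have e1 := flow_add_apply hX hK hinv (hpK i) (t i - t₀) t₀
  have e2 := dflow_add_apply hX hK hinv (hpK i) (t i - t₀) t₀ (p i).2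
  rw [sub_add_cancel] at e1 e2
  refine Bundle.TotalSpace.ext e1.symm ?_
  exact heq_of_eq e2.symm

end Compact

end MonotoneHam

namespace MonotoneHam

/-! ### Invariance of the Hamiltonian and of the symplectic form -/

section Invariance

variable {E : Type*} [NormedAddCommGroup E] [NormedSpace ℝ E] [FiniteDimensional ℝ E]
  {M : Type*} [TopologicalSpace M] [T2Space M] [ChartedSpace E M] [IsManifold 𝓘(ℝ, E) ∞ M]
  {Ω : Π x : M, TangentSpace 𝓘(ℝ, E) x →L[ℝ] TangentSpace 𝓘(ℝ, E) x →L[ℝ] ℝ} {H : M → ℝ}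

omit [T2Space M] in
theorem dirDeriv_hamField (hΩ : IsSymplecticForm Ω) (x : M) : dirDeriv H x (hamField Ω H x) = 0 := by
  have h1 := hamField_spec Ω H x (hΩ.nondegenerate x) (hamField Ω H x)
  rw [hΩ.alternating] at h1
  linarith

/-- The Hamiltonian is a first integral. -/
theorem hamiltonian_flow (hΩ : IsSymplecticForm Ω) (hH : ContMDiff 𝓘(ℝ, E) 𝓘(ℝ, ℝ) ∞ H) {x : M}
    {t : ℝ} (h : (t, x) ∈ flowDomain (hamField Ω H)) : H (flow (hamField Ω H) t x) = H x := by
  have hX := contMDiff_hamField hΩ hH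
  have hz : ∀ y : M, (mfderiv 𝓘(ℝ, E) 𝓘(ℝ, ℝ) H y : E →L[ℝ] ℝ) (hamField Ω H y) = 0 :=
    fun y => dirDeriv_hamField hΩ y
  generalize hamField Ω H = X at *
  obtain ⟨a, b, h0, ht, hdom, -⟩ := exists_isMIntegralCurveOn_flow hX h
  have hd : ∀ s ∈ Ioo a b, HasDerivAt (fun s => H (flow X s x)) 0 s := by
    intro s hs
    have h1 := HasMFDerivAt.comp s (hH.mdifferentiableAt (x := flow X s x) (by simp)).hasMFDerivAt
      (hasMFDerivAt_flow_time hX (hdom s hs))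
    have e : ∀ (f : ℝ → ℝ) (L : E →L[ℝ] ℝ) (w : E) (s : ℝ),
        HasFDerivAt f (L.comp ((1 : ℝ →L[ℝ] ℝ).smulRight w)) s → L w = 0 → HasDerivAt f 0 s :=
      fun f L w s h hw => by simpa [hw] using h.hasDerivAt
    exact e _ _ _ s h1.hasFDerivAt (hz _)
  have h1 := (isOpen_Ioo (a := a) (b := b)).is_const_of_deriv_eq_zero isPreconnected_Ioo
    (fun s hs => (hd s hs).differentiableAt.differentiableWithinAt)
    (fun s hs => (hd s hs).deriv) ht h0
  rwa [(mem_flowDomain_zero hX x).2] at h1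

/-- The flow preserves the symplectic form along compact invariant sets. -/
theorem form_dflow {K : Set M} (hΩ : IsSymplecticForm Ω) (hH : ContMDiff 𝓘(ℝ, E) 𝓘(ℝ, ℝ) ∞ H)
    (hK : IsCompact K)
    (hinv : ∀ x ∈ K, ∀ t, (t, x) ∈ flowDomain (hamField Ω H) → flow (hamField Ω H) t x ∈ K)
    {x : M} (hx : x ∈ K) (t : ℝ) (u v : E) :
    Ω (flow (hamField Ω H) t x) (dflow (hamField Ω H) t x u) (dflow (hamField Ω H) t x v) =
      Ω x u v := by
  have hX := contMDiff_hamField hΩ hH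
  have hz := hasDerivAt_form_dflow_zero hΩ hH
  generalize hamField Ω H = X at *
  let f : ℝ → ℝ := fun s => Ω (flow X s x) (dflow X s x u) (dflow X s x v)
  -- The cocycle identity turns the derivative at time `s` over `x` into the derivative at time zero
  -- over `φ_s(x)`, which vanishes.
  have hd : ∀ s, HasDerivAt f 0 s := by
    intro s
    have h1 := hz (flow X s x) (dflow X s x u) (dflow X s x v)
    have h2 : HasDerivAt (fun r => f (r + s)) 0 0 := by
      refine h1.congr_of_eventuallyEq (Eventually.of_forall fun r => ?_)
      have e0 := flow_add_apply hX hK hinv hx r s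
      have e1 := dflow_add_apply hX hK hinv hx r s u
      have e2 := dflow_add_apply hX hK hinv hx r s v
      have key : ∀ (y z : M) (a b a' b' : E), y = z → a = a' → b = b' →
          (Ω y a b : ℝ) = Ω z a' b' := by
        rintro y z a b a' b' rfl rfl rfl; rfl
      exact key _ _ _ _ _ _ e0 e1 e2
    have h3 : HasDerivAt (fun r => f (r + s)) 0 (s - s) := by rwa [sub_self]
    simpa using h3.comp_sub_const s s
  have h1 := is_const_of_deriv_eq_zero (fun s => (hd s).differentiableAt) (fun s => (hd s).deriv) t 0
  have e1 := dflow_zero_apply hX x u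
  have e2 := dflow_zero_apply hX x v
  have e0 := (mem_flowDomain_zero hX x).2
  refine h1.trans ?_
  have key : ∀ (y z : M) (a b a' b' : E), y = z → a = a' → b = b' →
      (Ω y a b : ℝ) = Ω z a' b' := by
    rintro y z a b a' b' rfl rfl rfl; rfl
  exact key _ _ _ _ _ _ e0 e1 e2

end Invariance

end MonotoneHam

namespace MonotoneHam

/-! ### Existence of Riemannian metrics -/

section Metric

/-- The constant is the minimum on the unit sphere, which is compact; an empty sphere means `E = 0`.
-/
theorem exists_pos_mul_sq_le {E : Type*} [NormedAddCommGroup E] [NormedSpace ℝ E]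
    [FiniteDimensional ℝ E] {g : E →L[ℝ] E →L[ℝ] ℝ} (hp : ∀ v, v ≠ 0 → 0 < g v v) :
    ∃ c : ℝ, 0 < c ∧ ∀ v, c * ‖v‖ ^ 2 ≤ g v v := by
  have : ProperSpace E := FiniteDimensional.proper ℝ E
  rcases (Metric.sphere (0 : E) 1).eq_empty_or_nonempty with he | hne
  · refine ⟨1, one_pos, fun v => ?_⟩
    by_cases hv : v = 0
    · simp [hv]
    · have : ‖v‖⁻¹ • v ∈ Metric.sphere (0 : E) 1 := by
        simp [norm_smul, hv]
      rw [he] at this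
      exact absurd this (notMem_empty _)
  · obtain ⟨v₀, hv₀, hmin⟩ := (isCompact_sphere (0 : E) 1).exists_isMinOn hne
      (f := fun v => g v v) (by fun_prop)
    have h0 : v₀ ≠ 0 := by
      rintro rfl
      simp at hv₀
    refine ⟨g v₀ v₀, hp v₀ h0, fun v => ?_⟩
    by_cases hv : v = 0
    · simp [hv]
    · have hmem : ‖v‖⁻¹ • v ∈ Metric.sphere (0 : E) 1 := by
        simp [norm_smul, hv]
      have h1 : g v₀ v₀ ≤ g (‖v‖⁻¹ • v) (‖v‖⁻¹ • v) := hmin hmem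
      simp only [map_smul, smul_apply, smul_eq_mul] at h1
      have h2 : 0 < ‖v‖ := norm_pos_iff.2 hv
      calc g v₀ v₀ * ‖v‖ ^ 2 ≤ (‖v‖⁻¹ * (‖v‖⁻¹ * g v v)) * ‖v‖ ^ 2 := by gcongr
        _ = g v v := by field_simp

theorem exists_form_symm_pos (E : Type*) [NormedAddCommGroup E] [NormedSpace ℝ E]
    [FiniteDimensional ℝ E] :
    ∃ B : E →L[ℝ] E →L[ℝ] ℝ, (∀ v w, B v w = B w v) ∧ ∀ v, v ≠ 0 → 0 < B v v := by
  let e : E ≃L[ℝ] EuclideanSpace ℝ (Fin (Module.finrank ℝ E)) :=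
    ContinuousLinearEquiv.ofFinrankEq (by simp)
  refine ⟨(innerSL ℝ).bilinearComp (e : E →L[ℝ] EuclideanSpace ℝ (Fin (Module.finrank ℝ E)))
    (e : E →L[ℝ] EuclideanSpace ℝ (Fin (Module.finrank ℝ E))), fun v w => ?_, fun v hv => ?_⟩
  · exact real_inner_comm (e w) (e v)
  · exact real_inner_self_pos.2 ((map_ne_zero_iff e e.injective).2 hv)

variable {E : Type*} [NormedAddCommGroup E] [NormedSpace ℝ E] [FiniteDimensional ℝ E]
  {M : Type*} [TopologicalSpace M] [ChartedSpace E M] [IsManifold 𝓘(ℝ, E) ∞ M]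

/-- A fixed inner product of the model space is a constant section in the trivialisation of the
bundle of forms, hence smooth. -/
theorem exists_local_metric (x₀ : M) : ∃ U ∈ 𝓝 x₀,
    ∃ s : Π x : M, TangentSpace 𝓘(ℝ, E) x →L[ℝ] TangentSpace 𝓘(ℝ, E) x →L[ℝ] ℝ,
      ContMDiffOn 𝓘(ℝ, E) (𝓘(ℝ, E).prod 𝓘(ℝ, E →L[ℝ] E →L[ℝ] ℝ)) ∞
        (fun x => Bundle.TotalSpace.mk' (E →L[ℝ] E →L[ℝ] ℝ)
          (E := fun x : M => TangentSpace 𝓘(ℝ, E) x →L[ℝ] TangentSpace 𝓘(ℝ, E) x →L[ℝ] ℝ)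
          x (s x)) U ∧
      ∀ x ∈ U, (∀ v w, s x v w = s x w v) ∧ ∀ v, v ≠ 0 → 0 < s x v v := by
  have := isManifold_one E M
  obtain ⟨B, hB, hB'⟩ := exists_form_symm_pos E
  let e := trivializationAt (E →L[ℝ] E →L[ℝ] ℝ)
    (fun x : M => TangentSpace 𝓘(ℝ, E) x →L[ℝ] TangentSpace 𝓘(ℝ, E) x →L[ℝ] ℝ) x₀
  let s : Π x : M, TangentSpace 𝓘(ℝ, E) x →L[ℝ] TangentSpace 𝓘(ℝ, E) x →L[ℝ] ℝ :=
    fun x => e.symm x B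
  have hs : ∀ x ∈ e.baseSet, (e ⟨x, s x⟩).2 = B := fun x hx => by
    rw [e.apply_mk_symm hx]
  refine ⟨e.baseSet, e.open_baseSet.mem_nhds (FiberBundle.mem_baseSet_trivializationAt' x₀), s,
    ?_, ?_⟩
  · refine (Bundle.Trivialization.contMDiffOn_section_baseSet_iff (F := E →L[ℝ] E →L[ℝ] ℝ)
      (E := fun x : M => TangentSpace 𝓘(ℝ, E) x →L[ℝ] TangentSpace 𝓘(ℝ, E) x →L[ℝ] ℝ) (e := e) (n := ∞) (IB := 𝓘(ℝ, E)) (s := s)).2 ?_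
    exact (contMDiffOn_const (c := B)).congr fun x hx => hs x hx
  · intro x hx
    have hx' : x ∈ (trivializationAt E (TangentSpace 𝓘(ℝ, E)) x₀).baseSet := by
      simpa [e] using hx
    have key : ∀ v w : TangentSpace 𝓘(ℝ, E) x, s x v w =
        B (trivializationAt E (TangentSpace 𝓘(ℝ, E)) x₀ ⟨x, v⟩).2
          (trivializationAt E (TangentSpace 𝓘(ℝ, E)) x₀ ⟨x, w⟩).2 := by
      intro v w
      have h1 := hs x hx
      rw [hom_trivializationAt_apply] at h1
      have h2 := inCoordinates_apply_eq₂ (𝕜 := ℝ) (F₁ := E) (F₂ := E) (F₃ := ℝ)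
        (E₁ := fun x : M => TangentSpace 𝓘(ℝ, E) x) (E₂ := fun x : M => TangentSpace 𝓘(ℝ, E) x)
        (E₃ := Bundle.Trivial M ℝ) (ϕ := s x)
        (v := (trivializationAt E (TangentSpace 𝓘(ℝ, E)) x₀ ⟨x, v⟩).2)
        (w := (trivializationAt E (TangentSpace 𝓘(ℝ, E)) x₀ ⟨x, w⟩).2) hx' hx' (mem_univ x)
      rw [Bundle.Trivialization.symm_apply_apply_mk _ hx', Bundle.Trivialization.symm_apply_apply_mk _ hx'] at h2
      have h3 : ∀ r : ℝ, Bundle.Trivialization.linearMapAt ℝ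
          (trivializationAt ℝ (Bundle.Trivial M ℝ) x₀) x r = r := fun r => by simp
      have h4 := congrArg (fun L : E →L[ℝ] E →L[ℝ] ℝ =>
        L (trivializationAt E (TangentSpace 𝓘(ℝ, E)) x₀ ⟨x, v⟩).2
          (trivializationAt E (TangentSpace 𝓘(ℝ, E)) x₀ ⟨x, w⟩).2) h1
      exact (h2.trans (h3 _)).symm.trans h4
    refine ⟨fun v w => by rw [key, key, hB], fun v hv => ?_⟩
    rw [key]
    refine hB' _ fun h0 => hv ?_
    have h1 := Bundle.Trivialization.symm_apply_apply_mk
      (trivializationAt E (TangentSpace 𝓘(ℝ, E)) x₀) hx' v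
    rw [h0] at h1
    rw [← h1]
    exact (congrFun (Bundle.Trivialization.coe_symmₗ (R := ℝ)
      (trivializationAt E (TangentSpace 𝓘(ℝ, E)) x₀) hx').symm 0).trans (map_zero _)

set_option synthInstance.maxHeartbeats 400000 in
-- Symmetry and positivity are convex conditions on a form, so local metrics are glued by a
-- partition of unity.
theorem nonempty_contMDiffRiemannianMetric [T2Space M] [SigmaCompactSpace M] :
    Nonempty (Bundle.ContMDiffRiemannianMetric 𝓘(ℝ, E) ∞ E (fun x : M => TangentSpace 𝓘(ℝ, E) x)) := by
  have := isManifold_one E M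
  obtain ⟨s, hs⟩ := exists_contMDiffSection_forall_mem_convex_of_local 𝓘(ℝ, E) (n := ⊤)
    (F_fiber := E →L[ℝ] E →L[ℝ] ℝ)
    (fun x : M => TangentSpace 𝓘(ℝ, E) x →L[ℝ] TangentSpace 𝓘(ℝ, E) x →L[ℝ] ℝ)
    (fun x => {b | (∀ v w, b v w = b w v) ∧ ∀ v, v ≠ 0 → 0 < b v v})
    (fun x b hb b' hb' r r' hr hr' hrr => by
      refine ⟨fun v w => ?_, fun v hv => ?_⟩
      · change r * b v w + r' * b' v w = r * b w v + r' * b' w v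
        rw [hb.1, hb'.1]
      · change 0 < r * b v v + r' * b' v v
        have h1 := hb.2 v hv
        have h2 := hb'.2 v hv
        rcases hr.eq_or_lt with h | h
        · rw [← h, zero_add] at hrr
          rw [← h, hrr]
          simpa using h2
        · have := mul_pos h h1
          have := mul_nonneg hr' h2.le
          linarith)
    exists_local_metric
  refine ⟨⟨fun x => s x, fun x => (hs x).1, fun x => (hs x).2, fun x => ?_, s.contMDiff⟩⟩
  let g : E →L[ℝ] E →L[ℝ] ℝ := s x
  have hg : ∀ v : E, v ≠ 0 → 0 < g v v := (hs x).2
  obtain ⟨c, hc, h⟩ := exists_pos_mul_sq_le hg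
  refine (NormedSpace.isVonNBounded_closedBall ℝ E (Real.sqrt (1 / c))).subset fun v hv => ?_
  have hv' : g v v < 1 := hv
  have h1 := (h v).trans hv'.le
  refine mem_closedBall_zero_iff.2 (Real.le_sqrt_of_sq_le ?_)
  rw [le_div_iff₀ hc]
  linarith

end Metric

end MonotoneHam

namespace MonotoneHam

/-! ### Uniform estimates for convergent bilinear forms -/

section Bilinear

variable {F : Type*} [NormedAddCommGroup F] [NormedSpace ℝ F] {ι : Type*} {l : Filter ι}
  {B : ι → F →L[ℝ] F →L[ℝ] ℝ} {B₀ : F →L[ℝ] F →L[ℝ] ℝ}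

theorem tendsto_bilinear_apply (hB : Tendsto B l (𝓝 B₀)) {u v : ι → F} {u₀ v₀ : F}
    (hu : Tendsto u l (𝓝 u₀)) (hv : Tendsto v l (𝓝 v₀)) :
    Tendsto (fun i => B i (u i) (v i)) l (𝓝 (B₀ u₀ v₀)) :=
  ((by fun_prop : Continuous fun p : (F →L[ℝ] F →L[ℝ] ℝ) × F × F => p.1 p.2.1 p.2.2).tendsto
    (B₀, u₀, v₀)).comp (hB.prodMk_nhds (hu.prodMk_nhds hv))

theorem eventually_norm_apply_sub_le {G : Type*} [NormedAddCommGroup G] [NormedSpace ℝ G]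
    {A : ι → F →L[ℝ] G} {A₀ : F →L[ℝ] G} (hA : Tendsto A l (𝓝 A₀)) {c : ℝ} (hc : 0 < c) :
    ∀ᶠ i in l, ∀ v, ‖A i v - A₀ v‖ ≤ c * ‖v‖ := by
  filter_upwards [Metric.tendsto_nhds.1 hA c hc] with i hi v
  rw [dist_eq_norm] at hi
  exact (A i - A₀).le_of_opNorm_le hi.le v

theorem eventually_half_mul_sq_le (hB : Tendsto B l (𝓝 B₀)) {c : ℝ} (hc : 0 < c)
    (h : ∀ v, c * ‖v‖ ^ 2 ≤ B₀ v v) : ∀ᶠ i in l, ∀ v, c / 2 * ‖v‖ ^ 2 ≤ B i v v := by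
  have h1 := eventually_norm_apply_sub_le (G := F →L[ℝ] ℝ) hB (half_pos hc)
  filter_upwards [h1] with i hi a
  have h5 : |(B i a - B₀ a) a| ≤ c / 2 * ‖a‖ * ‖a‖ := (B i a - B₀ a).le_of_opNorm_le (hi a) a
  have h6 : (B i a - B₀ a) a = B i a a - B₀ a a := rfl
  rw [h6] at h5
  have h7 := h a
  have h8 := (abs_le.1 h5).1
  nlinarith

end Bilinear

/-! ### Limits in the tangent bundle -/

section TangentLimits

variable {E : Type*} [NormedAddCommGroup E] [NormedSpace ℝ E]
  {M : Type*} [TopologicalSpace M] [ChartedSpace E M] [IsManifold 𝓘(ℝ, E) ∞ M]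

theorem tendsto_tangent_iff {ι : Type*} {l : Filter ι} {x : ι → M} {u : ι → E} {y : M} {v : E} :
    Tendsto (fun i => (⟨x i, u i⟩ : TangentBundle 𝓘(ℝ, E) M)) l (𝓝 ⟨y, v⟩) ↔
      Tendsto x l (𝓝 y) ∧ Tendsto (fun i => chartCoframe (E := E) y (x i) (u i)) l (𝓝 v) := by
  have := isManifold_one E M
  rw [(trivializationAt E (TangentSpace 𝓘(ℝ, E)) y).tendsto_nhds_iff
    (by simp)]
  refine and_congr_right fun hx => ?_
  have h1 : (trivializationAt E (TangentSpace 𝓘(ℝ, E)) y ⟨y, v⟩).2 = v :=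
    (trivializationAt_snd_eq (mem_chart_source E y) v).trans
      (congrArg (fun L : E →L[ℝ] E => L v) (chartCoframe_self y))
  have h2 : (fun i => (trivializationAt E (TangentSpace 𝓘(ℝ, E)) y ⟨x i, u i⟩).2) =ᶠ[l]
      fun i => chartCoframe (E := E) y (x i) (u i) := by
    have h3 : Tendsto x l (𝓝 y) := hx
    filter_upwards [h3 (chart_source_mem_nhds E y)] with i hi using trivializationAt_snd_eq hi _
  rw [h1]
  exact tendsto_congr' h2

theorem chartForm_chartCoframe {x₀ x : M} (hx : x ∈ (chartAt E x₀).source)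
    (b : Π x : M, TangentSpace 𝓘(ℝ, E) x →L[ℝ] TangentSpace 𝓘(ℝ, E) x →L[ℝ] ℝ) (u v : E) :
    chartForm x₀ b (extChartAt 𝓘(ℝ, E) x₀ x) (chartCoframe x₀ x u) (chartCoframe x₀ x v) =
      b x u v := by
  have hx2 : x ∈ (extChartAt 𝓘(ℝ, E) x₀).source := mem_extChartAt_source_iff.2 hx
  have h1 := chartFrame_chartCoframe ((extChartAt 𝓘(ℝ, E) x₀).map_source hx2)
  have h2 : ∀ z : M, z = x → (∀ w, chartFrame x₀ (extChartAt 𝓘(ℝ, E) x₀ x)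
      (chartCoframe x₀ z w) = w) → (b z (chartFrame x₀ (extChartAt 𝓘(ℝ, E) x₀ x)
      (chartCoframe x₀ x u)) (chartFrame x₀ (extChartAt 𝓘(ℝ, E) x₀ x)
      (chartCoframe x₀ x v)) : ℝ) = b x u v := by
    rintro z rfl hz
    rw [hz, hz]
  exact h2 _ ((extChartAt 𝓘(ℝ, E) x₀).left_inv hx2) h1

variable [FiniteDimensional ℝ E]
  {b : Π x : M, TangentSpace 𝓘(ℝ, E) x →L[ℝ] TangentSpace 𝓘(ℝ, E) x →L[ℝ] ℝ}
  (hb : ContMDiff 𝓘(ℝ, E) (𝓘(ℝ, E).prod 𝓘(ℝ, E →L[ℝ] E →L[ℝ] ℝ)) ∞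
    (fun x => Bundle.TotalSpace.mk' (E →L[ℝ] E →L[ℝ] ℝ)
      (E := fun x : M => TangentSpace 𝓘(ℝ, E) x →L[ℝ] TangentSpace 𝓘(ℝ, E) x →L[ℝ] ℝ) x (b x)))

include hb

theorem tendsto_chartForm {ι : Type*} {l : Filter ι} {x : ι → M} {y : M}
    (hx : Tendsto x l (𝓝 y)) :
    Tendsto (fun i => chartForm y b (extChartAt 𝓘(ℝ, E) y (x i))) l
      (𝓝 (chartForm y b (extChartAt 𝓘(ℝ, E) y y))) :=
  (contDiffAt_chartForm (hb y)).continuousAt.tendsto.comp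
    ((continuousAt_extChartAt (I := 𝓘(ℝ, E)) y).tendsto.comp hx)

theorem tendsto_form_apply {ι : Type*} {l : Filter ι} {x : ι → M} {u v : ι → E} {y : M} {u' v' : E}
    (hu : Tendsto (fun i => (⟨x i, u i⟩ : TangentBundle 𝓘(ℝ, E) M)) l (𝓝 ⟨y, u'⟩))
    (hv : Tendsto (fun i => (⟨x i, v i⟩ : TangentBundle 𝓘(ℝ, E) M)) l (𝓝 ⟨y, v'⟩)) :
    Tendsto (fun i => (b (x i) (u i) (v i) : ℝ)) l (𝓝 (b y u' v')) := by
  have hu := tendsto_tangent_iff.1 hu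
  have hv := tendsto_tangent_iff.1 hv
  have h1 := tendsto_bilinear_apply (tendsto_chartForm hb hu.1) hu.2 hv.2
  rw [chartForm_self] at h1
  refine h1.congr' ?_
  filter_upwards [hu.1 (chart_source_mem_nhds E y)] with i hi
  exact chartForm_chartCoframe hi b _ _

/-- Near the limiting base point the forms, read in the chart, are uniformly positive, so a bound on
their values bounds the coordinates. Ultrafilters converge in compact sets, which avoids passing to
subsequences. -/
theorem exists_tendsto_tangent (hp : ∀ x v, v ≠ 0 → 0 < b x v v) {K : Set M} (hK : IsCompact K)
    {ι : Type*} (l : Ultrafilter ι) {x : ι → M} (hx : ∀ i, x i ∈ K) {u : ι → E} {C : ℝ}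
    (hu : ∀ i, b (x i) (u i) (u i) ≤ C) :
    ∃ y ∈ K, ∃ v : E, Tendsto (fun i => (⟨x i, u i⟩ : TangentBundle 𝓘(ℝ, E) M)) l (𝓝 ⟨y, v⟩) := by
  have : ProperSpace E := FiniteDimensional.proper ℝ E
  obtain ⟨y, hy, hxy⟩ := hK.ultrafilter_le_nhds (l.map x)
    (le_principal_iff.2 (mem_map.2 (Eventually.of_forall hx)))
  have hxy : Tendsto x l (𝓝 y) := hxy
  have hp' : ∀ v : E, v ≠ 0 → 0 < chartForm y b (extChartAt 𝓘(ℝ, E) y y) v v := by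
    rw [chartForm_self]
    exact hp y
  obtain ⟨c, hc, hlow⟩ := exists_pos_mul_sq_le hp'
  have h1 := tendsto_chartForm hb hxy
  have h2 := eventually_half_mul_sq_le h1 hc hlow
  have h3 : ∀ᶠ i in (l : Filter ι), chartCoframe (E := E) y (x i) (u i) ∈
      Metric.closedBall (0 : E) (Real.sqrt (C / (c / 2))) := by
    filter_upwards [h2, hxy (chart_source_mem_nhds E y)] with i hi hi'
    have h4 := (chartForm_chartCoframe hi' b (u i) (u i)).le.trans (hu i)
    have h5 := hi (chartCoframe y (x i) (u i))
    refine mem_closedBall_zero_iff.2 (Real.le_sqrt_of_sq_le ?_)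
    rw [le_div_iff₀ (by positivity)]
    linarith
  obtain ⟨v, -, hv⟩ := (isCompact_closedBall (0 : E) (Real.sqrt (C / (c / 2)))).ultrafilter_le_nhds
    (l.map fun i => chartCoframe (E := E) y (x i) (u i)) (le_principal_iff.2 h3)
  exact ⟨y, hy, v, tendsto_tangent_iff.2 ⟨hxy, hv⟩⟩

end TangentLimits

end MonotoneHam

namespace MonotoneHam

/-! ### Quadratic forms given by coefficient matrices -/

section CoeffForm

variable {k : ℕ}

/-- The bilinear form with the given coefficients. -/
noncomputable def coeffForm (p : Fin k → Fin k → ℝ) : (Fin k → ℝ) →L[ℝ] (Fin k → ℝ) →L[ℝ] ℝ :=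
  ∑ i, (ContinuousLinearMap.proj (R := ℝ) i : (Fin k → ℝ) →L[ℝ] ℝ).smulRight
    (∑ j, p i j • (ContinuousLinearMap.proj (R := ℝ) j : (Fin k → ℝ) →L[ℝ] ℝ))

theorem coeffForm_apply (p : Fin k → Fin k → ℝ) (a b : Fin k → ℝ) :
    coeffForm p a b = ∑ i, a i * ∑ j, p i j * b j := by
  simp [coeffForm, sum_apply]

theorem continuous_sum_smulRight {G : Type*} [NormedAddCommGroup G] [NormedSpace ℝ G] :
    Continuous fun q : Fin k → G =>
      ∑ i, (ContinuousLinearMap.proj (R := ℝ) i : (Fin k → ℝ) →L[ℝ] ℝ).smulRight (q i) := by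
  refine continuous_finsetSum _ fun i _ => ?_
  exact (ContinuousLinearMap.smulRightL ℝ (Fin k → ℝ) G
    (ContinuousLinearMap.proj (R := ℝ) i)).continuous.comp (continuous_apply i)

theorem continuous_coeffForm : Continuous (coeffForm (k := k)) := by
  refine (continuous_sum_smulRight (k := k) (G := (Fin k → ℝ) →L[ℝ] ℝ)).comp
    (f := fun p : Fin k → Fin k → ℝ => fun i =>
      ∑ j, p i j • (ContinuousLinearMap.proj (R := ℝ) j : (Fin k → ℝ) →L[ℝ] ℝ)) ?_
  fun_prop

theorem form_sum_smul {E : Type*} [NormedAddCommGroup E] [NormedSpace ℝ E]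
    (B : E →L[ℝ] E →L[ℝ] ℝ) (w v : Fin k → E) (a : Fin k → ℝ) :
    B (∑ i, a i • w i) (∑ j, a j • v j) = coeffForm (fun i j => B (w i) (v j)) a a := by
  rw [coeffForm_apply]
  simp only [map_sum, map_smul, sum_apply, smul_apply, smul_eq_mul, Finset.mul_sum]
  rw [Finset.sum_comm]
  exact Finset.sum_congr rfl fun i _ => Finset.sum_congr rfl fun j _ => by ring

/-- A form close to a positive definite one dominates a fixed multiple of any bounded form. -/
theorem exists_pos_eventually_coeffForm_le {ι : Type*} {l : Filter ι}
    {p q : ι → Fin k → Fin k → ℝ} {p₀ q₀ : Fin k → Fin k → ℝ}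
    (hp : Tendsto p l (𝓝 p₀)) (hq : Tendsto q l (𝓝 q₀))
    (hpos : ∀ a, a ≠ 0 → 0 < coeffForm p₀ a a) :
    ∃ κ : ℝ, 0 < κ ∧ ∀ᶠ i in l, ∀ a, κ * coeffForm (q i) a a ≤ coeffForm (p i) a a := by
  obtain ⟨c, hc, hlow⟩ := exists_pos_mul_sq_le hpos
  have h1 := eventually_half_mul_sq_le ((continuous_coeffForm.tendsto p₀).comp hp) hc hlow
  have h2 := eventually_norm_apply_sub_le (G := (Fin k → ℝ) →L[ℝ] ℝ)
    ((continuous_coeffForm.tendsto q₀).comp hq) one_pos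
  have hC : 0 ≤ ‖coeffForm q₀‖ := (coeffForm q₀).opNorm_nonneg
  -- Half of `c` survives the deviation of `p i` from `p₀`, and the `1` absorbs that of `q i` from
  -- `q₀`.
  refine ⟨c / 2 / (‖coeffForm q₀‖ + 1), by positivity, ?_⟩
  filter_upwards [h1, h2] with i hi hi' a
  have h3 : |coeffForm (q i) a a - coeffForm q₀ a a| ≤ 1 * ‖a‖ * ‖a‖ :=
    (coeffForm (q i) a - coeffForm q₀ a).le_of_opNorm_le (hi' a) a
  have h4 : |coeffForm q₀ a a| ≤ ‖coeffForm q₀‖ * ‖a‖ * ‖a‖ := (coeffForm q₀).le_opNorm₂ a a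
  have h5 := (abs_le.1 h3).2
  have h6 := (abs_le.1 h4).2
  have h7 : c / 2 * ‖a‖ ^ 2 ≤ coeffForm (p i) a a := hi a
  have h8 : coeffForm (q i) a a ≤ (‖coeffForm q₀‖ + 1) * ‖a‖ ^ 2 := by linarith
  refine le_trans ?_ h7
  rw [div_mul_eq_mul_div, div_le_iff₀ (by positivity)]
  nlinarith

end CoeffForm

/-! ### Local frames of the Lagrangian distribution -/

section Frames

variable {E : Type*} [NormedAddCommGroup E] [NormedSpace ℝ E] [FiniteDimensional ℝ E]
  {M : Type*} [TopologicalSpace M] [ChartedSpace E M] [IsManifold 𝓘(ℝ, E) ∞ M]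
  {Ω : Π x : M, TangentSpace 𝓘(ℝ, E) x →L[ℝ] TangentSpace 𝓘(ℝ, E) x →L[ℝ] ℝ}
  {Λ : Π x : M, Submodule ℝ (TangentSpace 𝓘(ℝ, E) x)}
  {X : Π x : M, TangentSpace 𝓘(ℝ, E) x}

/-- A Lagrangian distribution is closed. -/
theorem mem_of_tendsto_tangent (hΩ : IsSymplecticForm Ω) (hΛ : IsLagrangianDistribution Ω Λ)
    {ι : Type*} {l : Filter ι} [l.NeBot] {x : ι → M} {u : ι → E} {y : M} {v : E}
    (h : Tendsto (fun i => (⟨x i, u i⟩ : TangentBundle 𝓘(ℝ, E) M)) l (𝓝 ⟨y, v⟩))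
    (hu : ∀ i, u i ∈ Λ (x i)) : v ∈ Λ y := by
  obtain ⟨U, k, V, hU, hy, hV, hspan⟩ := hΛ.smooth y
  have hx := (tendsto_tangent_iff.1 h).1
  -- Since `Λ y` is its own orthogonal, membership can be tested by pairing with a local frame, and
  -- these pairings pass to the limit.
  have key : ∀ j, (Ω y v (V j y) : ℝ) = 0 := by
    intro j
    have h1 : Tendsto (fun i => (⟨x i, V j (x i)⟩ : TangentBundle 𝓘(ℝ, E) M)) l
        (𝓝 ⟨y, V j y⟩) :=
      (((hV j).contMDiffAt (hU.mem_nhds hy)).continuousAt.tendsto).comp hx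
    have h2 := tendsto_form_apply hΩ.smooth h h1
    refine tendsto_nhds_unique h2 (tendsto_const_nhds.congr' ?_)
    filter_upwards [hx (hU.mem_nhds hy)] with i hi
    have h3 : V j (x i) ∈ Λ (x i) := by
      rw [← (hspan _ hi).2]
      exact Submodule.subset_span ⟨j, rfl⟩
    exact ((hΛ.lagrangian _ _).1 (hu i) _ h3).symm
  refine (hΛ.lagrangian y v).2 fun w hw => ?_
  rw [← (hspan y hy).2] at hw
  induction hw using Submodule.span_induction with
  | mem w hw =>
    obtain ⟨j, rfl⟩ := hw
    exact key j
  | zero => exact map_zero _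
  | add a b _ _ ha hb => rw [map_add, ha, hb, add_zero]
  | smul r a _ ha => rw [map_smul, ha, smul_zero]

omit [FiniteDimensional ℝ E] in
theorem lieBracket_sum_smul {k : ℕ} {Y : E → E} {V : Fin k → E → E} {y : E}
    (hV : ∀ j, DifferentiableAt ℝ (V j) y) (a : Fin k → ℝ) :
    VectorField.lieBracket ℝ Y (fun z => ∑ j, a j • V j z) y =
      ∑ j, a j • VectorField.lieBracket ℝ Y (V j) y := by
  have h1 := HasFDerivAt.fun_sum (u := Finset.univ)
    fun j _ => (hV j).hasFDerivAt.const_smul (a j)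
  have h2 : fderiv ℝ (fun z => ∑ j, a j • V j z) y = ∑ j, a j • fderiv ℝ (V j) y := h1.fderiv
  simp only [VectorField.lieBracket, h2, sum_apply, smul_apply, map_sum, map_smul, smul_sub,
    Finset.sum_sub_distrib]

omit [FiniteDimensional ℝ E] in
theorem mlieBracket_sum_smul {k : ℕ} {V : Fin k → Π x : M, TangentSpace 𝓘(ℝ, E) x} {x : M}
    (hV : ∀ j, ContMDiffAt 𝓘(ℝ, E) 𝓘(ℝ, E).tangent ∞
      (fun y => (⟨y, V j y⟩ : TangentBundle 𝓘(ℝ, E) M)) x) (a : Fin k → ℝ) :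
    VectorField.mlieBracket 𝓘(ℝ, E) X (fun y => ∑ j, a j • V j y) x =
      ∑ j, a j • VectorField.mlieBracket 𝓘(ℝ, E) X (V j) x := by
  have hd : ∀ j, DifferentiableAt ℝ (chartRep x (V j)) (extChartAt 𝓘(ℝ, E) x x) := fun j =>
    ((contMDiffAt_iff_contDiffAt_chartRep le_rfl).1 (hV j)).differentiableAt (by simp)
  have hr : chartRep x (fun y => ∑ j, a j • V j y) = fun y => ∑ j, a j • chartRep x (V j) y := by
    ext y
    exact (map_sum _ _ _).trans (Finset.sum_congr rfl fun j _ => map_smul _ _ _)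
  have hj := fun j => mlieBracket_eq_lieBracket_chartRep X (V j) x
  rw [mlieBracket_eq_lieBracket_chartRep, hr]
  exact (lieBracket_sum_smul hd a).trans
    (Finset.sum_congr rfl fun j _ => congrArg (fun z : E => a j • z) (hj j)).symm

/-- Near every point, monotonicity is uniform. -/
theorem exists_local_velocity (hΩ : IsSymplecticForm Ω) (hΛ : IsLagrangianDistribution Ω Λ)
    (hX : ContMDiff 𝓘(ℝ, E) 𝓘(ℝ, E).tangent ∞ (fun x => (⟨x, X x⟩ : TangentBundle 𝓘(ℝ, E) M)))
    (hmono : IsMonotone Ω Λ X)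
    {g : Π x : M, TangentSpace 𝓘(ℝ, E) x →L[ℝ] TangentSpace 𝓘(ℝ, E) x →L[ℝ] ℝ}
    (hg : ContMDiff 𝓘(ℝ, E) (𝓘(ℝ, E).prod 𝓘(ℝ, E →L[ℝ] E →L[ℝ] ℝ)) ∞
      (fun x => Bundle.TotalSpace.mk' (E →L[ℝ] E →L[ℝ] ℝ)
        (E := fun x : M => TangentSpace 𝓘(ℝ, E) x →L[ℝ] TangentSpace 𝓘(ℝ, E) x →L[ℝ] ℝ) x (g x)))
    (x₀ : M) : ∃ κ : ℝ, 0 < κ ∧ ∀ᶠ x in 𝓝 x₀, ∀ v ∈ Λ x, ∃ V : Π y : M, TangentSpace 𝓘(ℝ, E) y,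
      ContMDiffAt 𝓘(ℝ, E) 𝓘(ℝ, E).tangent ∞ (fun y => (⟨y, V y⟩ : TangentBundle 𝓘(ℝ, E) M)) x ∧
      (∀ᶠ y in 𝓝 x, V y ∈ Λ y) ∧ V x = v ∧
      κ * g x v v ≤ Ω x (VectorField.mlieBracket 𝓘(ℝ, E) X V x) v := by
  have := isManifold_one E M
  have : CompleteSpace E := FiniteDimensional.complete ℝ E
  have : IsManifold 𝓘(ℝ, E) (minSmoothness ℝ 2) M := by
    rw [minSmoothness_of_isRCLikeNormedField]
    exact .of_le (n := ∞) (WithTop.coe_le_coe.2 (le_top : (2 : ℕ∞) ≤ ⊤))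
  have : IsManifold 𝓘(ℝ, E) ((⊤ : ℕ∞) + 1) M := .of_le (n := ∞) le_rfl
  obtain ⟨U, k, V, hU, hx₀, hV, hspan⟩ := hΛ.smooth x₀
  have hVat : ∀ j, ∀ x ∈ U, ContMDiffAt 𝓘(ℝ, E) 𝓘(ℝ, E).tangent ∞
      (fun y => (⟨y, V j y⟩ : TangentBundle 𝓘(ℝ, E) M)) x :=
    fun j x hx => (hV j).contMDiffAt (hU.mem_nhds hx)
  let W : Fin k → Π y : M, TangentSpace 𝓘(ℝ, E) y :=
    fun j => VectorField.mlieBracket 𝓘(ℝ, E) X (V j)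
  let p : M → Fin k → Fin k → ℝ := fun x i j => Ω x (W i x) (V j x)
  let q : M → Fin k → Fin k → ℝ := fun x i j => g x (V i x) (V j x)
  have hVt : ∀ j, Tendsto (fun x => (⟨x, V j x⟩ : TangentBundle 𝓘(ℝ, E) M)) (𝓝 x₀)
      (𝓝 ⟨x₀, V j x₀⟩) := fun j => (hVat j x₀ hx₀).continuousAt.tendsto
  have hWt : ∀ j, Tendsto (fun x => (⟨x, W j x⟩ : TangentBundle 𝓘(ℝ, E) M)) (𝓝 x₀)
      (𝓝 ⟨x₀, W j x₀⟩) := fun j => by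
    have := ContMDiffAt.mlieBracket_vectorField (I := 𝓘(ℝ, E)) (m := 0) (n := ⊤) (hX x₀) (hVat j x₀ hx₀)
      (by rw [minSmoothness_of_isRCLikeNormedField]; simp)
    exact this.continuousAt.tendsto
  have hp : Tendsto p (𝓝 x₀) (𝓝 (p x₀)) :=
    tendsto_pi_nhds.2 fun i => tendsto_pi_nhds.2 fun j => tendsto_form_apply hΩ.smooth (hWt i) (hVt j)
  have hq : Tendsto q (𝓝 x₀) (𝓝 (q x₀)) :=
    tendsto_pi_nhds.2 fun i => tendsto_pi_nhds.2 fun j => tendsto_form_apply hg (hVt i) (hVt j)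
  -- With constant coefficients the bracket with `X` is linear in them, so monotonicity at `x₀` says
  -- that the matrix `p x₀` is positive definite, a property that persists nearby with a uniform
  -- constant.
  let S : (Fin k → ℝ) → Π y : M, TangentSpace 𝓘(ℝ, E) y := fun a y => ∑ j, a j • V j y
  have hS : ∀ a, ContMDiffOn 𝓘(ℝ, E) 𝓘(ℝ, E).tangent ∞
      (fun y => (⟨y, S a y⟩ : TangentBundle 𝓘(ℝ, E) M)) U := fun a =>
    ContMDiffOn.sum_section (t := fun j y => a j • V j y)
      fun j _ => ContMDiffOn.const_smul_section (hV j)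
  have hSmem : ∀ a, ∀ x ∈ U, S a x ∈ Λ x := fun a x hx => by
    rw [← (hspan x hx).2]
    exact Submodule.sum_mem _ fun j _ => Submodule.smul_mem _ _ (Submodule.subset_span ⟨j, rfl⟩)
  have hSΛ : ∀ a, ∀ x ∈ U, ∀ᶠ y in 𝓝 x, S a y ∈ Λ y := fun a x hx => by
    filter_upwards [hU.mem_nhds hx] with y hy using hSmem a y hy
  have hPa : ∀ a, ∀ x ∈ U, (Ω x (VectorField.mlieBracket 𝓘(ℝ, E) X (S a) x) (S a x) : ℝ) =
      coeffForm (p x) a a := fun a x hx => by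
    have h1 := mlieBracket_sum_smul (X := X)
      (fun j => hVat j x hx) a
    exact (congrArg (fun z : E => (Ω x z (S a x) : ℝ)) h1).trans
      (form_sum_smul (E := E) (Ω x) (fun j => W j x) (fun j => V j x) a)
  have hQa : ∀ a x, (g x (S a x) (S a x) : ℝ) = coeffForm (q x) a a := fun a x =>
    form_sum_smul (E := E) (g x) (fun j => V j x) (fun j => V j x) a
  have hpos : ∀ a, a ≠ 0 → 0 < coeffForm (p x₀) a a := fun a ha => by
    rw [← hPa a x₀ hx₀]
    refine hmono x₀ (S a) ⟨U, hU, hx₀, hS a⟩ (hSΛ a x₀ hx₀) fun h0 => ha ?_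
    exact funext (Fintype.linearIndependent_iff.1 (hspan x₀ hx₀).1 a h0)
  obtain ⟨κ, hκ, hev⟩ := exists_pos_eventually_coeffForm_le hp hq hpos
  refine ⟨κ, hκ, ?_⟩
  filter_upwards [hev, hU.mem_nhds hx₀] with x hx hxU v hv
  rw [← (hspan x hxU).2] at hv
  obtain ⟨a, rfl⟩ := (Submodule.mem_span_range_iff_exists_fun ℝ).1 hv
  refine ⟨S a, (hS a).contMDiffAt (hU.mem_nhds hxU), hSΛ a x hxU, rfl, ?_⟩
  have h1 := hx a
  rw [← hPa a x hxU, ← hQa a x] at h1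
  exact h1

end Frames

end MonotoneHam

namespace MonotoneHam

/-! ### Bounds from limits along ultrafilters -/

section Bounds

/-- An unbounded function exceeds `n` at some `a n`, and then has no limit along this sequence. The
uniform bounds on the compact set are derived from this. -/
theorem exists_bound_of_tendsto {α : Type*} {f : α → ℝ}
    (h : ∀ a : ℕ → α, ∃ r, Tendsto (fun n => f (a n)) (hyperfilter ℕ) (𝓝 r)) :
    ∃ C, ∀ a, f a ≤ C := by
  by_contra! hc
  choose a ha using fun n : ℕ => hc n
  obtain ⟨r, hr⟩ := h a
  have h1 : Tendsto (fun n : ℕ => f (a n)) (hyperfilter ℕ) atTop :=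
    (tendsto_atTop_mono (fun n => (ha n).le) tendsto_natCast_atTop_atTop).mono_left
      Nat.hyperfilter_le_atTop
  exact not_tendsto_nhds_of_tendsto_atTop h1 r hr

variable {E : Type*} [NormedAddCommGroup E] [NormedSpace ℝ E] {g : E →L[ℝ] E →L[ℝ] ℝ}

theorem exists_formNorm_eq_one (hp : ∀ v, v ≠ 0 → 0 < g v v) {v : E} (hv : v ≠ 0) :
    ∃ u, formNorm g u = 1 ∧ v = formNorm g v • u := by
  have h0 : formNorm g v ≠ 0 := fun h => hv ((formNorm_eq_zero hp).1 h)
  refine ⟨(formNorm g v)⁻¹ • v, ?_, (smul_inv_smul₀ h0 v).symm⟩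
  rw [formNorm_smul, abs_inv, abs_of_nonneg (formNorm_nonneg g v), inv_mul_cancel₀ h0]

theorem abs_form_le_of_unit (hp : ∀ v, v ≠ 0 → 0 < g v v) {B : E →L[ℝ] E →L[ℝ] ℝ} {C : ℝ}
    (h : ∀ u v, formNorm g u = 1 → formNorm g v = 1 → |B u v| ≤ C) (u v : E) :
    |B u v| ≤ C * formNorm g u * formNorm g v := by
  by_cases hu : u = 0
  · simp [hu, formNorm]
  by_cases hv : v = 0
  · simp [hv, formNorm]
  obtain ⟨u', hu1, hu'⟩ := exists_formNorm_eq_one hp hu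
  obtain ⟨v', hv1, hv'⟩ := exists_formNorm_eq_one hp hv
  have h1 := formNorm_nonneg g u
  have h2 := formNorm_nonneg g v
  generalize formNorm g u = r at *
  generalize formNorm g v = s at *
  subst hu' hv'
  simp only [map_smul, smul_apply, smul_eq_mul, abs_mul, abs_of_nonneg h1, abs_of_nonneg h2]
  have h3 := h u' v' hu1 hv1
  calc s * (r * |B u' v'|) = |B u' v'| * (r * s) := by ring
    _ ≤ C * (r * s) := by gcongr
    _ = C * r * s := by ring

theorem formNorm_apply_le_of_unit (hp : ∀ v, v ≠ 0 → 0 < g v v) {g' : E →L[ℝ] E →L[ℝ] ℝ}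
    {A : E →L[ℝ] E} {C : ℝ} (h : ∀ u, formNorm g u = 1 → formNorm g' (A u) ≤ C) (u : E) :
    formNorm g' (A u) ≤ C * formNorm g u := by
  by_cases hu : u = 0
  · simp [hu, formNorm]
  obtain ⟨u', hu1, hu'⟩ := exists_formNorm_eq_one hp hu
  have h1 := formNorm_nonneg g u
  generalize formNorm g u = r at *
  subst hu'
  rw [map_smul, formNorm_smul, abs_of_nonneg h1, mul_comm]
  gcongr
  exact h u' hu1

end Bounds

/-! ### Uniform bounds on a compact invariant set -/

section Restrict

variable {E : Type*} [NormedAddCommGroup E] [NormedSpace ℝ E] [FiniteDimensional ℝ E]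
  {M : Type*} [TopologicalSpace M] [T2Space M] [ChartedSpace E M] [IsManifold 𝓘(ℝ, E) ∞ M]
  {X : Π x : M, TangentSpace 𝓘(ℝ, E) x} {K : Set M}
  (hX : ContMDiff 𝓘(ℝ, E) 𝓘(ℝ, E).tangent ∞
    (fun x => (⟨x, X x⟩ : TangentBundle 𝓘(ℝ, E) M)))
  (hK : IsCompact K) (hinv : ∀ x ∈ K, ∀ t, (t, x) ∈ flowDomain X → flow X t x ∈ K)
  {g : Π x : M, TangentSpace 𝓘(ℝ, E) x →L[ℝ] TangentSpace 𝓘(ℝ, E) x →L[ℝ] ℝ}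
  (hg : ContMDiff 𝓘(ℝ, E) (𝓘(ℝ, E).prod 𝓘(ℝ, E →L[ℝ] E →L[ℝ] ℝ)) ∞
    (fun x => Bundle.TotalSpace.mk' (E →L[ℝ] E →L[ℝ] ℝ)
      (E := fun x : M => TangentSpace 𝓘(ℝ, E) x →L[ℝ] TangentSpace 𝓘(ℝ, E) x →L[ℝ] ℝ) x (g x)))
  (hpos : ∀ x v, v ≠ 0 → 0 < g x v v)

include hg in
omit [T2Space M] in
theorem tendsto_formNorm {ι : Type*} {l : Filter ι} {x : ι → M} {u : ι → E} {y : M} {v : E}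
    (h : Tendsto (fun i => (⟨x i, u i⟩ : TangentBundle 𝓘(ℝ, E) M)) l (𝓝 ⟨y, v⟩)) :
    Tendsto (fun i => formNorm (E := E) (g (x i)) (u i)) l (𝓝 (formNorm (E := E) (g y) v)) :=
  (Real.continuous_sqrt.tendsto _).comp (tendsto_form_apply hg h h)

include hg hpos in
omit [T2Space M] in
theorem tendsto_formNorm_orthComponent (hsymm : ∀ x v w, g x v w = g x w v)
    {ι : Type*} {l : Filter ι} {x : ι → M} {u w : ι → E} {y : M} {v z : E}
    (hu : Tendsto (fun i => (⟨x i, u i⟩ : TangentBundle 𝓘(ℝ, E) M)) l (𝓝 ⟨y, v⟩))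
    (hw : Tendsto (fun i => (⟨x i, w i⟩ : TangentBundle 𝓘(ℝ, E) M)) l (𝓝 ⟨y, z⟩))
    (hw0 : ∀ i, w i ≠ 0) (hz : z ≠ 0) :
    Tendsto (fun i => formNorm (E := E) (g (x i)) (orthComponent (E := E) (g (x i)) (w i) (u i))) l
      (𝓝 (formNorm (E := E) (g y) (orthComponent (E := E) (g y) z v))) := by
  -- With this formula only values of `g` on convergent vectors are needed; convergence of the
  -- orthogonal components themselves is not.
  have key : ∀ (x : M) (a b : E), a ≠ 0 →
      formNorm (E := E) (g x) (orthComponent (E := E) (g x) a b) =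
        Real.sqrt ((g x b b : ℝ) - (g x b a : ℝ) ^ 2 / (g x a a : ℝ)) := by
    intro x a b ha
    have h1 := formNorm_orthComponent_sq (E := E) (g := g x) (hsymm x) (hpos x) ha b
    rw [← Real.sqrt_sq (formNorm_nonneg (E := E) (g x) _)]
    exact congrArg Real.sqrt h1
  rw [key y z v hz]
  refine Tendsto.congr (fun i => (key (x i) (w i) (u i) (hw0 i)).symm) ?_
  have h1 := tendsto_form_apply hg hu hu
  have h2 := tendsto_form_apply hg hu hw
  have h3 := tendsto_form_apply hg hw hw
  exact (Real.continuous_sqrt.tendsto _).comp (h1.sub ((h2.pow 2).div h3 (hpos y z hz).ne'))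

include hg hpos in
omit [T2Space M] in
theorem exists_tendsto_of_formNorm (hK : IsCompact K) {ι : Type*} (l : Ultrafilter ι) {x : ι → M}
    (hx : ∀ i, x i ∈ K) {u : ι → E} (hu : ∀ i, formNorm (E := E) (g (x i)) (u i) = 1) :
    ∃ y ∈ K, ∃ v : E, Tendsto (fun i => (⟨x i, u i⟩ : TangentBundle 𝓘(ℝ, E) M)) l (𝓝 ⟨y, v⟩) := by
  refine exists_tendsto_tangent hg hpos hK l hx (C := 1) fun i => ?_
  have h1 := formNorm_sq (E := E) (g := g (x i)) (hpos (x i)) (u i)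
  rw [hu i, one_pow] at h1
  exact h1.symm.le

include hg hpos in
theorem exists_form_le (hK : IsCompact K)
    {b : Π x : M, TangentSpace 𝓘(ℝ, E) x →L[ℝ] TangentSpace 𝓘(ℝ, E) x →L[ℝ] ℝ}
    (hb : ContMDiff 𝓘(ℝ, E) (𝓘(ℝ, E).prod 𝓘(ℝ, E →L[ℝ] E →L[ℝ] ℝ)) ∞
      (fun x => Bundle.TotalSpace.mk' (E →L[ℝ] E →L[ℝ] ℝ)
        (E := fun x : M => TangentSpace 𝓘(ℝ, E) x →L[ℝ] TangentSpace 𝓘(ℝ, E) x →L[ℝ] ℝ) x (b x))) :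
    ∃ C : ℝ, ∀ x ∈ K, ∀ u v : E, |(b x u v : ℝ)| ≤
      C * formNorm (E := E) (g x) u * formNorm (E := E) (g x) v := by
  let α := {p : M × E × E // p.1 ∈ K ∧ formNorm (E := E) (g p.1) p.2.1 = 1 ∧
    formNorm (E := E) (g p.1) p.2.2 = 1}
  obtain ⟨C, hC⟩ := exists_bound_of_tendsto (f := fun p : α => |(b p.1.1 p.1.2.1 p.1.2.2 : ℝ)|)
    (fun a => by
      obtain ⟨y, hy, u, hu⟩ := exists_tendsto_of_formNorm hg hpos hK (hyperfilter ℕ)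
        (fun n => (a n).2.1) (fun n => (a n).2.2.1)
      obtain ⟨y', hy', v, hv⟩ := exists_tendsto_of_formNorm hg hpos hK (hyperfilter ℕ)
        (fun n => (a n).2.1) (fun n => (a n).2.2.2)
      obtain rfl := tendsto_nhds_unique (tendsto_tangent_iff.1 hu).1 (tendsto_tangent_iff.1 hv).1
      exact ⟨_, (tendsto_form_apply hb hu hv).abs⟩)
  exact ⟨C, fun x hx => abs_form_le_of_unit (E := E) (g := g x) (B := b x) (hpos x)
    fun u v hu hv => hC ⟨(x, u, v), hx, hu, hv⟩⟩

include hX hK hinv hg hpos in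
theorem exists_dflow_le (T : ℝ) : ∃ C : ℝ, ∀ t : ℝ, |t| ≤ T → ∀ x ∈ K, ∀ u : E,
    formNorm (E := E) (g (flow X t x)) (dflow X t x u) ≤ C * formNorm (E := E) (g x) u := by
  let α := {p : ℝ × M × E // |p.1| ≤ T ∧ p.2.1 ∈ K ∧ formNorm (E := E) (g p.2.1) p.2.2 = 1}
  obtain ⟨C, hC⟩ := exists_bound_of_tendsto (f := fun p : α =>
      formNorm (E := E) (g (flow X p.1.1 p.1.2.1)) (dflow X p.1.1 p.1.2.1 p.1.2.2))
    (fun a => by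
      obtain ⟨y, hy, u, hu⟩ := exists_tendsto_of_formNorm hg hpos hK (hyperfilter ℕ)
        (fun n => (a n).2.2.1) (fun n => (a n).2.2.2)
      obtain ⟨t, -, ht⟩ := (isCompact_Icc (a := -T) (b := T)).ultrafilter_le_nhds
        ((hyperfilter ℕ).map fun n => (a n).1.1)
        (le_principal_iff.2 (mem_map.2 (Eventually.of_forall fun n => abs_le.1 (a n).2.1)))
      exact ⟨_, tendsto_formNorm hg
        (tendsto_tangent_flow hX hK hinv ht hu (fun n => (a n).2.2.1) hy)⟩)
  exact ⟨C, fun t ht x hx => formNorm_apply_le_of_unit (E := E) (g := g x)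
    (g' := g (flow X t x)) (A := dflow X t x) (hpos x) fun u hu => hC ⟨(t, x, u), ht, hx, hu⟩⟩

include hX hK hg in
omit [T2Space M] in
theorem exists_tendsto_field (a : ℕ → K) : ∃ y ∈ K,
    Tendsto (fun n => formNorm (E := E) (g (a n)) (X (a n))) (hyperfilter ℕ)
      (𝓝 (formNorm (E := E) (g y) (X y))) := by
  obtain ⟨y, hy, hay⟩ := hK.ultrafilter_le_nhds ((hyperfilter ℕ).map fun n => (a n : M))
    (le_principal_iff.2 (mem_map.2 (Eventually.of_forall fun n => (a n).2)))
  exact ⟨y, hy, tendsto_formNorm hg ((hX.continuous.tendsto y).comp hay)⟩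

include hX hK hg in
omit [T2Space M] in
theorem exists_field_le : ∃ C : ℝ, ∀ x ∈ K, formNorm (E := E) (g x) (X x) ≤ C := by
  obtain ⟨C, hC⟩ := exists_bound_of_tendsto
    (f := fun x : K => formNorm (E := E) (g x) (X x)) (fun a =>
      (exists_tendsto_field hX hK hg a).imp' _ fun y h => h.2)
  exact ⟨C, fun x hx => hC ⟨x, hx⟩⟩

include hX hK hg hpos in
omit [T2Space M] in
theorem exists_le_field (hX0 : ∀ x ∈ K, X x ≠ 0) :
    ∃ c : ℝ, 0 < c ∧ ∀ x ∈ K, c ≤ formNorm (E := E) (g x) (X x) := by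
  have hne : ∀ x ∈ K, 0 < formNorm (E := E) (g x) (X x) := fun x hx =>
    Real.sqrt_pos.2 (hpos x _ (hX0 x hx))
  obtain ⟨C, hC⟩ := exists_bound_of_tendsto
    (f := fun x : K => (formNorm (E := E) (g x) (X x))⁻¹) (fun a => by
      obtain ⟨y, hy, h⟩ := exists_tendsto_field hX hK hg a
      exact ⟨_, h.inv₀ (hne y hy).ne'⟩)
  refine ⟨(max C 1)⁻¹, by positivity, fun x hx => ?_⟩
  exact inv_le_of_inv_le₀ (hne x hx) ((hC ⟨x, hx⟩).trans (le_max_left _ _))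

end Restrict

end MonotoneHam

namespace MonotoneHam

/-! ### The flow on the level as a monotone cocycle -/

section Cocycle

variable {E : Type*} [NormedAddCommGroup E] [NormedSpace ℝ E] [FiniteDimensional ℝ E]
  {M : Type*} [TopologicalSpace M] [T2Space M] [ChartedSpace E M] [IsManifold 𝓘(ℝ, E) ∞ M]
  {X : Π x : M, TangentSpace 𝓘(ℝ, E) x} {K : Set M}
  {Ω : Π x : M, TangentSpace 𝓘(ℝ, E) x →L[ℝ] TangentSpace 𝓘(ℝ, E) x →L[ℝ] ℝ}
  {Λ : Π x : M, Submodule ℝ (TangentSpace 𝓘(ℝ, E) x)}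
  {g : Π x : M, TangentSpace 𝓘(ℝ, E) x →L[ℝ] TangentSpace 𝓘(ℝ, E) x →L[ℝ] ℝ}

/-- Compactness makes the local monotonicity constants uniform. The curve `w` is a local section of
`Λ` through `v` pulled back by the flow, whose velocity is the bracket. -/
theorem exists_velocity (hΩ : IsSymplecticForm Ω) (hΛ : IsLagrangianDistribution Ω Λ)
    (hX : ContMDiff 𝓘(ℝ, E) 𝓘(ℝ, E).tangent ∞ (fun x => (⟨x, X x⟩ : TangentBundle 𝓘(ℝ, E) M)))
    (hmono : IsMonotone Ω Λ X) (hK : IsCompact K)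
    (hg : ContMDiff 𝓘(ℝ, E) (𝓘(ℝ, E).prod 𝓘(ℝ, E →L[ℝ] E →L[ℝ] ℝ)) ∞
      (fun x => Bundle.TotalSpace.mk' (E →L[ℝ] E →L[ℝ] ℝ)
        (E := fun x : M => TangentSpace 𝓘(ℝ, E) x →L[ℝ] TangentSpace 𝓘(ℝ, E) x →L[ℝ] ℝ) x (g x)))
    (hpos : ∀ x v, v ≠ 0 → 0 < g x v v) :
    ∃ κ : ℝ, 0 < κ ∧ ∀ x ∈ K, ∀ v ∈ Λ x, ∃ (w : ℝ → E) (w' : E), w 0 = v ∧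
      (∀ᶠ s in 𝓝 0, dflow X s x (w s) ∈ Λ (flow X s x)) ∧ HasDerivAt w w' 0 ∧
      κ * g x v v ≤ Ω x w' v := by
  have key : ∃ κ : ℝ, 0 < κ ∧ ∀ x ∈ K, ∀ v ∈ Λ x, ∃ V : Π y : M, TangentSpace 𝓘(ℝ, E) y,
      ContMDiffAt 𝓘(ℝ, E) 𝓘(ℝ, E).tangent ∞ (fun y => (⟨y, V y⟩ : TangentBundle 𝓘(ℝ, E) M)) x ∧
      (∀ᶠ y in 𝓝 x, V y ∈ Λ y) ∧ V x = v ∧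
      κ * g x v v ≤ Ω x (VectorField.mlieBracket 𝓘(ℝ, E) X V x) v := by
    refine hK.induction_on (p := fun S => ∃ κ : ℝ, 0 < κ ∧ ∀ x ∈ S, ∀ v ∈ Λ x,
      ∃ V : Π y : M, TangentSpace 𝓘(ℝ, E) y,
      ContMDiffAt 𝓘(ℝ, E) 𝓘(ℝ, E).tangent ∞ (fun y => (⟨y, V y⟩ : TangentBundle 𝓘(ℝ, E) M)) x ∧
      (∀ᶠ y in 𝓝 x, V y ∈ Λ y) ∧ V x = v ∧
      κ * g x v v ≤ Ω x (VectorField.mlieBracket 𝓘(ℝ, E) X V x) v) ?_ ?_ ?_ ?_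
    · exact ⟨1, one_pos, fun x hx => absurd hx (notMem_empty x)⟩
    · rintro s t hst ⟨κ, hκ, h⟩
      exact ⟨κ, hκ, fun x hx => h x (hst hx)⟩
    · rintro s t ⟨κ, hκ, h⟩ ⟨κ', hκ', h'⟩
      have hmin : ∀ (r : ℝ) (x : M) (v : E), min κ κ' ≤ r → min κ κ' * (g x v v : ℝ) ≤ r * g x v v :=
        fun r x v hr => mul_le_mul_of_nonneg_right hr
          (form_self_nonneg (E := E) (g := g x) (hpos x) v)
      refine ⟨min κ κ', lt_min hκ hκ', fun x hx v hv => ?_⟩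
      rcases hx with hx | hx
      · obtain ⟨V, h1, h2, h3, h4⟩ := h x hx v hv
        exact ⟨V, h1, h2, h3, (hmin κ x v (min_le_left _ _)).trans h4⟩
      · obtain ⟨V, h1, h2, h3, h4⟩ := h' x hx v hv
        exact ⟨V, h1, h2, h3, (hmin κ' x v (min_le_right _ _)).trans h4⟩
    · intro x₀ _
      obtain ⟨κ, hκ, h⟩ := exists_local_velocity hΩ hΛ hX hmono hg x₀
      exact ⟨_, mem_nhdsWithin_of_mem_nhds h, κ, hκ, fun x hx => hx⟩
  obtain ⟨κ, hκ, h⟩ := key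
  refine ⟨κ, hκ, fun x hx v hv => ?_⟩
  obtain ⟨V, h1, h2, rfl, h4⟩ := h x hx v hv
  obtain ⟨w, hw0, hw, hwd⟩ := exists_hasDerivAt_mlieBracket hX h1
  refine ⟨w, _, hw0, ?_, hwd, h4⟩
  have h0 := mem_flowDomain_zero hX x
  have hc : Tendsto (fun s => flow X s x) (𝓝 0) (𝓝 x) := by
    have := (hasMFDerivAt_flow_time hX h0.1).continuousAt.tendsto
    rwa [h0.2] at this
  filter_upwards [hw, hc.eventually h2] with s hs hs'
  have h5 : ∀ z : E, z = V (flow X s x) → z ∈ Λ (flow X s x) := by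
    rintro z rfl
    exact hs'
  exact h5 _ hs

/-- The flow of `X` on an invariant set. -/
noncomputable def restrictFlow (X : Π x : M, TangentSpace 𝓘(ℝ, E) x) {K : Set M}
    (h : ∀ x ∈ K, ∀ t, flow X t x ∈ K) (t : ℝ) (x : K) : K := ⟨flow X t x, h x x.2 t⟩

/-- All tangent spaces are definitionally `E`, so the differential of the flow is a cocycle with
values in one fixed space. Compactness of `K` enters the axioms only through uniform constants and
limits along the hyperfilter. -/
theorem monotoneCocycle_restrictFlow (hΩ : IsSymplecticForm Ω) (hΛ : IsLagrangianDistribution Ω Λ)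
    (hX : ContMDiff 𝓘(ℝ, E) 𝓘(ℝ, E).tangent ∞ (fun x => (⟨x, X x⟩ : TangentBundle 𝓘(ℝ, E) M)))
    (hmono : IsMonotone Ω Λ X) (hconj : NoConjugatePoints Λ X) (hK : IsCompact K)
    (hinv : ∀ x ∈ K, ∀ t, (t, x) ∈ flowDomain X → flow X t x ∈ K)
    (hsymp : ∀ x ∈ K, ∀ (t : ℝ) (u v : E),
      Ω (flow X t x) (dflow X t x u) (dflow X t x v) = Ω x u v)
    (hX0 : ∀ x ∈ K, X x ≠ 0)
    (hg : ContMDiff 𝓘(ℝ, E) (𝓘(ℝ, E).prod 𝓘(ℝ, E →L[ℝ] E →L[ℝ] ℝ)) ∞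
      (fun x => Bundle.TotalSpace.mk' (E →L[ℝ] E →L[ℝ] ℝ)
        (E := fun x : M => TangentSpace 𝓘(ℝ, E) x →L[ℝ] TangentSpace 𝓘(ℝ, E) x →L[ℝ] ℝ) x (g x)))
    (hsymm : ∀ x v w, g x v w = g x w v) (hpos : ∀ x v, v ≠ 0 → 0 < g x v v) :
    MonotoneCocycle (E := E)
      (restrictFlow X fun _ hx t => flow_mem_of_mem hX hK hinv hx t)
      (fun t x => dflow X t x.1) (fun x => Ω x.1) (fun x => Λ x.1) (fun x => X x.1)
      (fun x => g x.1) where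
  flow_zero x := Subtype.ext (mem_flowDomain_zero hX x.1).2
  flow_add s t x := Subtype.ext (flow_add_apply hX hK hinv x.2 s t)
  deriv_zero x v := dflow_zero_apply hX x.1 v
  deriv_add s t x v := dflow_add_apply hX hK hinv x.2 s t v
  alternating x v := hΩ.alternating x.1 v
  nondegenerate x v := hΩ.nondegenerate x.1 v
  symplectic t x u v := hsymp x.1 x.2 t u v
  deriv_field t x := dflow_field hX hK hinv x.2 t
  field_ne x := hX0 x.1 x.2
  lagrangian x v := hΛ.lagrangian x.1 v
  transversal t x ht := hconj t x.1 (mem_flowDomain_of_mem hX hK hinv x.2 t) ht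
  metric_symm x v w := hsymm x.1 v w
  metric_pos x v hv := hpos x.1 v hv
  velocity := by
    obtain ⟨κ, hκ, h⟩ := exists_velocity hΩ hΛ hX hmono hK hg hpos
    exact ⟨κ, hκ, fun x => h x.1 x.2⟩
  form_bounded := by
    obtain ⟨C, hC⟩ := exists_form_le hg hpos hK hΩ.smooth
    exact ⟨C, fun x => hC x.1 x.2⟩
  deriv_bounded T := by
    obtain ⟨C, hC⟩ := exists_dflow_le hX hK hinv hg hpos T
    exact ⟨C, fun t x u ht => hC t ht x.1 x.2 u⟩
  field_bounded := by
    obtain ⟨C, hC⟩ := exists_field_le hX hK hg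
    exact ⟨C, fun x => hC x.1 x.2⟩
  field_bounded_below := by
    obtain ⟨c, hc, h⟩ := exists_le_field hX hK hg hpos hX0
    exact ⟨c, hc, fun x => h x.1 x.2⟩
  compact x u hu := by
    obtain ⟨y, hy, v, hv⟩ := exists_tendsto_of_formNorm hg hpos hK (hyperfilter ℕ)
      (fun n => (x n).2) hu
    have hflow : ∀ t : ℝ, Tendsto (fun n => (⟨flow X t (x n).1, dflow X t (x n).1 (u n)⟩ :
        TangentBundle 𝓘(ℝ, E) M)) (hyperfilter ℕ) (𝓝 ⟨flow X t y, dflow X t y v⟩) := fun t =>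
      tendsto_tangent_flow hX hK hinv tendsto_const_nhds hv (fun n => (x n).2) hy
    have hfield : ∀ {z : ℕ → M} {z₀ : M}, Tendsto z (hyperfilter ℕ) (𝓝 z₀) →
        Tendsto (fun n => (⟨z n, X (z n)⟩ : TangentBundle 𝓘(ℝ, E) M)) (hyperfilter ℕ)
          (𝓝 ⟨z₀, X z₀⟩) := fun h => (hX.continuous.tendsto _).comp h
    refine ⟨⟨y, hy⟩, v, fun t => tendsto_formNorm hg (hflow t), fun t => ?_, ?_, fun h => ?_⟩
    · exact tendsto_formNorm_orthComponent hg hpos hsymm (hflow t)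
        (hfield (tendsto_tangent_iff.1 (hflow t)).1)
        (fun n => hX0 _ (flow_mem_of_mem hX hK hinv (x n).2 t))
        (hX0 _ (flow_mem_of_mem hX hK hinv hy t))
    · exact tendsto_form_apply hΩ.smooth (hfield (tendsto_tangent_iff.1 hv).1) hv
    · exact mem_of_tendsto_tangent hΩ hΛ hv h

end Cocycle

end MonotoneHam

/-! ### The theorem -/

theorem mainTheorem4 {E : Type*} [NormedAddCommGroup E] [NormedSpace ℝ E] [FiniteDimensional ℝ E]
    {M : Type*} [TopologicalSpace M] [T2Space M] [SigmaCompactSpace M]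
    [ChartedSpace E M] [IsManifold 𝓘(ℝ, E) ∞ M]
    (Ω : Π x : M, TangentSpace 𝓘(ℝ, E) x →L[ℝ] TangentSpace 𝓘(ℝ, E) x →L[ℝ] ℝ)
    (hΩ : MonotoneHam.IsSymplecticForm Ω)
    (Λ : Π x : M, Submodule ℝ (TangentSpace 𝓘(ℝ, E) x))
    (hΛ : MonotoneHam.IsLagrangianDistribution Ω Λ)
    (H : M → ℝ) (hH : ContMDiff 𝓘(ℝ, E) 𝓘(ℝ, ℝ) ∞ H)
    (hmono : MonotoneHam.IsMonotone Ω Λ (MonotoneHam.hamField Ω H))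
    (hconj : MonotoneHam.NoConjugatePoints Λ (MonotoneHam.hamField Ω H))
    (c : ℝ) (hc : MonotoneHam.IsRegularValue E H c) (hcpt : IsCompact (H ⁻¹' {c})) :
    -- the limits that define `Δ⁺` and `Δ⁻` on the level set exist
    (∀ x : M, H x = c →
      MonotoneHam.TendstoGrassmannian (MonotoneHam.jacobiCurve Λ (MonotoneHam.hamField Ω H) x)
        atTop (MonotoneHam.greenPlus Λ (MonotoneHam.hamField Ω H) x) ∧
      MonotoneHam.TendstoGrassmannian (MonotoneHam.jacobiCurve Λ (MonotoneHam.hamField Ω H) x)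
        atBot (MonotoneHam.greenMinus Λ (MonotoneHam.hamField Ω H) x)) ∧
    List.TFAE [
      MonotoneHam.IsAnosovOnLevel (MonotoneHam.hamField Ω H) H c,
      ∀ x : M, H x = c →
        MonotoneHam.greenPlus Λ (MonotoneHam.hamField Ω H) x ⊔
          MonotoneHam.greenMinus Λ (MonotoneHam.hamField Ω H) x = MonotoneHam.levelTangent H x,
      ∀ x : M, H x = c →
        MonotoneHam.greenPlus Λ (MonotoneHam.hamField Ω H) x ⊓
          MonotoneHam.greenMinus Λ (MonotoneHam.hamField Ω H) x =
            Submodule.span ℝ {MonotoneHam.hamField Ω H x}] := by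
  classical
  have hX := MonotoneHam.contMDiff_hamField hΩ hH
  have hinv : ∀ x ∈ H ⁻¹' {c}, ∀ t, (t, x) ∈ MonotoneHam.flowDomain (MonotoneHam.hamField Ω H) →
      MonotoneHam.flow (MonotoneHam.hamField Ω H) t x ∈ H ⁻¹' {c} := fun x hx t ht =>
    (MonotoneHam.hamiltonian_flow hΩ hH ht).trans hx
  have hsymp : ∀ x ∈ H ⁻¹' {c}, ∀ (t : ℝ) (u v : E),
      Ω (MonotoneHam.flow (MonotoneHam.hamField Ω H) t x)
        (MonotoneHam.dflow (MonotoneHam.hamField Ω H) t x u)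
        (MonotoneHam.dflow (MonotoneHam.hamField Ω H) t x v) = Ω x u v := fun x hx t u v =>
    MonotoneHam.form_dflow hΩ hH hcpt hinv hx t u v
  have hker : ∀ x, LinearMap.ker (M₂ := ℝ) (Ω x (MonotoneHam.hamField Ω H x)).toLinearMap =
      MonotoneHam.levelTangent H x := fun x => by
    ext v
    have h1 := MonotoneHam.hamField_spec Ω H x (hΩ.nondegenerate x) v
    change (Ω x (MonotoneHam.hamField Ω H x) v : ℝ) = 0 ↔ MonotoneHam.dirDeriv H x v = 0
    rw [h1, neg_eq_zero]
  have hX0 : ∀ x ∈ H ⁻¹' {c}, MonotoneHam.hamField Ω H x ≠ 0 := fun x hx h0 => hc x hx <| by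
    ext v
    have h1 := MonotoneHam.hamField_spec Ω H x (hΩ.nondegenerate x) v
    rw [h0, map_zero] at h1
    exact neg_eq_zero.1 h1.symm
  -- From here on only the consequences just collected matter: smoothness, invariance of the level
  -- and of the form, its kernel, and absence of zeros.
  generalize MonotoneHam.hamField Ω H = X at *
  -- The metric stays arbitrary because statement 1 supplies its own, while `g₀` serves everywhere
  -- else.
  have hcoc : ∀ g : Bundle.ContMDiffRiemannianMetric 𝓘(ℝ, E) ∞ E
      (fun x : M => TangentSpace 𝓘(ℝ, E) x), _ := fun g =>
    MonotoneHam.monotoneCocycle_restrictFlow hΩ hΛ hX hmono hconj hcpt hinv hsymp hX0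
      g.contMDiff g.symm g.pos
  obtain ⟨g₀⟩ := MonotoneHam.nonempty_contMDiffRiemannianMetric (E := E) (M := M)
  have h23 : ∀ x : M, H x = c → (MonotoneHam.greenPlus Λ X x ⊔ MonotoneHam.greenMinus Λ X x =
      MonotoneHam.levelTangent H x ↔ MonotoneHam.greenPlus Λ X x ⊓ MonotoneHam.greenMinus Λ X x =
        Submodule.span ℝ {X x}) := fun x hx => by
    rw [← hker x]
    exact (hcoc g₀).sup_eq_iff_inf_eq ⟨x, hx⟩
  refine ⟨fun x hx => ⟨(hcoc g₀).tendstoGrassmannian_atTop ⟨x, hx⟩,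
    (hcoc g₀).tendstoGrassmannian_atBot ⟨x, hx⟩⟩, ?_⟩
  tfae_have 2 ↔ 3 := forall₂_congr h23
  tfae_have 1 → 2 := by
    rintro ⟨g, Ep, Em, c₁, c₂, hc₁, hc₂, h⟩ x hx
    obtain ⟨⟨-, hsup⟩, -, hp, hm⟩ := h x hx
    -- Of the Anosov estimates only the boundedness of half-orbits is used.
    have hexp : ∀ t : ℝ, 0 ≤ t → Real.exp (-c₂ * t) ≤ 1 := fun t ht =>
      Real.exp_le_one_iff.2 (by nlinarith)
    have hbd : ∀ (v : E) (t r : ℝ), 0 ≤ t → r ≤ c₁ * Real.exp (-c₂ * t) *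
        MonotoneHam.metricNorm g x v → r ≤ c₁ * MonotoneHam.metricNorm g x v := fun v t r ht hr =>
      hr.trans (mul_le_mul_of_nonneg_right (mul_le_of_le_one_right hc₁.le (hexp t ht))
        (Real.sqrt_nonneg _))
    rw [← hker x] at hsup ⊢
    exact (hcoc g).sup_eq_of_splitting (x := ⟨x, hx⟩) hsup
      (fun v hv t ht => hbd v t _ ht (hp t ht v hv))
      (fun v hv t ht => hbd v t _ ht (hm t ht v hv))
  tfae_have 3 → 1 := by
    intro h
    obtain ⟨Ep, Em, c₁, c₂, hc₁, hc₂, hsplit⟩ :=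
      (hcoc g₀).exists_anosov_splitting fun x => h x.1 x.2
    -- The subspaces are needed on all of `M`; the value off the level is irrelevant since the flow
    -- preserves the level.
    let Fp : Π x : M, Submodule ℝ (TangentSpace 𝓘(ℝ, E) x) :=
      fun x => if hx : H x = c then Ep ⟨x, hx⟩ else ⊥
    let Fm : Π x : M, Submodule ℝ (TangentSpace 𝓘(ℝ, E) x) :=
      fun x => if hx : H x = c then Em ⟨x, hx⟩ else ⊥
    have hFp : ∀ (x : M) (hx : H x = c), Fp x = Ep ⟨x, hx⟩ := fun x hx => dif_pos hx
    have hFm : ∀ (x : M) (hx : H x = c), Fm x = Em ⟨x, hx⟩ := fun x hx => dif_pos hx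
    refine ⟨g₀, Fp, Fm, c₁, c₂, hc₁, hc₂, fun x hx => ?_⟩
    have hflow : ∀ t, H (MonotoneHam.flow X t x) = c := fun t =>
      MonotoneHam.flow_mem_of_mem hX hcpt hinv (K := H ⁻¹' {c}) hx t
    have h1 := hsplit ⟨x, hx⟩
    rw [hFp x hx, hFm x hx, ← hker x]
    refine ⟨h1.1, fun t => ?_, h1.2.2.1, h1.2.2.2⟩
    rw [hFp _ (hflow t), hFm _ (hflow t)]
    exact h1.2.1 t
  tfae_finish
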